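/- Identify $\mathbb{R}^4$ with the quaternions (basis $1,i,j,k$) and $SU(2)$ with the unit quaternions, and let $\tau=\frac12(1+\sqrt5)$. Let $\tilde I=\langle i,\ \frac12(1+i-j+k),\ \frac12(\tau+(\tau-1)j+k)\rangle$ be the binary icosahedral group, $\tilde O=\langle i,\ \frac1{\sqrt2}(1+i),\ \frac12(1+i-j+k)\rangle$ the binary octahedral group, and let $IO\subset SO(4)$ be the image of $\tilde I\times\tilde O$ under the double covering $SU(2)\times SU(2)\to SO(4)$, $(a,b)\mapsto(x\mapsto axb^{-1})$. The group $IO$ acts on $\mathbb{C}^4$ and on $\mathbb{P}_3(\mathbb{C})$. Put $$q=x_0^2+x_1^2+x_2^2+x_3^2,\quad f_0=x_0^4+x_1^4+x_2^4+x_3^4,\quad f_4=4x_0x_1x_2x_3,$$ $$f_1=2(x_0^2x_1^2+x_2^2x_3^2),\quad f_2=2(x_0^2x_2^2+x_1^2x_3^2),\quad f_3=2(x_0^2x_3^2+x_1^2x_2^2),$$ $$F_a=f_1^2f_2+f_3^2f_1+f_2^2f_3-f_1f_2^2-f_3f_1^2-f_2f_3^2,$$ $$\begin{aligned}S_{IO}={}&-\sum_i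 f_i^3+11\sum_{i\ne j}f_i^2f_j+(f_0^2-14f_4^2)\sum_i f_i+30f_0f_4^2-4f_0\sum_{i\neq j}f_if_j-30f_1f_2f_3\\&+3\sqrt5\,f_4\Big(2f_0\sum_i f_i-\sum_{i\ne j}f_if_j-f_0^2-\sum_i f_i^2+4f_4^2\Big)+6\sqrt5\,F_a,\end{aligned}$$ where $i,j$ run over $\{1,2,3\}$ and $\sum_{i\neq j}$ is over ordered pairs. Proposition. The polynomials $q$ and $S_{IO}$ are $IO$-invariant. Consider the pencil of surfaces in $\mathbb{P}_3(\mathbb{C})$ of degree $12$ consisting of the surfaces $S_{IO}+\lambda q^6=0$, $\lambda\in\mathbb{C}$, and of $q^6=0$ ($\lambda=\infty$). The surfaces of the pencil that have an isolated singular point (an isolated point of the singular locus) are exactly those with $$\lambda\in\{0,\ c_1,\ -\tfrac18,\ c_2\},\qquad c_1=-\tfrac{74}{972}+\tfrac{4}{243}\sqrt{10},\quad c_2=-\tfrac{74}{972}-\tfrac{4}{243}\sqrt{10}.$$ On every surface $S_{IO}+\lambda q^6=0$ the isolated singular points are exactly the nodes (ordinary double points). For $\lambda=0,\ c_1,\ -\frac18,\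 c_2$ the nodes form a single $IO$-orbit, consisting of $120$, $240$, $360$ and $240$ points respectively, and the stabilizer in $IO$ of each node, modulo $\pm1$, is isomorphic to the alternating group $A_4$, the dihedral group $D_3$ of order $6$, $\mathbb{Z}_2\times\mathbb{Z}_2$ and $D_3$ respectively. -/

import Mathlib

open scoped LinearAlgebra.Projectivization Quaternion

noncomputable section

namespace IOPencil

/-! ### Unit quaternions and the binary polyhedral groups

`SU(2)` is realised as the group of unit quaternions: the quaternion `a + b i + c j + d k`
corresponds to the matrix with rows `(a + b i, c + d i)` and `(-c + d i, a - b i)`. -/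

/-- The group of unit quaternions, that is `SU(2)`. -/
abbrev UnitQuaternions : Type := unitary ℍ[ℝ]

/-- The quaternion `a + b i + c j + d k`. -/
def quat (a b c d : ℝ) : ℍ[ℝ] := ⟨a, b, c, d⟩

theorem mem_unitary_iff_normSq (x : ℍ[ℝ]) : x ∈ unitary ℍ[ℝ] ↔ Quaternion.normSq x = 1 := by
  rw [Unitary.mem_iff, Quaternion.star_mul_self, Quaternion.self_mul_star, and_self]
  refine ⟨fun h => ?_, fun h => by rw [h]; rfl⟩
  simpa using congrArg QuaternionAlgebra.re h

theorem sq_sum_of_mem (a : UnitQuaternions) :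
    a.1.re ^ 2 + a.1.imI ^ 2 + a.1.imJ ^ 2 + a.1.imK ^ 2 = 1 := by
  rw [← Quaternion.normSq_def']
  exact (mem_unitary_iff_normSq a.1).mp a.2

/-- The unit quaternion `a + b i + c j + d k`. -/
def unitQuat (a b c d : ℝ) (h : a ^ 2 + b ^ 2 + c ^ 2 + d ^ 2 = 1) : UnitQuaternions :=
  ⟨quat a b c d, (mem_unitary_iff_normSq _).mpr (by rw [Quaternion.normSq_def']; exact h)⟩

/-- The golden ratio. -/
def tau : ℝ := (1 + √5) / 2

theorem tau_sq : tau ^ 2 = tau + 1 := by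
  have h : √5 ^ 2 = 5 := Real.sq_sqrt (by norm_num)
  unfold tau
  nlinarith

/-- The lift `diag(i, -i)` of the rotation `A₁`. -/
def A1 : UnitQuaternions := unitQuat 0 1 0 0 (by norm_num)

/-- The lift of the rotation `S` of order three. -/
def S : UnitQuaternions := unitQuat (1 / 2) (1 / 2) (-1 / 2) (1 / 2) (by norm_num)

/-- The lift of the rotation `U` of order five. -/
def U : UnitQuaternions := unitQuat (tau / 2) 0 ((tau - 1) / 2) (1 / 2) (by
  linarith [tau_sq, show (tau / 2) ^ 2 + 0 ^ 2 + ((tau - 1) / 2) ^ 2 + (1 / 2) ^ 2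
    = (tau ^ 2 - tau + 1) / 2 by ring])

/-- The lift `diag(exp(iπ/4), exp(-iπ/4))` of the rotation `R₄` of order four. -/
def R4 : UnitQuaternions :=
  unitQuat (Real.cos (Real.pi / 4)) (Real.sin (Real.pi / 4)) 0 0 (by
    linarith [Real.cos_sq_add_sin_sq (Real.pi / 4)])

/-- The binary icosahedral group (of order 120). -/
def binaryIcosahedral : Subgroup UnitQuaternions := Subgroup.closure {A1, S, U}

/-- The binary octahedral group (of order 48). -/
def binaryOctahedral : Subgroup UnitQuaternions := Subgroup.closure {A1, R4, S}

/-! ### The double covering `SU(2) × SU(2) → SO(4)` -/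

/-- The coordinates of a quaternion in the basis `1, i, j, k`. -/
def coords (x : ℍ[ℝ]) : Fin 4 → ℝ := ![x.re, x.imI, x.imJ, x.imK]

/-- The matrix of `x ↦ a * x` in the basis `1, i, j, k`. -/
def leftMatrix (a : ℍ[ℝ]) : Matrix (Fin 4) (Fin 4) ℝ :=
  !![a.re, -a.imI, -a.imJ, -a.imK;
     a.imI, a.re, -a.imK, a.imJ;
     a.imJ, a.imK, a.re, -a.imI;
     a.imK, -a.imJ, a.imI, a.re]

/-- The matrix of `x ↦ x * star b` in the basis `1, i, j, k`;
for a unit quaternion `star b = b⁻¹`. -/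
def rightMatrix (b : ℍ[ℝ]) : Matrix (Fin 4) (Fin 4) ℝ :=
  !![b.re, b.imI, b.imJ, b.imK;
     -b.imI, b.re, -b.imK, b.imJ;
     -b.imJ, b.imK, b.re, -b.imI;
     -b.imK, -b.imJ, b.imI, b.re]

theorem leftMatrix_mulVec (a x : ℍ[ℝ]) :
    Matrix.mulVec (leftMatrix a) (coords x) = coords (a * x) := by
  ext i
  fin_cases i <;> simp [leftMatrix, coords, Matrix.mulVec, dotProduct, Fin.sum_univ_four] <;> ring

theorem rightMatrix_mulVec (b x : ℍ[ℝ]) :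
    Matrix.mulVec (rightMatrix b) (coords x) = coords (x * star b) := by
  ext i
  fin_cases i <;> simp [rightMatrix, coords, Matrix.mulVec, dotProduct, Fin.sum_univ_four] <;> ring

theorem leftMatrix_mul (a b : ℍ[ℝ]) : leftMatrix (a * b) = leftMatrix a * leftMatrix b := by
  ext i j
  fin_cases i <;> fin_cases j <;>
    simp [leftMatrix, Matrix.mul_apply, Fin.sum_univ_four] <;> ring

theorem rightMatrix_mul (a b : ℍ[ℝ]) : rightMatrix (a * b) = rightMatrix a * rightMatrix b := by
  ext i j
  fin_cases i <;> fin_cases j <;>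
    simp [rightMatrix, Matrix.mul_apply, Fin.sum_univ_four] <;> ring

theorem leftMatrix_comm (a b : ℍ[ℝ]) :
    leftMatrix a * rightMatrix b = rightMatrix b * leftMatrix a := by
  ext i j
  fin_cases i <;> fin_cases j <;>
    simp [leftMatrix, rightMatrix, Matrix.mul_apply, Fin.sum_univ_four] <;> ring

theorem leftMatrix_mem (a : UnitQuaternions) :
    leftMatrix a.1 ∈ Matrix.specialOrthogonalGroup (Fin 4) ℝ := by
  have h := sq_sum_of_mem a
  rw [Matrix.mem_specialOrthogonalGroup_iff, Matrix.mem_orthogonalGroup_iff]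
  constructor
  · ext i j
    fin_cases i <;> fin_cases j <;>
      simp [leftMatrix, Matrix.mul_apply, Fin.sum_univ_four] <;> linarith
  · have : (leftMatrix a.1).det
        = (a.1.re ^ 2 + a.1.imI ^ 2 + a.1.imJ ^ 2 + a.1.imK ^ 2) ^ 2 := by
      simp [leftMatrix, Matrix.det_succ_row_zero, Fin.sum_univ_succ, Fin.succAbove]
      ring
    rw [this, h, one_pow]

theorem rightMatrix_mem (a : UnitQuaternions) :
    rightMatrix a.1 ∈ Matrix.specialOrthogonalGroup (Fin 4) ℝ := by
  have h := sq_sum_of_mem a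
  rw [Matrix.mem_specialOrthogonalGroup_iff, Matrix.mem_orthogonalGroup_iff]
  constructor
  · ext i j
    fin_cases i <;> fin_cases j <;>
      simp [rightMatrix, Matrix.mul_apply, Fin.sum_univ_four] <;> linarith
  · have : (rightMatrix a.1).det
        = (a.1.re ^ 2 + a.1.imI ^ 2 + a.1.imJ ^ 2 + a.1.imK ^ 2) ^ 2 := by
      simp [rightMatrix, Matrix.det_succ_row_zero, Fin.sum_univ_succ, Fin.succAbove]
      ring
    rw [this, h, one_pow]

/-- The double covering `SU(2) × SU(2) → SO(4)`, sending `(a, b)` to `x ↦ a * x * b⁻¹`. -/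
def doubleCover :
    UnitQuaternions × UnitQuaternions →* Matrix.specialOrthogonalGroup (Fin 4) ℝ where
  toFun p := ⟨leftMatrix p.1.1 * rightMatrix p.2.1,
    mul_mem (leftMatrix_mem p.1) (rightMatrix_mem p.2)⟩
  map_one' := by
    apply Subtype.ext
    ext i j
    fin_cases i <;> fin_cases j <;>
      simp [leftMatrix, rightMatrix, Matrix.mul_apply, Fin.sum_univ_four]
  map_mul' p r := by
    apply Subtype.ext
    change leftMatrix (p.1.1 * r.1.1) * rightMatrix (p.2.1 * r.2.1)
      = (leftMatrix p.1.1 * rightMatrix p.2.1) * (leftMatrix r.1.1 * rightMatrix r.2.1)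
    rw [leftMatrix_mul, rightMatrix_mul, Matrix.mul_assoc, Matrix.mul_assoc,
      ← Matrix.mul_assoc (leftMatrix r.1.1), leftMatrix_comm, Matrix.mul_assoc]

/-! ### The group `IO` and its action on complex projective space -/

/-- `ℂ⁴`. -/
abbrev V : Type := Fin 4 → ℂ

/-- The group `GL(4, ℂ)` of linear automorphisms of `ℂ⁴`; it acts on `ℙ ℂ V`. -/
abbrev GL4 : Type := LinearMap.GeneralLinearGroup ℂ V

/-- The inclusion of `SO(4)` into `GL(4, ℂ)`. -/
def complexify : Matrix.specialOrthogonalGroup (Fin 4) ℝ →* GL4 :=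
  MonoidHom.toHomUnits
    (((Matrix.toLinAlgEquiv' (R := ℂ) (n := Fin 4)).toAlgHom : _ →* Module.End ℂ V).comp
      ((Complex.ofRealHom.mapMatrix (m := Fin 4)).toMonoidHom.comp
        (Matrix.specialOrthogonalGroup (Fin 4) ℝ).subtype))

/-- The group `IO`: the image in `SO(4) ⊆ GL(4, ℂ)` of the product of the binary icosahedral
group and the binary octahedral group. -/
def icosaOcta : Subgroup GL4 :=
  (binaryIcosahedral.prod binaryOctahedral).map (complexify.comp doubleCover)

/-- The group `{1, -1}`. -/
def signs : Subgroup GL4 := Subgroup.zpowers (-1)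

instance signs_normal : signs.Normal where
  conj_mem n hn g := by
    obtain ⟨k, rfl⟩ := Subgroup.mem_zpowers_iff.mp hn
    have h1 : g * (-1) * g⁻¹ = (-1 : GL4) := by
      rw [show (-1 : GL4) = (-1 : (Module.End ℂ V)ˣ) from rfl]
      rw [show g * (-1 : (Module.End ℂ V)ˣ) = -(g * 1) from Units.ext (mul_neg g.1 1), mul_one]
      exact Units.ext (by simp)
    have h : g * (-1) ^ k * g⁻¹ = (-1 : GL4) ^ k := by
      rw [← conj_zpow, h1]
    rw [h]
    exact Subgroup.zpow_mem _ (Subgroup.mem_zpowers _) k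

/-- The fix group in `IO` of a point of projective space. -/
def fixGroup (p : ℙ ℂ V) : Subgroup GL4 := icosaOcta ⊓ MulAction.stabilizer GL4 p

/-- The fix group of `p` modulo `± 1`. -/
abbrev FixGroupModSigns (p : ℙ ℂ V) : Type := fixGroup p ⧸ signs.subgroupOf (fixGroup p)

/-! ### The pencil -/

open MvPolynomial

/-- Complex polynomials in `x₀, x₁, x₂, x₃`. -/
abbrev Poly : Type := MvPolynomial (Fin 4) ℂ

/-- The quadric `x₀² + x₁² + x₂² + x₃²`. -/
def q : Poly := X 0 ^ 2 + X 1 ^ 2 + X 2 ^ 2 + X 3 ^ 2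

def f0 : Poly := X 0 ^ 4 + X 1 ^ 4 + X 2 ^ 4 + X 3 ^ 4

def f1 : Poly := 2 * (X 0 ^ 2 * X 1 ^ 2 + X 2 ^ 2 * X 3 ^ 2)

def f2 : Poly := 2 * (X 0 ^ 2 * X 2 ^ 2 + X 1 ^ 2 * X 3 ^ 2)

def f3 : Poly := 2 * (X 0 ^ 2 * X 3 ^ 2 + X 1 ^ 2 * X 2 ^ 2)

def f4 : Poly := 4 * (X 0 * X 1 * X 2 * X 3)

/-- `f₁, f₂, f₃` as a family. -/
def f : Fin 3 → Poly := ![f1, f2, f3]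

def sqrt5 : Poly := C ((√5 : ℝ) : ℂ)

/-- The sum of `f i ^ 2 * f j` over all ordered pairs `i ≠ j`. -/
def sumSqMul : Poly := ∑ i, ∑ j ∈ Finset.univ.filter (fun j => j ≠ i), f i ^ 2 * f j

/-- The sum of `f i * f j` over all ordered pairs `i ≠ j`. -/
def sumMul : Poly := ∑ i, ∑ j ∈ Finset.univ.filter (fun j => j ≠ i), f i * f j

def Fa : Poly :=
  f1 ^ 2 * f2 + f3 ^ 2 * f1 + f2 ^ 2 * f3 - f1 * f2 ^ 2 - f3 * f1 ^ 2 - f2 * f3 ^ 2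

/-- The nontrivial `IO`-invariant polynomial of degree twelve. -/
def invForm : Poly :=
  -(∑ i, f i ^ 3) + 11 * sumSqMul + (f0 ^ 2 - 14 * f4 ^ 2) * (∑ i, f i) + 30 * f0 * f4 ^ 2
    - 4 * f0 * sumMul - 30 * f1 * f2 * f3
    + 3 * sqrt5 * f4 * (2 * f0 * (∑ i, f i) - sumMul - f0 ^ 2 - (∑ i, f i ^ 2) + 4 * f4 ^ 2)
    + 6 * sqrt5 * Fa

/-- The member `S_IO + λ q⁶` of the pencil. -/
def pencil (lam : ℂ) : Poly := invForm + C lam * q ^ 6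

/-- `c₁ = -74/972 + (4/243) √10`. -/
def c1 : ℂ := ((-74 / 972 + 4 / 243 * √10 : ℝ) : ℂ)

/-- `c₂ = -74/972 - (4/243) √10`. -/
def c2 : ℂ := ((-74 / 972 - 4 / 243 * √10 : ℝ) : ℂ)

/-- A polynomial is invariant under a linear automorphism of `ℂ⁴`. -/
def IsInvariant (g : GL4) (F : Poly) : Prop := ∀ v : V, eval (g • v) F = eval v F

/-! ### Singular points of the projective surface `F = 0`, for a homogeneous form `F` -/

/-- `p` is a singular point of the surface `F = 0`. -/
def IsSingularPoint (F : Poly) (p : ℙ ℂ V) : Prop :=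
  eval p.rep F = 0 ∧ ∀ i, eval p.rep (pderiv i F) = 0

/-- `p` is an isolated point of the singular locus of `F = 0`: all singular points with
homogeneous coordinates near to those of `p` are equal to `p`. -/
def IsIsolatedSingularPoint (F : Poly) (p : ℙ ℂ V) : Prop :=
  IsSingularPoint F p ∧
    ∀ᶠ w in nhds p.rep, ∀ hw : w ≠ 0,
      IsSingularPoint F (Projectivization.mk ℂ w hw) → Projectivization.mk ℂ w hw = p

/-- The Hessian matrix of `F` at the point `v`. -/
def hessian (F : Poly) (v : V) : Matrix (Fin 4) (Fin 4) ℂ :=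
  Matrix.of fun i j => eval v (pderiv i (pderiv j F))

/-- `p` is a node (ordinary double point) of `F = 0`: a singular point at which the `3 × 3` Hessian
matrix of the equation of the surface in every affine chart `x i ≠ 0` containing `p` is
nondegenerate. The chart is taken as the hyperplane `x i = v i` through the representative `v`
of `p`, on which the remaining three coordinates are affine coordinates. -/
def IsNode (F : Poly) (p : ℙ ℂ V) : Prop :=
  IsSingularPoint F p ∧
    ∀ i : Fin 4, p.rep i ≠ 0 →
      ((hessian F p.rep).submatrix i.succAbove i.succAbove).det ≠ 0

/-- The set of nodes of `F = 0`. -/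
def nodes (F : Poly) : Set (ℙ ℂ V) := {p | IsNode F p}

/-- The nodes of `F = 0` form one `IO`-orbit of length `n`, and the fix group in `IO` of each of
them, modulo `± 1`, is isomorphic to `H`. -/
def NodesFormOrbit (F : Poly) (n : ℕ) (H : Type) [Group H] : Prop :=
  (∃ p, nodes F = MulAction.orbit icosaOcta p) ∧ (nodes F).ncard = n ∧
    ∀ p ∈ nodes F, Nonempty (FixGroupModSigns p ≃* H)

end IOPencil

end

/-!
The five quartics `f₀, …, f₄` satisfy one quartic relation, `q²` is the sum `f₀ + f₁ + f₂ + f₃`, and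
every surface `S_IO + λ q⁶` is the pull-back of a cubic in the five quartics. The proof works with
the image of `ℂ⁴` in this five-dimensional space.

*Singular points off the quadric.* By the chain rule the gradient of the cubic lies in the kernel of
the Jacobian matrix of the quartics, which is spanned by the vector of its maximal minors, that is,
by the gradient of the quartic relation. So a singular vector with `q ≠ 0` either maps to the
singular locus of the quartic or satisfies Lagrange equations (`exists_multiplier`). The
multiplications by the quaternion `S` of order three from both sides act on the space of quartics
through cube roots of unity; in coordinates `x, x', y, y'` diagonalising them the Lagrange equations
split into two pairs and can be solved (`critClass_of_lagrange`). The solutions are known only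
through the invariants `x x', x³, x'³, y y', y³, y'³`, but the quartics separate the orbits of the
group generated by the multiplications by `i, j, k` and by fourth roots of unity
(`sameOrbit_of_quartics_eq`), so equal invariants mean equal orbits. This leaves the orbits of four
explicit vectors (`isNodal_of_singAt`). Each of them fixes the value of `λ`, and there the kernel of
the Hessian matrix is the line spanned by the vector, so that the point is a node. In particular
there are only finitely many singular points off the quadric, and they are isolated.

*Singular points on the quadric.* The quadric is parametrised by pairs `(u, w)` of vectors of `ℂ²`,
and there the pencil becomes the product of a form of degree twelve in `u` without multiple zeros and
the square of the sextic `w₁ w₂ (w₁⁴ - w₂⁴)`. A singular point on the quadric therefore satisfies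
`w₁ w₂ (w₁⁴ - w₂⁴) = 0`, and along these six lines all surfaces are singular
(`exists_line_of_singAt_pencil`). A point on a line of singular points is neither isolated nor a
node.

*Invariance.* Up to a factor the invariant is the sum, over the three columns of the rotation matrix
of a quaternion, of the icosahedral sextic, the product of the linear forms belonging to the six axes
of order five (`eval_invForm`). Left multiplication by an icosahedral quaternion rotates the
columns, right multiplication by an octahedral one permutes them up to signs.

*Orbits and fix groups.* All four representatives are real, hence quaternions `x`, and a pair `(a, b)`
fixes the point of `x` if and only if `a x = ± x b`. Modulo signs the fix group acts faithfully,
through `b`, on the four diagonals of the cube (`nonempty_fixGroupModSigns_equiv`). Explicit elements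
generate a lower bound for its image. This is the whole image, because every larger group contains a
permutation of order four, which would come from `b` with `b⁴ = -1` and so from an element of order
eight of the binary icosahedral group; but the coordinates of that group lie in `ℚ(√5)`
(`sq_eq_one_of_mem_range`). The lengths of the orbits follow from the order `2880` of `IO`.
-/

noncomputable section

namespace IOPencil

open MvPolynomial

/-! ### Directional derivatives of polynomials -/

/-- The derivative of `F` at `v` in the direction `w`. -/
def dir (F : Poly) (v w : V) : ℂ := ∑ i, w i * eval v (pderiv i F)

/-- The second derivative of `F` at `v` in the directions `w` and `z`. -/
def dir2 (F : Poly) (v w z : V) : ℂ := ∑ j, z j * dir (pderiv j F) v w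

theorem hasDerivAt_eval_line (F : Poly) (v w : V) (t : ℂ) :
    HasDerivAt (fun s : ℂ => eval (v + s • w) F) (dir F (v + t • w) w) t := by
  induction F using MvPolynomial.induction_on with
  | C a => simpa [dir] using hasDerivAt_const t a
  | add p r hp hr =>
    have := hp.add hr
    simp only [dir, map_add, mul_add, Finset.sum_add_distrib] at this ⊢
    exact this
  | mul_X p k hp =>
    have hx : HasDerivAt (fun s : ℂ => (v + s • w) k) (w k) t := by
      simpa using ((hasDerivAt_id t).mul_const (w k)).const_add (v k)
    have := hp.mul hx
    simp only [map_mul, eval_X]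
    refine this.congr_deriv ?_
    simp only [dir, Derivation.leibniz, pderiv_X, smul_eq_mul, map_add, map_mul, eval_X,
      mul_add, Finset.sum_add_distrib, Finset.sum_mul]
    rw [add_comm]
    congr 1
    · simp [Pi.single_apply, apply_ite, Finset.sum_ite_eq, mul_comm]
    · exact Finset.sum_congr rfl fun i _ => by ring

theorem hasDerivAt_eval_line_zero (F : Poly) (v w : V) :
    HasDerivAt (fun s : ℂ => eval (v + s • w) F) (dir F v w) 0 := by
  simpa using hasDerivAt_eval_line F v w 0

theorem hasDerivAt_dir_line_zero (F : Poly) (v w z : V) :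
    HasDerivAt (fun s : ℂ => dir F (v + s • w) z) (dir2 F v w z) 0 := by
  unfold dir dir2
  have : ∀ i ∈ Finset.univ, HasDerivAt (fun s : ℂ => z i * eval (v + s • w) (pderiv i F))
      (z i * dir (pderiv i F) v w) 0 := fun i _ =>
    (hasDerivAt_eval_line_zero (pderiv i F) v w).const_mul (z i)
  simpa using HasDerivAt.fun_sum this

theorem dir_single (F : Poly) (v : V) (i : Fin 4) :
    dir F v (Pi.single i 1) = eval v (pderiv i F) := by
  simp [dir, Pi.single_apply]

theorem pderiv_comm (i j : Fin 4) (F : Poly) :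
    pderiv i (pderiv j F) = pderiv j (pderiv i F) := by
  have h : ⁅(pderiv i : Derivation ℂ Poly Poly), (pderiv j : Derivation ℂ Poly Poly)⁆ = 0 := by
    apply MvPolynomial.derivation_ext
    intro k
    rw [Derivation.commutator_apply]
    by_cases h1 : k = j <;> by_cases h2 : k = i <;>
      simp [pderiv_X, Pi.single_apply, h1, h2, apply_ite]
  have := congrArg (fun D : Derivation ℂ Poly Poly => D F) h
  simpa [Derivation.commutator_apply, sub_eq_zero] using this

/-! ### Singular points and nodes of homogeneous forms -/

/-- All first derivatives of `F`, and `F` itself, vanish at the vector `v`. -/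
def SingAt (F : Poly) (v : V) : Prop := eval v F = 0 ∧ ∀ w, dir F v w = 0

theorem singAt_iff {F : Poly} {v : V} :
    SingAt F v ↔ eval v F = 0 ∧ ∀ i, eval v (pderiv i F) = 0 := by
  refine and_congr_right fun _ => ⟨fun h i => by rw [← dir_single, h], fun h w => ?_⟩
  simp [dir, h]

/-- `v` is a singular vector at which the Hessian form has the line through `v` as its kernel. -/
def NodeAt (F : Poly) (v : V) : Prop :=
  SingAt F v ∧ ∀ w, (∀ z, dir2 F v w z = 0) → ∃ c : ℂ, w = c • v

theorem eval_smul_of_isHomogeneous {F : Poly} {n : ℕ} (hF : F.IsHomogeneous n) (c : ℂ) (v : V) :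
    eval (c • v) F = c ^ n * eval v F := by
  rw [eval_eq, eval_eq, Finset.mul_sum]
  refine Finset.sum_congr rfl fun d hd => ?_
  have h : d.degree = n := by
    rw [← hF (mem_support_iff.mp hd)]
    exact DFunLike.congr_fun (Finsupp.degree_eq_weight_one (σ := Fin 4) (R := ℕ)) d
  have h2 : ∏ i ∈ d.support, (c • v) i ^ d i = c ^ n * ∏ i ∈ d.support, v i ^ d i := by
    simp only [Pi.smul_apply, smul_eq_mul, mul_pow, Finset.prod_mul_distrib,
      Finset.prod_pow_eq_pow_sum]
    rw [← h, Finsupp.degree_apply]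
  rw [h2]
  ring

theorem SingAt.smul {F : Poly} {n : ℕ} (hF : F.IsHomogeneous n) {v : V} (h : SingAt F v)
    (c : ℂ) : SingAt F (c • v) := by
  rw [singAt_iff] at h ⊢
  refine ⟨by rw [eval_smul_of_isHomogeneous hF, h.1, mul_zero], fun i => ?_⟩
  rw [eval_smul_of_isHomogeneous hF.pderiv, h.2, mul_zero]

theorem NodeAt.smul {F : Poly} {n : ℕ} (hF : F.IsHomogeneous n) {v : V} (h : NodeAt F v)
    {c : ℂ} (hc : c ≠ 0) : NodeAt F (c • v) := by
  refine ⟨h.1.smul hF c, fun w hw => ?_⟩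
  have key : ∀ z, dir2 F (c • v) w z = c ^ (n - 1 - 1) * dir2 F v w z := by
    intro z
    simp only [dir2, dir, Finset.mul_sum]
    refine Finset.sum_congr rfl fun j _ => Finset.sum_congr rfl fun i _ => ?_
    rw [eval_smul_of_isHomogeneous (hF.pderiv.pderiv)]
    ring
  obtain ⟨d, hd⟩ := h.2 w fun z => by
    have := hw z
    rw [key] at this
    exact (mul_eq_zero.mp this).resolve_left (pow_ne_zero _ hc)
  exact ⟨d / c, by rw [hd, smul_smul, div_mul_cancel₀ _ hc]⟩

theorem dir_smul_of_isInvariant {g : GL4} {F : Poly} (hg : IsInvariant g F) (v w : V) :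
    dir F (g • v) (g • w) = dir F v w := by
  have h1 := hasDerivAt_eval_line_zero F (g • v) (g • w)
  have h2 := hasDerivAt_eval_line_zero F v w
  have : (fun s : ℂ => eval (g • v + s • g • w) F) = fun s : ℂ => eval (v + s • w) F := by
    funext s
    rw [← hg (v + s • w), smul_add, smul_comm]
  rw [this] at h1
  exact h1.unique h2

theorem dir2_smul_of_isInvariant {g : GL4} {F : Poly} (hg : IsInvariant g F) (v w z : V) :
    dir2 F (g • v) (g • w) (g • z) = dir2 F v w z := by
  have h1 := hasDerivAt_dir_line_zero F (g • v) (g • w) (g • z)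
  have h2 := hasDerivAt_dir_line_zero F v w z
  have : (fun s : ℂ => dir F (g • v + s • g • w) (g • z))
      = fun s : ℂ => dir F (v + s • w) z := by
    funext s
    rw [← dir_smul_of_isInvariant hg (v + s • w), smul_add, smul_comm]
  rw [this] at h1
  exact h1.unique h2

theorem SingAt.smul_of_isInvariant {g : GL4} {F : Poly} (hg : IsInvariant g F) {v : V}
    (h : SingAt F v) : SingAt F (g • v) := by
  refine ⟨by rw [hg, h.1], fun w => ?_⟩
  have := dir_smul_of_isInvariant hg v (g⁻¹ • w)
  rwa [smul_inv_smul, h.2] at this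

theorem NodeAt.smul_of_isInvariant {g : GL4} {F : Poly} (hg : IsInvariant g F) {v : V}
    (h : NodeAt F v) : NodeAt F (g • v) := by
  refine ⟨h.1.smul_of_isInvariant hg, fun w hw => ?_⟩
  obtain ⟨c, hc⟩ := h.2 (g⁻¹ • w) fun z => by
    rw [← dir2_smul_of_isInvariant hg, smul_inv_smul, hw]
  exact ⟨c, by rw [← smul_inv_smul g w, hc, smul_comm]⟩

theorem rep_mk_eq_smul (v : V) (hv : v ≠ 0) :
    ∃ c : ℂ, c ≠ 0 ∧ (Projectivization.mk ℂ v hv).rep = c • v := by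
  obtain ⟨a, ha⟩ := Projectivization.exists_smul_eq_mk_rep ℂ v hv
  exact ⟨a, a.ne_zero, ha.symm⟩

theorem isSingularPoint_iff {F : Poly} {p : ℙ ℂ V} : IsSingularPoint F p ↔ SingAt F p.rep :=
  singAt_iff.symm

theorem isSingularPoint_mk_iff {F : Poly} {n : ℕ} (hF : F.IsHomogeneous n) (v : V) (hv : v ≠ 0) :
    IsSingularPoint F (Projectivization.mk ℂ v hv) ↔ SingAt F v := by
  obtain ⟨c, hc, h⟩ := rep_mk_eq_smul v hv
  rw [isSingularPoint_iff, h]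
  refine ⟨fun h => ?_, fun h => h.smul hF c⟩
  simpa [smul_smul, hc] using h.smul hF c⁻¹

/-- By Euler's identity a singular vector lies in the kernel of the Hessian matrix, so the
`3 × 3` minors of the Hessian in the charts are nonzero exactly if that kernel is a line. -/
theorem isNode_iff {F : Poly} {n : ℕ} (hF : F.IsHomogeneous n) {p : ℙ ℂ V} :
    IsNode F p ↔ NodeAt F p.rep := by
  unfold IsNode NodeAt
  rw [isSingularPoint_iff]
  refine and_congr_right fun hs => ?_
  set v := p.rep with hv
  have hv0 : v ≠ 0 := p.rep_nonzero
  have hd : ∀ j, dir (pderiv j F) v v = 0 := by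
    intro j
    have h1 := congrArg (eval v) (hF.pderiv (i := j)).sum_X_mul_pderiv
    simp only [map_sum, map_mul, eval_X, map_nsmul] at h1
    rw [dir, h1, (singAt_iff.mp hs).2, smul_zero]
  have hker : ∀ w, (∀ z, dir2 F v w z = 0) ↔ ∀ j, dir (pderiv j F) v w = 0 := by
    intro w
    refine ⟨fun h j => by simpa [dir2, Pi.single_apply] using h (Pi.single j 1), fun h z => ?_⟩
    simp [dir2, h]
  have hmat : ∀ w j, dir (pderiv j F) v w = Matrix.vecMul w (hessian F v) j := by
    intro w j
    simp [dir, Matrix.vecMul, dotProduct, hessian]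
  have hsymm : (hessian F v).transpose = hessian F v := by
    ext i j
    simp only [Matrix.transpose_apply, hessian, Matrix.of_apply, pderiv_comm i j]
  have hMv : Matrix.mulVec (hessian F v) v = 0 := by
    rw [← Matrix.vecMul_transpose, hsymm]
    ext j
    rw [← hmat, hd, Pi.zero_apply]
  simp only [hker, hmat]
  constructor
  · intro hdet w hw
    obtain ⟨i, hi⟩ : ∃ i, v i ≠ 0 := by
      by_contra! h
      exact hv0 (funext h)
    refine ⟨w i / v i, ?_⟩
    set u : V := w - (w i / v i) • v with hu
    have hui : u i = 0 := by simp [hu, hi]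
    have huM : ∀ j, Matrix.vecMul u (hessian F v) j = 0 := by
      intro j
      rw [hu, Matrix.sub_vecMul, Matrix.smul_vecMul, Pi.sub_apply, Pi.smul_apply, hw,
        ← hmat, hd]
      simp
    have h3 : Matrix.vecMul (fun k => u (i.succAbove k))
        ((hessian F v).submatrix i.succAbove i.succAbove) = 0 := by
      ext j
      have := huM (i.succAbove j)
      rw [Matrix.vecMul, dotProduct, Fin.sum_univ_succAbove _ i, hui, zero_mul, zero_add] at this
      simpa [Matrix.vecMul, dotProduct] using this
    have h4 := Matrix.eq_zero_of_vecMul_eq_zero (hdet i hi) h3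
    have h5 : u = 0 := by
      ext k
      rcases Fin.eq_self_or_eq_succAbove i k with rfl | ⟨m, rfl⟩
      · exact hui
      · exact congrFun h4 m
    rw [hu, sub_eq_zero] at h5
    exact h5
  · intro hk i hi hdet
    obtain ⟨x, hx0, hx⟩ := Matrix.exists_vecMul_eq_zero_iff.mpr hdet
    set w : V := i.insertNth 0 x with hw
    have hwi : w i = 0 := by simp [hw]
    have hws : ∀ k, w (i.succAbove k) = x k := by simp [hw]
    have h1 : ∀ j, Matrix.vecMul w (hessian F v) (i.succAbove j) = 0 := by
      intro j
      rw [Matrix.vecMul, dotProduct, Fin.sum_univ_succAbove _ i, hwi, zero_mul, zero_add]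
      simpa [Matrix.vecMul, dotProduct, hws] using congrFun hx j
    have h2 : Matrix.vecMul w (hessian F v) i = 0 := by
      have h3 : dotProduct (Matrix.vecMul w (hessian F v)) v = 0 := by
        rw [← Matrix.dotProduct_mulVec, hMv, dotProduct_zero]
      rw [dotProduct, Fin.sum_univ_succAbove _ i] at h3
      simp only [h1, zero_mul, Finset.sum_const_zero, add_zero] at h3
      exact (mul_eq_zero.mp h3).resolve_right hi
    obtain ⟨c, hc⟩ := hk w fun j => by
      rcases Fin.eq_self_or_eq_succAbove i j with rfl | ⟨m, rfl⟩
      · exact h2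
      · exact h1 m
    have hc0 : c = 0 := by
      have := congrFun hc i
      rw [hwi] at this
      exact (mul_eq_zero.mp this.symm).resolve_right hi
    apply hx0
    ext k
    rw [← hws k, hc, hc0]
    simp

/-! ### Isolated singular points -/

theorem tendsto_line (v w : V) : Filter.Tendsto (fun t : ℂ => v + t • w) (nhdsWithin 0 {0}ᶜ)
    (nhds v) := by
  have : Continuous fun t : ℂ => v + t • w := by fun_prop
  have h := this.tendsto 0
  simp only [zero_smul, add_zero] at h
  exact h.mono_left nhdsWithin_le_nhds

/-- A singular point through which a line of singular points passes is not isolated. -/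
theorem not_isIsolated_of_line {F : Poly} {n : ℕ} (hF : F.IsHomogeneous n) {p : ℙ ℂ V} {w : V}
    (hw : ¬ ∃ c : ℂ, w = c • p.rep) (h : ∀ t : ℂ, SingAt F (p.rep + t • w)) :
    ¬ IsIsolatedSingularPoint F p := by
  rintro ⟨-, hiso⟩
  have h2 := ((tendsto_line p.rep w).eventually hiso).and self_mem_nhdsWithin
  obtain ⟨t, ht, ht0⟩ := h2.exists
  have ht0 : t ≠ 0 := ht0
  have hne : p.rep + t • w ≠ 0 := by
    intro h0
    refine hw ⟨-t⁻¹, ?_⟩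
    have : t • w = -p.rep := by rw [eq_neg_iff_add_eq_zero, add_comm, h0]
    rw [neg_smul, ← smul_neg, ← this, smul_smul, inv_mul_cancel₀ ht0, one_smul]
  have h3 := ht hne ((isSingularPoint_mk_iff hF _ hne).mpr (h t))
  obtain ⟨a, ha⟩ := (Projectivization.mk_eq_mk_iff' ℂ _ _ hne p.rep_nonzero).mp
    (h3.trans p.mk_rep.symm)
  refine hw ⟨t⁻¹ * (a - 1), ?_⟩
  rw [mul_smul, sub_smul, one_smul, ha, add_sub_cancel_left, smul_smul, inv_mul_cancel₀ ht0,
    one_smul]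

theorem not_nodeAt_of_line {F : Poly} {v w : V}
    (hw : ¬ ∃ c : ℂ, w = c • v) (h : ∀ t : ℂ, SingAt F (v + t • w)) : ¬ NodeAt F v := by
  intro hn
  refine hw (hn.2 w fun z => ?_)
  have h1 := hasDerivAt_dir_line_zero F v w z
  have h2 : (fun s : ℂ => dir F (v + s • w) z) = fun _ => 0 := by
    funext s
    exact (h s).2 z
  rw [h2] at h1
  exact h1.unique (hasDerivAt_const _ _)

/-- A singular point with a neighbourhood that contains only finitely many singular points is
isolated. -/
theorem isIsolated_of_finite {F : Poly} {n : ℕ} (hF : F.IsHomogeneous n) {p : ℙ ℂ V}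
    (hp : IsSingularPoint F p) (A : Set V) (hA : IsOpen A) (hpA : p.rep ∈ A)
    (s : Set (ℙ ℂ V)) (hs : s.Finite)
    (h : ∀ w ∈ A, ∀ hw : w ≠ 0, SingAt F w → Projectivization.mk ℂ w hw ∈ s) :
    IsIsolatedSingularPoint F p := by
  refine ⟨hp, ?_⟩
  have h1 : ∀ r ∈ s, ∀ᶠ w in nhds p.rep, ∀ hw : w ≠ 0,
      Projectivization.mk ℂ w hw = r → r = p := by
    intro r _
    by_cases hr : r = p
    · exact Filter.Eventually.of_forall fun _ _ _ => hr
    have hcl : IsClosed ((Submodule.span ℂ {r.rep} : Submodule ℂ V) : Set V) :=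
      Submodule.closed_of_finiteDimensional _
    have hmem : p.rep ∈ ((Submodule.span ℂ {r.rep} : Submodule ℂ V) : Set V)ᶜ := by
      intro hm
      obtain ⟨a, ha⟩ := Submodule.mem_span_singleton.mp hm
      apply hr
      rw [← p.mk_rep, ← r.mk_rep, eq_comm, Projectivization.mk_eq_mk_iff']
      exact ⟨a, ha⟩
    filter_upwards [hcl.isOpen_compl.mem_nhds hmem] with w hw hw0 hwr
    refine (hw ?_).elim
    obtain ⟨a, ha⟩ := (Projectivization.mk_eq_mk_iff' ℂ _ _ hw0 r.rep_nonzero).mp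
      (hwr.trans r.mk_rep.symm)
    exact Submodule.mem_span_singleton.mpr ⟨a, by rw [← ha]⟩
  have h2 := (Filter.eventually_all_finite hs).mpr h1
  filter_upwards [h2, hA.mem_nhds hpA] with w hw hwA hw0 hsing
  exact hw _ (h w hwA hw0 ((isSingularPoint_mk_iff hF w hw0).mp hsing)) hw0 rfl

/-! ### The pencil as a family of cubics in the five quartics -/

/-- The cubic form through which the member `S_IO + l q⁶` factors: `r` stands for `√5` and `aᵢ`
for `fᵢ`. -/
def cubic {R : Type*} [CommRing R] (r l a0 a1 a2 a3 a4 : R) : R :=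
  -(a1 ^ 3 + a2 ^ 3 + a3 ^ 3)
    + 11 * (a1 ^ 2 * (a2 + a3) + a2 ^ 2 * (a1 + a3) + a3 ^ 2 * (a1 + a2))
    + (a0 ^ 2 - 14 * a4 ^ 2) * (a1 + a2 + a3) + 30 * a0 * a4 ^ 2
    - 8 * a0 * (a1 * a2 + a1 * a3 + a2 * a3) - 30 * a1 * a2 * a3
    + 3 * r * a4 * (4 * a4 ^ 2 - (a0 - a1 - a2 - a3) ^ 2)
    + 6 * r * (a1 ^ 2 * a2 + a3 ^ 2 * a1 + a2 ^ 2 * a3 - a1 * a2 ^ 2 - a3 * a1 ^ 2 - a2 * a3 ^ 2)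
    + l * (a0 + a1 + a2 + a3) ^ 3

/-- The partial derivative of `cubic` with respect to `a0`. -/
def cubic0 {R : Type*} [CommRing R] (r l a0 a1 a2 a3 a4 : R) : R :=
  2 * a0 * (a1 + a2 + a3) + 30 * a4 ^ 2 - 8 * (a1 * a2 + a1 * a3 + a2 * a3)
    - 6 * r * a4 * (a0 - a1 - a2 - a3) + 3 * l * (a0 + a1 + a2 + a3) ^ 2

/-- The partial derivative of `cubic` with respect to `a1`; those with respect to `a2` and `a3`
arise from it by cyclic permutation. -/
def cubic1 {R : Type*} [CommRing R] (r l a0 a1 a2 a3 a4 : R) : R :=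
  -3 * a1 ^ 2 + 11 * (2 * a1 * (a2 + a3) + a2 ^ 2 + a3 ^ 2) + a0 ^ 2 - 14 * a4 ^ 2
    - 8 * a0 * (a2 + a3) - 30 * a2 * a3 + 6 * r * a4 * (a0 - a1 - a2 - a3)
    + 6 * r * (2 * a1 * a2 + a3 ^ 2 - a2 ^ 2 - 2 * a3 * a1)
    + 3 * l * (a0 + a1 + a2 + a3) ^ 2

/-- The partial derivative of `cubic` with respect to `a4`. -/
def cubic4 {R : Type*} [CommRing R] (r a0 a1 a2 a3 a4 : R) : R :=
  -28 * a4 * (a1 + a2 + a3) + 60 * a0 * a4 + 36 * r * a4 ^ 2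
    - 3 * r * (a0 - a1 - a2 - a3) ^ 2

theorem invForm_eq : invForm = cubic sqrt5 0 f0 f1 f2 f3 f4 := by
  have h : ∀ g : Fin 3 → Fin 3 → Poly,
      (∑ i, ∑ j ∈ Finset.univ.filter (fun j => j ≠ i), g i j)
        = g 0 1 + g 0 2 + (g 1 0 + g 1 2) + (g 2 0 + g 2 1) := by
    intro g
    simp [Finset.sum_filter, Fin.sum_univ_three]
  unfold invForm sumSqMul sumMul
  rw [h, h]
  simp only [Fin.sum_univ_three, f, Matrix.cons_val_zero, Matrix.cons_val_one, Matrix.cons_val,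
    cubic, Fa]
  ring

theorem q_sq : q ^ 2 = f0 + f1 + f2 + f3 := by
  unfold q f0 f1 f2 f3
  ring

/-- Since `q² = f₀ + f₁ + f₂ + f₃`, all members of the pencil are cubics in the five quartics. -/
theorem pencil_eq (lam : ℂ) : pencil lam = cubic sqrt5 (C lam) f0 f1 f2 f3 f4 := by
  have h : q ^ 6 = (f0 + f1 + f2 + f3) ^ 3 := by rw [← q_sq]; ring
  rw [pencil, invForm_eq, h]
  unfold cubic
  ring

theorem derivation_cubic (D : Derivation ℂ Poly Poly) (b l : ℂ) (a0 a1 a2 a3 a4 : Poly) :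
    D (cubic (C b) (C l) a0 a1 a2 a3 a4)
      = cubic0 (C b) (C l) a0 a1 a2 a3 a4 * D a0 + cubic1 (C b) (C l) a0 a1 a2 a3 a4 * D a1
        + cubic1 (C b) (C l) a0 a2 a3 a1 a4 * D a2 + cubic1 (C b) (C l) a0 a3 a1 a2 a4 * D a3
        + cubic4 (C b) a0 a1 a2 a3 a4 * D a4 := by
  have hC : ∀ c : ℂ, D (C c) = 0 := fun c => D.map_algebraMap c
  have hn : ∀ n : ℕ, ∀ [n.AtLeastTwo], D (OfNat.ofNat n : Poly) = 0 := fun n _ => D.map_natCast n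
  unfold cubic cubic0 cubic1 cubic4
  simp only [map_add, map_sub, map_neg, Derivation.leibniz, Derivation.leibniz_pow, hC, hn,
    smul_eq_mul, nsmul_eq_mul]
  push_cast
  ring

theorem eval_q (v : V) : eval v q = v 0 ^ 2 + v 1 ^ 2 + v 2 ^ 2 + v 3 ^ 2 := by simp [q]

theorem eval_f0 (v : V) : eval v f0 = v 0 ^ 4 + v 1 ^ 4 + v 2 ^ 4 + v 3 ^ 4 := by simp [f0]

theorem eval_f1 (v : V) : eval v f1 = 2 * (v 0 ^ 2 * v 1 ^ 2 + v 2 ^ 2 * v 3 ^ 2) := by simp [f1]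

theorem eval_f2 (v : V) : eval v f2 = 2 * (v 0 ^ 2 * v 2 ^ 2 + v 1 ^ 2 * v 3 ^ 2) := by simp [f2]

theorem eval_f3 (v : V) : eval v f3 = 2 * (v 0 ^ 2 * v 3 ^ 2 + v 1 ^ 2 * v 2 ^ 2) := by simp [f3]

theorem eval_f4 (v : V) : eval v f4 = 4 * (v 0 * v 1 * v 2 * v 3) := by simp [f4]

/-- `√5` as a complex number. -/
def s5 : ℂ := ((√5 : ℝ) : ℂ)

theorem s5_sq : s5 ^ 2 = 5 := by
  rw [s5, ← Complex.ofReal_pow, Real.sq_sqrt (by norm_num)]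
  norm_num

theorem sqrt5_eq : sqrt5 = C s5 := rfl

theorem eval_cubic (v : V) (b l : ℂ) (a0 a1 a2 a3 a4 : Poly) :
    eval v (cubic (C b) (C l) a0 a1 a2 a3 a4)
      = cubic b l (eval v a0) (eval v a1) (eval v a2) (eval v a3) (eval v a4) := by
  simp [cubic]

theorem eval_cubic0 (v : V) (b l : ℂ) (a0 a1 a2 a3 a4 : Poly) :
    eval v (cubic0 (C b) (C l) a0 a1 a2 a3 a4)
      = cubic0 b l (eval v a0) (eval v a1) (eval v a2) (eval v a3) (eval v a4) := by
  simp [cubic0]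

theorem eval_cubic1 (v : V) (b l : ℂ) (a0 a1 a2 a3 a4 : Poly) :
    eval v (cubic1 (C b) (C l) a0 a1 a2 a3 a4)
      = cubic1 b l (eval v a0) (eval v a1) (eval v a2) (eval v a3) (eval v a4) := by
  simp [cubic1]

theorem eval_cubic4 (v : V) (b : ℂ) (a0 a1 a2 a3 a4 : Poly) :
    eval v (cubic4 (C b) a0 a1 a2 a3 a4)
      = cubic4 b (eval v a0) (eval v a1) (eval v a2) (eval v a3) (eval v a4) := by
  simp [cubic4]

theorem eval_pencil (lam : ℂ) (v : V) : eval v (pencil lam)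
    = cubic s5 lam (eval v f0) (eval v f1) (eval v f2) (eval v f3) (eval v f4) := by
  rw [pencil_eq, sqrt5_eq, eval_cubic]

/-- The gradient of the cubic at the point with coordinates `fᵢ v`. -/
def cubicGrad (lam : ℂ) (v : V) : Fin 5 → ℂ :=
  ![cubic0 s5 lam (eval v f0) (eval v f1) (eval v f2) (eval v f3) (eval v f4),
    cubic1 s5 lam (eval v f0) (eval v f1) (eval v f2) (eval v f3) (eval v f4),
    cubic1 s5 lam (eval v f0) (eval v f2) (eval v f3) (eval v f1) (eval v f4),
    cubic1 s5 lam (eval v f0) (eval v f3) (eval v f1) (eval v f2) (eval v f4),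
    cubic4 s5 (eval v f0) (eval v f1) (eval v f2) (eval v f3) (eval v f4)]

/-- The Jacobian matrix of the five quartics. -/
def jac (v : V) : Matrix (Fin 4) (Fin 5) ℂ :=
  !![4 * v 0 ^ 3, 4 * v 0 * v 1 ^ 2, 4 * v 0 * v 2 ^ 2, 4 * v 0 * v 3 ^ 2, 4 * v 1 * v 2 * v 3;
     4 * v 1 ^ 3, 4 * v 1 * v 0 ^ 2, 4 * v 1 * v 3 ^ 2, 4 * v 1 * v 2 ^ 2, 4 * v 0 * v 2 * v 3;
     4 * v 2 ^ 3, 4 * v 2 * v 3 ^ 2, 4 * v 2 * v 0 ^ 2, 4 * v 2 * v 1 ^ 2, 4 * v 0 * v 1 * v 3;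
     4 * v 3 ^ 3, 4 * v 3 * v 2 ^ 2, 4 * v 3 * v 1 ^ 2, 4 * v 3 * v 0 ^ 2, 4 * v 0 * v 1 * v 2]

theorem eval_pderiv_pencil (lam : ℂ) (v : V) (i : Fin 4) :
    eval v (pderiv i (pencil lam)) = Matrix.mulVec (jac v) (cubicGrad lam v) i := by
  rw [pencil_eq, sqrt5_eq, derivation_cubic]
  simp only [map_add, map_mul, eval_cubic0, eval_cubic1, eval_cubic4]
  rw [Matrix.mulVec, dotProduct, Fin.sum_univ_five]
  simp only [cubicGrad, Matrix.cons_val_zero, Matrix.cons_val_one, Matrix.cons_val]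
  set A0 := cubic0 s5 lam (eval v f0) (eval v f1) (eval v f2) (eval v f3) (eval v f4)
  set A1 := cubic1 s5 lam (eval v f0) (eval v f1) (eval v f2) (eval v f3) (eval v f4)
  set A2 := cubic1 s5 lam (eval v f0) (eval v f2) (eval v f3) (eval v f1) (eval v f4)
  set A3 := cubic1 s5 lam (eval v f0) (eval v f3) (eval v f1) (eval v f2) (eval v f4)
  set A4 := cubic4 s5 (eval v f0) (eval v f1) (eval v f2) (eval v f3) (eval v f4)
  clear_value A0 A1 A2 A3 A4
  have h2 : ∀ i : Fin 4, pderiv i (2 : Poly) = 0 := fun i => (pderiv i).map_natCast 2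
  have h4 : ∀ i : Fin 4, pderiv i (4 : Poly) = 0 := fun i => (pderiv i).map_natCast 4
  fin_cases i <;>
  · simp [f0, f1, f2, f3, f4, jac, Derivation.leibniz, Derivation.leibniz_pow, pderiv_X, h2, h4]
    ring

/-! ### The quartic relation between the five quartics -/

/-- The gradient, at the point with coordinates `fᵢ v`, of the quartic form that vanishes on the
image of `(f₀ : f₁ : f₂ : f₃ : f₄)`, in terms of `s = ∑ fᵢ = q²`, `m = f₀ - f₁ - f₂ - f₃`, the
elementary symmetric functions of `f₁, f₂, f₃`, and `f₄`. The quartic is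
`-s⁴ + 6 s² (u + v) - 4 s c + 3 (u - v)²`, where `u`, `v`, `c` are the forms of degree two, two
and three introduced in the definition. -/
def quarticGrad (a : Fin 5 → ℂ) : Fin 5 → ℂ :=
  let s := a 0 + a 1 + a 2 + a 3
  let m := a 0 - a 1 - a 2 - a 3
  let e := a 1 + a 2 + a 3
  let e2 := a 1 * a 2 + a 1 * a 3 + a 2 * a 3
  let u := m ^ 2 + 12 * a 4 ^ 2
  let v := 4 * (e ^ 2 - 3 * e2)
  let c := 2 * m ^ 3 - 72 * m * a 4 ^ 2 + 8 * (2 * e ^ 3 - 9 * e * e2 + 27 * (a 1 * a 2 * a 3))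
  let S := -4 * s ^ 3 + 12 * s * (u + v) - 4 * c
  let g : ℂ → ℂ → ℂ → ℂ := fun x y z => S - (6 * s ^ 2 + 6 * (u - v)) * (2 * m)
    + (6 * s ^ 2 - 6 * (u - v)) * (4 * (3 * x - e))
    - 4 * s * (-(6 * m ^ 2 - 72 * a 4 ^ 2)
      + 8 * (6 * e ^ 2 - 9 * e2 - 9 * e * (y + z) + 27 * (y * z)))
  ![S + (6 * s ^ 2 + 6 * (u - v)) * (2 * m) - 4 * s * (6 * m ^ 2 - 72 * a 4 ^ 2),
    g (a 1) (a 2) (a 3), g (a 2) (a 3) (a 1), g (a 3) (a 1) (a 2),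
    (6 * s ^ 2 + 6 * (u - v)) * (24 * a 4) + 4 * s * (144 * m * a 4)]

/-- The five quartics at `v`. -/
def quartics (v : V) : Fin 5 → ℂ := ![eval v f0, eval v f1, eval v f2, eval v f3, eval v f4]

theorem quartics_eq (v : V) : quartics v =
    ![v 0 ^ 4 + v 1 ^ 4 + v 2 ^ 4 + v 3 ^ 4, 2 * (v 0 ^ 2 * v 1 ^ 2 + v 2 ^ 2 * v 3 ^ 2),
      2 * (v 0 ^ 2 * v 2 ^ 2 + v 1 ^ 2 * v 3 ^ 2), 2 * (v 0 ^ 2 * v 3 ^ 2 + v 1 ^ 2 * v 2 ^ 2),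
      4 * (v 0 * v 1 * v 2 * v 3)] := by
  rw [quartics, eval_f0, eval_f1, eval_f2, eval_f3, eval_f4]

/-- The signed maximal minors of a `4 × 5` matrix span its kernel when they do not all vanish. -/
theorem minors_mul_eq (J : Matrix (Fin 4) (Fin 5) ℂ) (w : Fin 5 → ℂ) (hw : Matrix.mulVec J w = 0)
    (j k : Fin 5) :
    (-1) ^ (j : ℕ) * (J.submatrix id j.succAbove).det * w k
      = (-1) ^ (k : ℕ) * (J.submatrix id k.succAbove).det * w j := by
  set M : Matrix (Fin 5) (Fin 5) ℂ := Matrix.of (Matrix.vecCons (Pi.single j 1) J) with hM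
  have hrow : ∀ i : Fin 4, M i.succ = J i := fun _ => rfl
  have hsub : ∀ l : Fin 5, (M.submatrix Fin.succ l.succAbove) = J.submatrix id l.succAbove := by
    intro l
    rfl
  have hdet : M.det = (-1) ^ (j : ℕ) * (J.submatrix id j.succAbove).det := by
    rw [Matrix.det_succ_row_zero, Finset.sum_eq_single j]
    · rw [hsub]
      simp [hM]
    · intro b _ hb
      simp [hM, hb]
    · simp
  have hMw : Matrix.mulVec M w = Pi.single 0 (w j) := by
    ext i
    refine Fin.cases ?_ (fun i => ?_) i
    · simp [hM, Matrix.mulVec, dotProduct, Pi.single_apply]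
    · have := congrFun hw i
      simp only [Matrix.mulVec, dotProduct, hrow] at this ⊢
      simpa using this
  have h1 : Matrix.mulVec (Matrix.adjugate M) (Matrix.mulVec M w) = M.det • w := by
    rw [Matrix.mulVec_mulVec, Matrix.adjugate_mul, Matrix.smul_mulVec, Matrix.one_mulVec]
  have h2 := congrFun h1 k
  rw [hMw, Matrix.mulVec_single, Pi.smul_apply, Matrix.col_apply] at h2
  rw [Matrix.adjugate_fin_succ_eq_det_submatrix] at h2
  simp only [Pi.smul_apply, smul_eq_mul, Fin.coe_ofNat_eq_mod] at h2
  rw [← hdet, ← h2]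
  have h3 := hsub k
  simp only [MulOpposite.smul_eq_mul_unop, MulOpposite.unop_op]
  rw [show (M.submatrix (Fin.succAbove 0) k.succAbove) = J.submatrix id k.succAbove from by
    rw [← h3]; congr 1]
  ring

/-- The maximal minors of the Jacobian matrix are proportional to the gradient of the quartic. -/
theorem minors_jac (v : V) (k : Fin 5) :
    27 * ((-1) ^ (k : ℕ) * ((jac v).submatrix id k.succAbove).det)
      = 2 * quarticGrad (quartics v) k := by
  rw [quartics_eq]
  fin_cases k
  · simp [jac, quarticGrad, Matrix.det_succ_row_zero, Fin.sum_univ_succ, Fin.succAbove]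
    generalize v 0 = a, v 1 = b, v 2 = c, v 3 = d
    ring
  · simp [jac, quarticGrad, Matrix.det_succ_row_zero, Fin.sum_univ_succ, Fin.succAbove]
    generalize v 0 = a, v 1 = b, v 2 = c, v 3 = d
    ring
  · simp [jac, quarticGrad, Matrix.det_succ_row_zero, Fin.sum_univ_succ, Fin.succAbove]
    generalize v 0 = a, v 1 = b, v 2 = c, v 3 = d
    ring
  · simp [jac, quarticGrad, Matrix.det_succ_row_zero, Fin.sum_univ_succ, Fin.succAbove]
    generalize v 0 = a, v 1 = b, v 2 = c, v 3 = d
    ring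
  · simp [jac, quarticGrad, Matrix.det_succ_row_zero, Fin.sum_univ_succ, Fin.succAbove]
    generalize v 0 = a, v 1 = b, v 2 = c, v 3 = d
    ring

/-- A singular vector of a member of the pencil is critical for the cubic restricted to the
quartic, unless it maps to the singular locus of the quartic. -/
theorem exists_multiplier {lam : ℂ} {v : V} (h : SingAt (pencil lam) v) :
    quarticGrad (quartics v) = 0 ∨ ∃ μ : ℂ, cubicGrad lam v = μ • quarticGrad (quartics v) := by
  by_cases h0 : quarticGrad (quartics v) = 0
  · exact Or.inl h0
  right
  obtain ⟨j, hj⟩ : ∃ j, quarticGrad (quartics v) j ≠ 0 := by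
    by_contra! h
    exact h0 (funext h)
  have hw : Matrix.mulVec (jac v) (cubicGrad lam v) = 0 := by
    ext i
    rw [← eval_pderiv_pencil, (singAt_iff.mp h).2, Pi.zero_apply]
  refine ⟨cubicGrad lam v j / quarticGrad (quartics v) j, funext fun k => ?_⟩
  have h1 := minors_mul_eq (jac v) _ hw j k
  rw [Pi.smul_apply, smul_eq_mul, div_mul_eq_mul_div, eq_div_iff hj]
  linear_combination 27 / 2 * h1 - (cubicGrad lam v k) / 2 * minors_jac v j
    + (cubicGrad lam v j) / 2 * minors_jac v k

/-! ### The critical points of the cubic on the quartic -/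

/-- The invariants of a quadruple `(x, x', y, y')` under multiplication of `(x, x')` and of
`(y, y')` by pairs `(ζ, ζ⁻¹)` of cube roots of unity are `u`, `A`, `A'`, `w`, `B`, `B'`. -/
def HasInvariants (x x' y y' u A A' w B B' : ℂ) : Prop :=
  x * x' = u ∧ x ^ 3 = A ∧ x' ^ 3 = A' ∧ y * y' = w ∧ y ^ 3 = B ∧ y' ^ 3 = B'

/-- The Lagrange equations for the pair `(x, x')`, where `z = √-15`, `n` is eighteen times the
multiplier and `d` is the difference of the products of the two pairs. -/
def Lagrange (z n d x x' : ℂ) : Prop :=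
  (8 * n - 11 - 3 * z) * x ^ 2 = 4 * (n * (1 + d) - 2) * x' ∧
    (8 * n - 11 + 3 * z) * x' ^ 2 = 4 * (n * (1 + d) - 2) * x

/-- If one of `x, x'` vanishes, so does the other, except for special multipliers. -/
theorem Lagrange.eq_zero_or {z n d x x' : ℂ} (hz : z ^ 2 = -15) (h : Lagrange z n d x x')
    (hu : x * x' = 0) : (x = 0 ∧ x' = 0) ∨
      (n * (1 + d) = 2 ∧ 4 * n ^ 2 - 11 * n + 16 = 0) := by
  obtain ⟨h1, h2⟩ := h
  rcases mul_eq_zero.mp hu with h0 | h0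
  · by_cases h3 : x' = 0
    · exact Or.inl ⟨h0, h3⟩
    right
    have h4 : n * (1 + d) - 2 = 0 := by
      have : 4 * x' * (n * (1 + d) - 2) = 0 := by rw [h0] at h1; linear_combination -h1
      simpa [h3] using this
    have h5 : 8 * n - 11 + 3 * z = 0 := by
      have : x' ^ 2 * (8 * n - 11 + 3 * z) = 0 := by rw [h0] at h2; linear_combination h2
      simpa [h3] using this
    exact ⟨by linear_combination h4, by
      linear_combination (8 * n - 11 - 3 * z) / 16 * h5 + 9 / 16 * hz⟩
  · by_cases h3 : x = 0
    · exact Or.inl ⟨h3, h0⟩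
    right
    have h4 : n * (1 + d) - 2 = 0 := by
      have : 4 * x * (n * (1 + d) - 2) = 0 := by rw [h0] at h2; linear_combination -h2
      simpa [h3] using this
    have h5 : 8 * n - 11 - 3 * z = 0 := by
      have : x ^ 2 * (8 * n - 11 - 3 * z) = 0 := by rw [h0] at h1; linear_combination h1
      simpa [h3] using this
    exact ⟨by linear_combination h4, by
      linear_combination (8 * n - 11 + 3 * z) / 16 * h5 + 9 / 16 * hz⟩

theorem Lagrange.mul_eq_sq {z n d x x' : ℂ} (hz : z ^ 2 = -15) (h : Lagrange z n d x x')
    (hu : x * x' ≠ 0) : (4 * n ^ 2 - 11 * n + 16) * (x * x') = (n * (1 + d) - 2) ^ 2 := by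
  obtain ⟨h1, h2⟩ := h
  apply mul_left_cancel₀ hu
  linear_combination (8 * n - 11 + 3 * z) * x' ^ 2 / 16 * h1
    + (n * (1 + d) - 2) * x' / 4 * h2 + 9 / 16 * x ^ 2 * x' ^ 2 * hz

theorem Lagrange.ne_zero {z n d x x' : ℂ} (hz : z ^ 2 = -15) (h : Lagrange z n d x x')
    (hu : x * x' ≠ 0) : 4 * n ^ 2 - 11 * n + 16 ≠ 0 := by
  intro h0
  have h3 := h.mul_eq_sq hz hu
  have hK : n * (1 + d) - 2 = 0 := by
    apply pow_eq_zero_iff (two_ne_zero) |>.mp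
    rw [← h3, h0, zero_mul]
  obtain ⟨h1, h2⟩ := h
  have hx : x ≠ 0 := left_ne_zero_of_mul hu
  have hx' : x' ≠ 0 := right_ne_zero_of_mul hu
  have h4 : 8 * n - 11 - 3 * z = 0 := by
    have : x ^ 2 * (8 * n - 11 - 3 * z) = 0 := by linear_combination h1 + 4 * x' * hK
    simpa [hx] using this
  have h5 : 8 * n - 11 + 3 * z = 0 := by
    have : x' ^ 2 * (8 * n - 11 + 3 * z) = 0 := by linear_combination h2 + 4 * x * hK
    simpa [hx'] using this
  have h6 : z = 0 := by linear_combination (h5 - h4) / 6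
  rw [h6] at hz
  norm_num at hz

theorem Lagrange.cube_eq {z n d x x' : ℂ} (hz : z ^ 2 = -15) (h : Lagrange z n d x x') :
    (4 * n ^ 2 - 11 * n + 16) * x ^ 3
      = (n * (1 + d) - 2) * (x * x') * (8 * n - 11 + 3 * z) / 4 ∧
    (4 * n ^ 2 - 11 * n + 16) * x' ^ 3
      = (n * (1 + d) - 2) * (x * x') * (8 * n - 11 - 3 * z) / 4 := by
  obtain ⟨h1, h2⟩ := h
  constructor
  · linear_combination (8 * n - 11 + 3 * z) * x / 16 * h1 + 9 / 16 * x ^ 3 * hz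
  · linear_combination (8 * n - 11 - 3 * z) * x' / 16 * h2 + 9 / 16 * x' ^ 3 * hz

/-- The quadruples of invariants of the critical points, up to exchange of the two pairs. -/
def CritClass (z s x x' y y' : ℂ) : Prop :=
  HasInvariants x x' y y' (1 / 4) ((11 - 3 * z) / 128) ((11 + 3 * z) / 128) 0 0 0 ∨
  (∃ t : ℂ, t ^ 2 = 10 ∧ HasInvariants x x' y y' ((10 + t) / 18)
    ((905 + 140 * t + 15 * z - 12 * t * z) / 2160)
    ((905 + 140 * t - 15 * z + 12 * t * z) / 2160) 0 0 0) ∨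
  (∃ t : ℂ, t ^ 2 = 10 ∧ HasInvariants x x' y y' ((8 + t) / 54)
    ((945 + 270 * t - 25 * z + 34 * t * z) / 19440) ((945 + 270 * t + 25 * z - 34 * t * z) / 19440)
    ((8 + t) / 54)
    ((945 + 270 * t - 25 * z + 34 * t * z) / 19440)
    ((945 + 270 * t + 25 * z - 34 * t * z) / 19440)) ∨
  HasInvariants x x' y y' ((3 + s) / 16) ((5 + 2 * s) * (95 + 9 * z) / 5120)
    ((5 + 2 * s) * (95 - 9 * z) / 5120) ((3 - s) / 16) ((5 - 2 * s) * (95 + 9 * z) / 5120)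
    ((5 - 2 * s) * (95 - 9 * z) / 5120)

/-- The critical points at which the second pair vanishes. -/
theorem critClass_of_eq_zero {z s n x x' : ℂ} (hz : z ^ 2 = -15)
    (h : Lagrange z n (x * x') x x') (hu : x * x' ≠ 0)
    (hQ : -1 + 6 * (x * x') - 4 * (x ^ 3 + x' ^ 3) + 3 * (x * x') ^ 2 = 0) :
    CritClass z s x x' 0 0 := by
  have hD := h.ne_zero hz hu
  have e1 := h.mul_eq_sq hz hu
  obtain ⟨c1, c2⟩ := h.cube_eq hz
  generalize hx : x * x' = u at *
  -- Eliminating the cubes and the multiplier `n` leaves an equation for the product `u`.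
  have e2 : (3 * u ^ 2 + 6 * u - 1) * (4 * n ^ 2 - 11 * n + 16)
      = 2 * u * (n * (1 + u) - 2) * (8 * n - 11) := by
    linear_combination (4 * n ^ 2 - 11 * n + 16) * hQ + 4 * c1 + 4 * c2
  have e3 : n * (1 - u) * (11 * u - 5) = -12 * u * (4 * u - 1) := by
    linear_combination e2 - 4 * e1
  have e4 : (4 * u - 1) * ((18 * u ^ 2 - 20 * u + 5) * (8 * u ^ 2 + 5 * u + 5)) = 0 := by
    linear_combination (1 / 4) * (11 * u - 5) ^ 2 * (1 - u) * e1
      + (1 / 4) * (n * (1 - u) ^ 2 * (11 * u - 5) - 12 * u * (4 * u - 1) * (1 - u)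
        + (11 * u - 5) * (7 * u - 4)) * e3
  rcases mul_eq_zero.mp e4 with h4 | h4
  · left
    have hu4 : u = 1 / 4 := by linear_combination h4 / 4
    subst hu4
    have hn : n = 0 := by linear_combination (-16 / 27) * e3
    subst hn
    exact ⟨hx, by linear_combination c1 / 16, by linear_combination c2 / 16, by simp, by simp,
      by simp⟩
  rcases mul_eq_zero.mp h4 with h5 | h5
  · right; left
    set t := 18 * u - 10 with ht
    have ht2 : t ^ 2 = 10 := by rw [ht]; linear_combination 18 * h5
    have hut : u = (10 + t) / 18 := by rw [ht]; ring
    clear_value t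
    subst hut
    have hn : n = -8 - 4 * t := by grind
    subst hn
    refine ⟨t, ht2, hx, ?_, ?_, by simp, by simp, by simp⟩
    · apply mul_left_cancel₀ hD
      rw [c1]
      grind
    · apply mul_left_cancel₀ hD
      rw [c2]
      grind
  · exact absurd (by grind) hD

/-- The critical points at which neither pair vanishes. -/
theorem critClass_of_ne_zero {z s n x x' y y' : ℂ} (hz : z ^ 2 = -15) (hs : s ^ 2 = 5)
    (h : Lagrange z n (x * x' - y * y') x x') (h' : Lagrange z n (y * y' - x * x') y y')
    (hu : x * x' ≠ 0) (hv : y * y' ≠ 0)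
    (hQ : -1 + 6 * (x * x' + y * y') - 4 * (x ^ 3 + x' ^ 3 + y ^ 3 + y' ^ 3)
      + 3 * (x * x' - y * y') ^ 2 = 0) :
    CritClass z s x x' y y' ∨ CritClass z s y y' x x' := by
  have hD := h.ne_zero hz hu
  have e1 := h.mul_eq_sq hz hu
  have e1' := h'.mul_eq_sq hz hv
  obtain ⟨c1, c2⟩ := h.cube_eq hz
  obtain ⟨c1', c2'⟩ := h'.cube_eq hz
  generalize hx : x * x' = u at *
  generalize hy : y * y' = w at *
  have e2 : (-1 + 6 * (u + w) + 3 * (u - w) ^ 2) * (4 * n ^ 2 - 11 * n + 16)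
      = 2 * (u * (n * (1 + (u - w)) - 2) + w * (n * (1 + (w - u)) - 2)) * (8 * n - 11) := by
    linear_combination (4 * n ^ 2 - 11 * n + 16) * hQ + 4 * c1 + 4 * c2 + 4 * c1' + 4 * c2'
  -- Either the two products agree or the multiplier is `16 / 3`.
  have e3 : (u - w) * (16 - 3 * n) = 0 := by
    linear_combination e1 - e1'
  rcases mul_eq_zero.mp e3 with h0 | h0
  · left; right; right; left
    have huw : w = u := by linear_combination -h0
    subst huw
    have hn : 3 * n ^ 2 - 32 * n + 32 = 0 := by
      linear_combination (4 * n ^ 2 - 11 * n + 16) / 5 * e2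
        + (4 * (n - 2) * (8 * n - 11) - 12 * (4 * n ^ 2 - 11 * n + 16)) / 5 * e1
    set t := (3 * n - 16) / 4 with ht
    have ht2 : t ^ 2 = 10 := by rw [ht]; linear_combination (3 / 16) * hn
    have hnt : n = (16 + 4 * t) / 3 := by rw [ht]; ring
    clear_value t
    subst hnt
    have hut : w = (8 + t) / 54 := by grind
    refine ⟨t, ht2, hx.trans hut, ?_, ?_, hy.trans hut, ?_, ?_⟩
    · apply mul_left_cancel₀ hD
      rw [c1, hut]
      grind
    · apply mul_left_cancel₀ hD
      rw [c2, hut]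
      grind
    · apply mul_left_cancel₀ hD
      rw [c1', hut]
      grind
    · apply mul_left_cancel₀ hD
      rw [c2', hut]
      grind
  · have hn : n = 16 / 3 := by linear_combination -h0 / 3
    subst hn
    have hd : (u - w) ^ 2 = 5 / 64 := by grind
    have hd' : (u - w - s / 8) * (u - w + s / 8) = 0 := by linear_combination hd - hs / 64
    rcases mul_eq_zero.mp hd' with hd1 | hd1
    · left; right; right; right
      have hu' : u = (3 + s) / 16 := by grind
      have hw' : w = (3 - s) / 16 := by grind
      refine ⟨hx.trans hu', ?_, ?_, hy.trans hw', ?_, ?_⟩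
      · apply mul_left_cancel₀ hD
        rw [c1, hu', hw']
        grind
      · apply mul_left_cancel₀ hD
        rw [c2, hu', hw']
        grind
      · apply mul_left_cancel₀ hD
        rw [c1', hu', hw']
        grind
      · apply mul_left_cancel₀ hD
        rw [c2', hu', hw']
        grind
    · right; right; right; right
      have hu' : u = (3 - s) / 16 := by grind
      have hw' : w = (3 + s) / 16 := by grind
      refine ⟨hy.trans hw', ?_, ?_, hx.trans hu', ?_, ?_⟩
      · apply mul_left_cancel₀ hD
        rw [c1', hu', hw']
        grind
      · apply mul_left_cancel₀ hD
        rw [c2', hu', hw']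
        grind
      · apply mul_left_cancel₀ hD
        rw [c1, hu', hw']
        grind
      · apply mul_left_cancel₀ hD
        rw [c2, hu', hw']
        grind

/-- The solutions of the Lagrange equations on the quartic. -/
theorem critClass_of_lagrange {z s n x x' y y' : ℂ} (hz : z ^ 2 = -15) (hs : s ^ 2 = 5)
    (h : Lagrange z n (x * x' - y * y') x x') (h' : Lagrange z n (y * y' - x * x') y y')
    (hQ : -1 + 6 * (x * x' + y * y') - 4 * (x ^ 3 + x' ^ 3 + y ^ 3 + y' ^ 3)
      + 3 * (x * x' - y * y') ^ 2 = 0) :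
    CritClass z s x x' y y' ∨ CritClass z s y y' x x' := by
  -- If `4 n² - 11 n + 16 = 0`, both products vanish, hence `n = 2`, which is not a root.
  have hpair : ∀ {a a' b b' : ℂ}, Lagrange z n (a * a' - b * b') a a' →
      Lagrange z n (b * b' - a * a') b b' → a * a' = 0 → a = 0 ∧ a' = 0 := by
    intro a a' b b' g g' ha
    rcases g.eq_zero_or hz ha with h1 | ⟨h1, h2⟩
    · exact h1
    exfalso
    by_cases hb : b * b' = 0
    · rw [ha, hb] at h1
      have hn : n = 2 := by linear_combination h1
      subst hn
      norm_num at h2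
    · exact g'.ne_zero hz hb h2
  by_cases hu : x * x' = 0
  · obtain ⟨rfl, rfl⟩ := hpair h h' hu
    by_cases hv : y * y' = 0
    · obtain ⟨rfl, rfl⟩ := hpair h' h hv
      norm_num at hQ
    · right
      refine critClass_of_eq_zero hz (n := n) ?_ hv (by linear_combination hQ)
      simpa using h'
  · by_cases hv : y * y' = 0
    · obtain ⟨rfl, rfl⟩ := hpair h' h hv
      left
      refine critClass_of_eq_zero hz (n := n) ?_ hu (by linear_combination hQ)
      simpa using h
    · exact critClass_of_ne_zero hz hs h h' hu hv hQ

/-! ### Coordinates diagonalising the action of the cyclic subgroups of order three -/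

/-- `√-3`. -/
def r3 : ℂ := Complex.I * ((√3 : ℝ) : ℂ)

theorem r3_sq : r3 ^ 2 = -3 := by
  rw [r3, mul_pow, Complex.I_sq, ← Complex.ofReal_pow, Real.sq_sqrt (by norm_num)]
  norm_num

/-- A primitive cube root of unity. -/
def om : ℂ := (-1 + r3) / 2

theorem om_sq : om ^ 2 = -1 - om := by
  unfold om
  linear_combination r3_sq / 4

theorem om_cube : om ^ 3 = 1 := by
  linear_combination (om - 1) * om_sq

/-- The coordinate `x` on the space of the five quartics. Left and right multiplication by `S`
multiply `x, x', y, y'` by cube roots of unity. -/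
def cx (a : Fin 5 → ℂ) : ℂ := a 0 - a 1 - a 2 - a 3 - 2 * r3 * a 4

/-- The coordinate `x'` on the space of the five quartics. -/
def cx' (a : Fin 5 → ℂ) : ℂ := a 0 - a 1 - a 2 - a 3 + 2 * r3 * a 4

/-- The coordinate `y` on the space of the five quartics. -/
def cy (a : Fin 5 → ℂ) : ℂ := 2 * (a 1 + om * a 2 + (-1 - om) * a 3)

/-- The coordinate `y'` on the space of the five quartics. -/
def cy' (a : Fin 5 → ℂ) : ℂ := 2 * (a 1 + (-1 - om) * a 2 + om * a 3)

/-- In the coordinates `x, x', y, y'` the equation between the gradients splits into one pair of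
equations for `(x, x')` and one for `(y, y')`. -/
theorem lagrange_of_multiplier {lam μ : ℂ} {v : V}
    (hs : quartics v 0 + quartics v 1 + quartics v 2 + quartics v 3 = 1)
    (h : cubicGrad lam v = μ • quarticGrad (quartics v)) :
    Lagrange (s5 * r3) (18 * μ) (cx (quartics v) * cx' (quartics v)
      - cy (quartics v) * cy' (quartics v)) (cx (quartics v)) (cx' (quartics v)) ∧
    Lagrange (s5 * r3) (18 * μ) (cy (quartics v) * cy' (quartics v)
      - cx (quartics v) * cx' (quartics v)) (cy (quartics v)) (cy' (quartics v)) := by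
  have h0 := congrFun h 0
  have h1 := congrFun h 1
  have h2 := congrFun h 2
  have h3 := congrFun h 3
  have h4 := congrFun h 4
  simp only [cubicGrad, cubic0, cubic1, cubic4, quarticGrad, quartics, Pi.smul_apply, smul_eq_mul,
    Matrix.cons_val_zero, Matrix.cons_val_one, Matrix.cons_val, cx, cx', cy, cy', om, Lagrange]
    at h0 h1 h2 h3 h4 hs ⊢
  have hr := r3_sq
  generalize eval v f0 = a0, eval v f1 = a1, eval v f2 = a2, eval v f3 = a3,
    eval v f4 = a4, r3 = r, s5 = s at *
  obtain rfl : a0 = 1 - a1 - a2 - a3 := by linear_combination hs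
  clear h hs
  refine ⟨⟨?_, ?_⟩, ?_, ?_⟩
  · linear_combination (norm := skip) 3 * h0 - (h1 + h2 + h3) + r * h4
    clear h0 h1 h2 h3 h4
    grind
  · linear_combination (norm := skip) 3 * h0 - (h1 + h2 + h3) - r * h4
    clear h0 h1 h2 h3 h4
    grind
  · linear_combination (norm := skip) 2 * h1 - (1 + r) * h2 - (1 - r) * h3
    clear h0 h1 h2 h3 h4
    grind
  · linear_combination (norm := skip) 2 * h1 - (1 - r) * h2 - (1 + r) * h3
    clear h0 h1 h2 h3 h4
    grind

theorem cx_mul_cx' (a : Fin 5 → ℂ) :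
    cx a * cx' a = (a 0 - a 1 - a 2 - a 3) ^ 2 + 12 * a 4 ^ 2 := by
  unfold cx cx'
  linear_combination -4 * a 4 ^ 2 * r3_sq

theorem cy_mul_cy' (a : Fin 5 → ℂ) :
    cy a * cy' a = 4 * ((a 1 + a 2 + a 3) ^ 2 - 3 * (a 1 * a 2 + a 1 * a 3 + a 2 * a 3)) := by
  unfold cy cy'
  linear_combination 4 * (-a 2 ^ 2 - a 3 ^ 2 + 2 * a 2 * a 3) * om_sq

theorem sum_cubes (a : Fin 5 → ℂ) : cx a ^ 3 + cx' a ^ 3 + cy a ^ 3 + cy' a ^ 3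
    = 2 * (a 0 - a 1 - a 2 - a 3) ^ 3 - 72 * (a 0 - a 1 - a 2 - a 3) * a 4 ^ 2
      + 8 * (2 * (a 1 + a 2 + a 3) ^ 3
        - 9 * (a 1 + a 2 + a 3) * (a 1 * a 2 + a 1 * a 3 + a 2 * a 3)
        + 27 * (a 1 * a 2 * a 3)) := by
  have h1 := r3_sq
  have h2 := om_sq
  unfold cx cx' cy cy'
  generalize a 0 = a0, a 1 = a1, a 2 = a2, a 3 = a3, a 4 = a4, r3 = r, om = o at *
  grind

/-- The quartic relation between the five quartics. -/
theorem quartic_relation (v : V)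
    (hs : quartics v 0 + quartics v 1 + quartics v 2 + quartics v 3 = 1) :
    -1 + 6 * (cx (quartics v) * cx' (quartics v) + cy (quartics v) * cy' (quartics v))
      - 4 * (cx (quartics v) ^ 3 + cx' (quartics v) ^ 3 + cy (quartics v) ^ 3
        + cy' (quartics v) ^ 3)
      + 3 * (cx (quartics v) * cx' (quartics v) - cy (quartics v) * cy' (quartics v)) ^ 2 = 0 := by
  rw [sum_cubes, cx_mul_cx', cy_mul_cy']
  have key : ∀ s : ℂ, s = quartics v 0 + quartics v 1 + quartics v 2 + quartics v 3 →
      -s ^ 4 + 6 * s ^ 2 * ((quartics v 0 - quartics v 1 - quartics v 2 - quartics v 3) ^ 2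
        + 12 * quartics v 4 ^ 2 + 4 * ((quartics v 1 + quartics v 2 + quartics v 3) ^ 2
          - 3 * (quartics v 1 * quartics v 2 + quartics v 1 * quartics v 3
            + quartics v 2 * quartics v 3)))
      - 4 * s * (2 * (quartics v 0 - quartics v 1 - quartics v 2 - quartics v 3) ^ 3
        - 72 * (quartics v 0 - quartics v 1 - quartics v 2 - quartics v 3) * quartics v 4 ^ 2
        + 8 * (2 * (quartics v 1 + quartics v 2 + quartics v 3) ^ 3
          - 9 * (quartics v 1 + quartics v 2 + quartics v 3) * (quartics v 1 * quartics v 2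
            + quartics v 1 * quartics v 3 + quartics v 2 * quartics v 3)
          + 27 * (quartics v 1 * quartics v 2 * quartics v 3)))
      + 3 * ((quartics v 0 - quartics v 1 - quartics v 2 - quartics v 3) ^ 2
        + 12 * quartics v 4 ^ 2 - 4 * ((quartics v 1 + quartics v 2 + quartics v 3) ^ 2
          - 3 * (quartics v 1 * quartics v 2 + quartics v 1 * quartics v 3
            + quartics v 2 * quartics v 3))) ^ 2 = 0 := by
    rintro s rfl
    simp only [quartics_eq, Matrix.cons_val_zero, Matrix.cons_val_one, Matrix.cons_val]
    generalize v 0 = a, v 1 = b, v 2 = c, v 3 = d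
    ring
  have h := key 1 hs.symm
  linear_combination h

/-- The invariants of the points of the singular locus of the quartic. -/
theorem hasInvariants_of_quarticGrad_eq_zero {v : V}
    (hs : quartics v 0 + quartics v 1 + quartics v 2 + quartics v 3 = 1)
    (h : quarticGrad (quartics v) = 0) :
    ∃ m : ℂ, HasInvariants (cx (quartics v)) (cx' (quartics v)) (cy (quartics v))
      (cy' (quartics v)) (m ^ 2) (m ^ 3) (m ^ 3) ((1 - m) ^ 2) ((1 - m) ^ 3) ((1 - m) ^ 3) := by
  have hQ := quartic_relation v hs
  have heq : 2 * cx (quartics v) ^ 2 = cx' (quartics v) * (1 + (cx (quartics v) * cx' (quartics v)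
      - cy (quartics v) * cy' (quartics v))) ∧
    2 * cx' (quartics v) ^ 2 = cx (quartics v) * (1 + (cx (quartics v) * cx' (quartics v)
      - cy (quartics v) * cy' (quartics v))) ∧
    2 * cy (quartics v) ^ 2 = cy' (quartics v) * (1 - (cx (quartics v) * cx' (quartics v)
      - cy (quartics v) * cy' (quartics v))) ∧
    2 * cy' (quartics v) ^ 2 = cy (quartics v) * (1 - (cx (quartics v) * cx' (quartics v)
      - cy (quartics v) * cy' (quartics v))) := by
    clear hQ
    have h0 := congrFun h 0
    have h1 := congrFun h 1
    have h2 := congrFun h 2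
    have h3 := congrFun h 3
    have h4 := congrFun h 4
    simp only [quarticGrad, Matrix.cons_val_zero, Matrix.cons_val_one, Matrix.cons_val, cx, cx',
      cy, cy', om, Pi.zero_apply] at h0 h1 h2 h3 h4 ⊢
    have hr := r3_sq
    generalize quartics v 0 = a0, quartics v 1 = a1, quartics v 2 = a2, quartics v 3 = a3,
      quartics v 4 = a4, r3 = r at *
    obtain rfl : a0 = 1 - a1 - a2 - a3 := by linear_combination hs
    clear h hs
    refine ⟨?_, ?_, ?_, ?_⟩
    · linear_combination (norm := skip) (-3 * h0 + (h1 + h2 + h3) - r * h4) / 72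
      clear h0 h1 h2 h3 h4
      grind
    · linear_combination (norm := skip) (-3 * h0 + (h1 + h2 + h3) + r * h4) / 72
      clear h0 h1 h2 h3 h4
      grind
    · linear_combination (norm := skip) (-2 * h1 + (1 + r) * h2 + (1 - r) * h3) / 72
      clear h0 h1 h2 h3 h4
      grind
    · linear_combination (norm := skip) (-2 * h1 + (1 - r) * h2 + (1 + r) * h3) / 72
      clear h0 h1 h2 h3 h4
      grind
  generalize cx (quartics v) = x, cx' (quartics v) = x', cy (quartics v) = y,
    cy' (quartics v) = y' at *
  obtain ⟨e1, e2, e3, e4⟩ := heq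
  clear hs h
  have hpair : ∀ {a a' e : ℂ}, 2 * a ^ 2 = a' * e → 2 * a' ^ 2 = a * e → a * a' = 0 →
      a = 0 ∧ a' = 0 := by
    intro a a' e g g' h
    rcases mul_eq_zero.mp h with rfl | rfl
    · exact ⟨rfl, by simpa using g'⟩
    · exact ⟨by simpa using g, rfl⟩
  have hsq : ∀ {a a' e : ℂ}, 2 * a ^ 2 = a' * e → 2 * a' ^ 2 = a * e → a * a' ≠ 0 →
      a * a' = (e / 2) ^ 2 := by
    intro a a' e g g' h
    apply mul_left_cancel₀ h
    linear_combination a' ^ 2 / 2 * g + a' * e / 4 * g'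
  have hcube : ∀ {a a' e : ℂ}, 2 * a ^ 2 = a' * e → 2 * a' ^ 2 = a * e → a * a' = (e / 2) ^ 2 →
      a ^ 3 = (e / 2) ^ 3 ∧ a' ^ 3 = (e / 2) ^ 3 := by
    intro a a' e g g' h
    exact ⟨by linear_combination a / 2 * g + e / 2 * h,
      by linear_combination a' / 2 * g' + e / 2 * h⟩
  have hm : x * x' = ((1 + (x * x' - y * y')) / 2) ^ 2 ∧
      y * y' = ((1 - (x * x' - y * y')) / 2) ^ 2 := by
    by_cases hu : x * x' = 0
    · obtain ⟨rfl, rfl⟩ := hpair e1 e2 hu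
      by_cases hv : y * y' = 0
      · obtain ⟨rfl, rfl⟩ := hpair e3 e4 hv
        norm_num at hQ
      · have := hsq e3 e4 hv
        refine ⟨?_, this⟩
        linear_combination this
    · by_cases hv : y * y' = 0
      · obtain ⟨rfl, rfl⟩ := hpair e3 e4 hv
        have := hsq e1 e2 hu
        refine ⟨this, ?_⟩
        linear_combination this
      · exact ⟨hsq e1 e2 hu, hsq e3 e4 hv⟩
  refine ⟨(1 + (x * x' - y * y')) / 2, hm.1, (hcube e1 e2 hm.1).1, (hcube e1 e2 hm.1).2, ?_⟩
  rw [show 1 - (1 + (x * x' - y * y')) / 2 = (1 - (x * x' - y * y')) / 2 by ring]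
  exact ⟨hm.2, hcube e3 e4 hm.2⟩

/-- The possible invariants of the singular vectors off the quadric, normalised by `q² = 1`. -/
theorem hasInvariants_of_singAt {lam : ℂ} {v : V} (h : SingAt (pencil lam) v)
    (hs : quartics v 0 + quartics v 1 + quartics v 2 + quartics v 3 = 1) :
    (∃ m : ℂ, HasInvariants (cx (quartics v)) (cx' (quartics v)) (cy (quartics v))
      (cy' (quartics v)) (m ^ 2) (m ^ 3) (m ^ 3) ((1 - m) ^ 2) ((1 - m) ^ 3) ((1 - m) ^ 3)) ∨
    CritClass (s5 * r3) s5 (cx (quartics v)) (cx' (quartics v)) (cy (quartics v))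
      (cy' (quartics v)) ∨
    CritClass (s5 * r3) s5 (cy (quartics v)) (cy' (quartics v)) (cx (quartics v))
      (cx' (quartics v)) := by
  rcases exists_multiplier h with h0 | ⟨μ, hμ⟩
  · exact Or.inl (hasInvariants_of_quarticGrad_eq_zero hs h0)
  · right
    obtain ⟨h1, h2⟩ := lagrange_of_multiplier hs hμ
    exact critClass_of_lagrange (by rw [mul_pow, s5_sq, r3_sq]; norm_num) s5_sq h1 h2
      (quartic_relation v hs)

/-! ### The action on `ℂ⁴` -/

/-- The representation `(a, b) ↦ (x ↦ a x b⁻¹)` of `SU(2) × SU(2)` on `ℂ⁴`. -/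
def rep : UnitQuaternions × UnitQuaternions →* GL4 := complexify.comp doubleCover

theorem rep_smul (a b : UnitQuaternions) (v : V) : rep (a, b) • v
    = Matrix.mulVec ((leftMatrix a.1 * rightMatrix b.1).map Complex.ofReal) v := rfl

/-- The action of the first factor in coordinates. -/
theorem rep_left (a : UnitQuaternions) (v : V) : rep (a, 1) • v =
    ![a.1.re * v 0 - a.1.imI * v 1 - a.1.imJ * v 2 - a.1.imK * v 3,
      a.1.imI * v 0 + a.1.re * v 1 - a.1.imK * v 2 + a.1.imJ * v 3,
      a.1.imJ * v 0 + a.1.imK * v 1 + a.1.re * v 2 - a.1.imI * v 3,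
      a.1.imK * v 0 - a.1.imJ * v 1 + a.1.imI * v 2 + a.1.re * v 3] := by
  have h : rightMatrix (1 : UnitQuaternions).1 = 1 := by
    ext i j
    fin_cases i <;> fin_cases j <;> simp [rightMatrix]
  rw [rep_smul, h, mul_one]
  ext i
  fin_cases i <;>
  · simp [leftMatrix, Matrix.mulVec, dotProduct, Fin.sum_univ_four]
    try ring

/-- The action of the second factor in coordinates. -/
theorem rep_right (b : UnitQuaternions) (v : V) : rep (1, b) • v =
    ![b.1.re * v 0 + b.1.imI * v 1 + b.1.imJ * v 2 + b.1.imK * v 3,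
      -b.1.imI * v 0 + b.1.re * v 1 - b.1.imK * v 2 + b.1.imJ * v 3,
      -b.1.imJ * v 0 + b.1.imK * v 1 + b.1.re * v 2 - b.1.imI * v 3,
      -b.1.imK * v 0 - b.1.imJ * v 1 + b.1.imI * v 2 + b.1.re * v 3] := by
  have h : leftMatrix (1 : UnitQuaternions).1 = 1 := by
    ext i j
    fin_cases i <;> fin_cases j <;> simp [leftMatrix]
  rw [rep_smul, h, one_mul]
  ext i
  fin_cases i <;>
  · simp [rightMatrix, Matrix.mulVec, dotProduct, Fin.sum_univ_four]
    try ring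

/-- The action of `(a, b)` on a real vector, seen as a quaternion. -/
theorem rep_smul_coords (a b : UnitQuaternions) (x : ℍ[ℝ]) :
    rep (a, b) • (fun i => (coords x i : ℂ)) = fun i => (coords (a.1 * x * star b.1) i : ℂ) := by
  rw [rep_smul, mul_assoc, ← leftMatrix_mulVec, ← rightMatrix_mulVec, Matrix.mulVec_mulVec]
  ext i
  simp [Matrix.mulVec, dotProduct]

theorem rep_mem {a b : UnitQuaternions} (ha : a ∈ binaryIcosahedral) (hb : b ∈ binaryOctahedral) :
    rep (a, b) ∈ icosaOcta := Subgroup.mem_map_of_mem _ (Subgroup.mem_prod.mpr ⟨ha, hb⟩)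

theorem rep_left_mem {a : UnitQuaternions} (ha : a ∈ binaryIcosahedral) :
    rep (a, 1) ∈ icosaOcta := rep_mem ha (one_mem _)

theorem rep_right_mem {b : UnitQuaternions} (hb : b ∈ binaryOctahedral) :
    rep (1, b) ∈ icosaOcta := rep_mem (one_mem _) hb

/-- The points of projective space defined by `v` and `w` lie in the same `IO`-orbit. -/
def SameOrbit (v w : V) : Prop := ∃ g ∈ icosaOcta, ∃ c : ℂ, c ≠ 0 ∧ v = c • g • w

theorem SameOrbit.refl (v : V) : SameOrbit v v := ⟨1, one_mem _, 1, one_ne_zero, by simp⟩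

theorem SameOrbit.symm {v w : V} (h : SameOrbit v w) : SameOrbit w v := by
  obtain ⟨g, hg, c, hc, rfl⟩ := h
  refine ⟨g⁻¹, inv_mem hg, c⁻¹, inv_ne_zero hc, ?_⟩
  rw [smul_comm g⁻¹ c, inv_smul_smul, smul_smul, inv_mul_cancel₀ hc, one_smul]

theorem SameOrbit.trans {u v w : V} (h : SameOrbit u v) (h' : SameOrbit v w) :
    SameOrbit u w := by
  obtain ⟨g, hg, c, hc, rfl⟩ := h
  obtain ⟨k, hk, d, hd, rfl⟩ := h'
  exact ⟨g * k, mul_mem hg hk, c * d, mul_ne_zero hc hd, by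
    rw [smul_comm g d, smul_smul, smul_smul]⟩

theorem sameOrbit_smul {g : GL4} (hg : g ∈ icosaOcta) (v : V) : SameOrbit (g • v) v :=
  ⟨g, hg, 1, one_ne_zero, by simp⟩

theorem sameOrbit_smul_left {c : ℂ} (hc : c ≠ 0) (v : V) : SameOrbit (c • v) v :=
  ⟨1, one_mem _, c, hc, by simp⟩

/-! ### The binary tetrahedral group -/

/-- The binary tetrahedral group. -/
def binaryTetrahedral : Subgroup UnitQuaternions := Subgroup.closure {A1, S}

theorem tetrahedral_le_icosahedral : binaryTetrahedral ≤ binaryIcosahedral :=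
  Subgroup.closure_mono (by intro x; simp; tauto)

theorem tetrahedral_le_octahedral : binaryTetrahedral ≤ binaryOctahedral :=
  Subgroup.closure_mono (by intro x; simp; tauto)

theorem A1_mem : A1 ∈ binaryTetrahedral := Subgroup.subset_closure (by simp)

theorem S_mem : S ∈ binaryTetrahedral := Subgroup.subset_closure (by simp)

theorem U_mem : U ∈ binaryIcosahedral := Subgroup.subset_closure (by simp)

theorem R4_mem : R4 ∈ binaryOctahedral := Subgroup.subset_closure (by simp)

/-- The quaternion `j`. -/
def J1 : UnitQuaternions := unitQuat 0 0 1 0 (by norm_num)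

/-- The quaternion `k`. -/
def K1 : UnitQuaternions := unitQuat 0 0 0 1 (by norm_num)

theorem unitQuat_mul (a b c d a' b' c' d' : ℝ) (h : a ^ 2 + b ^ 2 + c ^ 2 + d ^ 2 = 1)
    (h' : a' ^ 2 + b' ^ 2 + c' ^ 2 + d' ^ 2 = 1) :
    unitQuat a b c d h * unitQuat a' b' c' d' h' =
      unitQuat (a * a' - b * b' - c * c' - d * d') (a * b' + b * a' + c * d' - d * c')
        (a * c' - b * d' + c * a' + d * b') (a * d' + b * c' - c * b' + d * a')
        (by linear_combination (a ^ 2 + b ^ 2 + c ^ 2 + d ^ 2) * h' + h) := by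
  apply Subtype.ext
  change quat a b c d * quat a' b' c' d' = quat _ _ _ _
  apply Quaternion.ext
  · exact Quaternion.re_mul _ _
  · exact Quaternion.imI_mul _ _
  · exact Quaternion.imJ_mul _ _
  · exact Quaternion.imK_mul _ _

theorem unitQuat_inv (a b c d : ℝ) (h : a ^ 2 + b ^ 2 + c ^ 2 + d ^ 2 = 1) :
    (unitQuat a b c d h)⁻¹ = unitQuat a (-b) (-c) (-d) (by linear_combination h) := by
  rw [inv_eq_iff_mul_eq_one, unitQuat_mul]
  apply Subtype.ext
  apply QuaternionAlgebra.ext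
  · simp [unitQuat, quat]
    linear_combination h
  all_goals simp [unitQuat, quat]
  all_goals ring

theorem unitQuat_congr {a b c d a' b' c' d' : ℝ} {h : a ^ 2 + b ^ 2 + c ^ 2 + d ^ 2 = 1}
    {h' : a' ^ 2 + b' ^ 2 + c' ^ 2 + d' ^ 2 = 1} (ha : a = a') (hb : b = b') (hc : c = c')
    (hd : d = d') : unitQuat a b c d h = unitQuat a' b' c' d' h' := by
  subst ha hb hc hd
  rfl

theorem K1_eq : K1 = S * A1 * S⁻¹ := by
  rw [S, A1, K1, unitQuat_inv, unitQuat_mul, unitQuat_mul]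
  apply unitQuat_congr <;> norm_num

theorem K1_mem : K1 ∈ binaryTetrahedral := by
  rw [K1_eq]
  exact mul_mem (mul_mem S_mem A1_mem) (inv_mem S_mem)

theorem J1_mem : J1 ∈ binaryTetrahedral := by
  have : J1 = K1 * A1 := by
    rw [J1, K1, A1, unitQuat_mul]
    apply unitQuat_congr <;> norm_num
  rw [this]
  exact mul_mem K1_mem A1_mem

/-! ### The quartics separate the orbits of the Heisenberg group -/

/-- Vectors with equal squares of the coordinates and equal products of the coordinates differ by
an even number of signs. -/
theorem exists_even_signs {a b : Fin 4 → ℂ} (h : ∀ i, a i ^ 2 = b i ^ 2)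
    (hp : a 0 * a 1 * a 2 * a 3 = b 0 * b 1 * b 2 * b 3) :
    ∃ s0 s1 s2 : ℂ, (s0 = 1 ∨ s0 = -1) ∧ (s1 = 1 ∨ s1 = -1) ∧ (s2 = 1 ∨ s2 = -1) ∧
      a 0 = s0 * b 0 ∧ a 1 = s1 * b 1 ∧ a 2 = s2 * b 2 ∧ a 3 = s0 * s1 * s2 * b 3 := by
  have hs : ∀ i, ∃ s : ℂ, (s = 1 ∨ s = -1) ∧ a i = s * b i := by
    intro i
    rcases sq_eq_sq_iff_eq_or_eq_neg.mp (h i) with h | h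
    · exact ⟨1, Or.inl rfl, by rw [h, one_mul]⟩
    · exact ⟨-1, Or.inr rfl, by rw [h]; ring⟩
  choose s hs1 hs2 using hs
  have hsq : ∀ i, s i * s i = 1 := by
    intro i
    rcases hs1 i with h | h <;> rw [h] <;> norm_num
  have hneg : ∀ i, -s i = 1 ∨ -s i = -1 := by
    intro i
    rcases hs1 i with h | h <;> rw [h] <;> simp
  have h3 : (s 0 * s 1 * s 2 - s 3) * (b 0 * b 1 * b 2 * b 3) = 0 := by
    rw [hs2 0, hs2 1, hs2 2, hs2 3] at hp
    linear_combination s 3 * hp - s 0 * s 1 * s 2 * b 0 * b 1 * b 2 * b 3 * hsq 3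
  have hodd : s 0 * s 1 * s 2 = s 3 ∨ s 0 * s 1 * s 2 = -s 3 := by
    apply sq_eq_sq_iff_eq_or_eq_neg.mp
    linear_combination (s 1 * s 2) ^ 2 * hsq 0 + s 2 ^ 2 * hsq 1 + hsq 2 - hsq 3
  rcases hodd with h4 | h4
  · exact ⟨s 0, s 1, s 2, hs1 0, hs1 1, hs1 2, hs2 0, hs2 1, hs2 2, by rw [h4, hs2 3]⟩
  have h5 : b 0 * b 1 * b 2 * b 3 = 0 := by
    rw [h4] at h3
    rcases hs1 3 with h | h <;> rw [h] at h3
    · linear_combination (-1 / 2) * h3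
    · linear_combination (1 / 2) * h3
  -- One of the `b i` vanishes, so that its sign is free.
  have h6 : s 3 = -(s 0 * s 1 * s 2) := by rw [h4, neg_neg]
  rcases mul_eq_zero.mp h5 with h5 | h5
  · rcases mul_eq_zero.mp h5 with h5 | h5
    · rcases mul_eq_zero.mp h5 with h5 | h5
      · exact ⟨-s 0, s 1, s 2, hneg 0, hs1 1, hs1 2, by rw [hs2 0, h5]; ring, hs2 1, hs2 2, by
          rw [hs2 3, h6]; ring⟩
      · exact ⟨s 0, -s 1, s 2, hs1 0, hneg 1, hs1 2, hs2 0, by rw [hs2 1, h5]; ring, hs2 2, by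
          rw [hs2 3, h6]; ring⟩
    · exact ⟨s 0, s 1, -s 2, hs1 0, hs1 1, hneg 2, hs2 0, hs2 1, by rw [hs2 2, h5]; ring, by
        rw [hs2 3, h6]; ring⟩
  · exact ⟨s 0, s 1, s 2, hs1 0, hs1 1, hs1 2, hs2 0, hs2 1, hs2 2, by rw [hs2 3, h5]; ring⟩

theorem A1_left (v : V) : rep (A1, 1) • v = ![-v 1, v 0, -v 3, v 2] := by
  rw [rep_left]
  simp [A1, unitQuat, quat]

theorem J1_left (v : V) : rep (J1, 1) • v = ![-v 2, v 3, v 0, -v 1] := by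
  rw [rep_left]
  simp [J1, unitQuat, quat]

theorem K1_left (v : V) : rep (K1, 1) • v = ![-v 3, -v 2, v 1, v 0] := by
  rw [rep_left]
  simp [K1, unitQuat, quat]

theorem A1_right (v : V) : rep (1, A1) • v = ![v 1, -v 0, -v 3, v 2] := by
  rw [rep_right]
  simp [A1, unitQuat, quat]

theorem J1_right (v : V) : rep (1, J1) • v = ![v 2, v 3, -v 0, -v 1] := by
  rw [rep_right]
  simp [J1, unitQuat, quat]

theorem K1_right (v : V) : rep (1, K1) • v = ![v 3, -v 2, v 1, -v 0] := by
  rw [rep_right]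
  simp [K1, unitQuat, quat]

/-- Vectors whose coordinates agree up to an even number of signs and a fourth root of unity lie
in one orbit, since conjugation by `i`, `j`, `k` changes two signs. -/
theorem sameOrbit_of_sq {v w : V} {c : ℂ} (hc : c ^ 4 = 1) (h : ∀ i, v i ^ 2 = c ^ 2 * w i ^ 2)
    (hp : v 0 * v 1 * v 2 * v 3 = w 0 * w 1 * w 2 * w 3) : SameOrbit v w := by
  have hc0 : c ≠ 0 := by
    rintro rfl
    norm_num at hc
  obtain ⟨s0, s1, s2, h0, h1, h2, e0, e1, e2, e3⟩ := exists_even_signs (a := v)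
    (b := fun i => c * w i) (fun i => by rw [h i]; ring)
    (by rw [hp]; linear_combination -(w 0 * w 1 * w 2 * w 3) * hc)
  have key : ∀ {x : UnitQuaternions}, x ∈ binaryTetrahedral →
      (rep (x, 1) * rep (1, x)) ∈ icosaOcta := fun hx =>
    mul_mem (rep_left_mem (tetrahedral_le_icosahedral hx))
      (rep_right_mem (tetrahedral_le_octahedral hx))
  have hs : s0 * c ≠ 0 := by
    rcases h0 with rfl | rfl <;> simp [hc0]
  have hv : v = ![v 0, v 1, v 2, v 3] := by ext i; fin_cases i <;> rfl
  have h00 : s0 * s0 = 1 := by rcases h0 with rfl | rfl <;> norm_num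
  have g1 : s1 = s0 ∨ s1 = -s0 := by
    rcases h0 with rfl | rfl <;> rcases h1 with rfl | rfl <;> simp
  have g2 : s2 = s0 ∨ s2 = -s0 := by
    rcases h0 with rfl | rfl <;> rcases h2 with rfl | rfl <;> simp
  rcases g1 with rfl | rfl <;> rcases g2 with rfl | rfl
  · refine ⟨1, one_mem _, s2 * c, hs, ?_⟩
    rw [hv, e0, e1, e2, e3, h00, one_smul]
    ext i
    fin_cases i <;> simp <;> ring
  · refine ⟨_, key A1_mem, s1 * c, hs, ?_⟩
    rw [mul_smul (rep (A1, 1)), A1_right, A1_left, hv, e0, e1, e2, e3, h00]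
    ext i
    fin_cases i <;> simp <;> ring
  · refine ⟨_, key J1_mem, s2 * c, hs, ?_⟩
    rw [mul_smul (rep (J1, 1)), J1_right, J1_left, hv, e0, e1, e2, e3]
    ext i
    fin_cases i <;> simp <;> try ring1
    linear_combination s2 * c * w 3 * h00
  · refine ⟨_, key K1_mem, s0 * c, hs, ?_⟩
    rw [mul_smul (rep (K1, 1)), K1_right, K1_left, hv, e0, e1, e2, e3]
    ext i
    fin_cases i <;> simp <;> try ring1
    linear_combination s0 * c * w 3 * h00

/-- The five quartics determine the squares and the product of the four sums
`x₀² ± x₁² ± x₂² ± x₃²` with an even number of minus signs, and the product of the coordinates. -/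
theorem quartics_of_hadamard {v w : V} (h : quartics v = quartics w) :
    (∀ i, (![v 0 ^ 2 + v 1 ^ 2 + v 2 ^ 2 + v 3 ^ 2, v 0 ^ 2 + v 1 ^ 2 - v 2 ^ 2 - v 3 ^ 2,
      v 0 ^ 2 - v 1 ^ 2 + v 2 ^ 2 - v 3 ^ 2, v 0 ^ 2 - v 1 ^ 2 - v 2 ^ 2 + v 3 ^ 2] :
        Fin 4 → ℂ) i ^ 2
      = (![w 0 ^ 2 + w 1 ^ 2 + w 2 ^ 2 + w 3 ^ 2, w 0 ^ 2 + w 1 ^ 2 - w 2 ^ 2 - w 3 ^ 2,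
      w 0 ^ 2 - w 1 ^ 2 + w 2 ^ 2 - w 3 ^ 2, w 0 ^ 2 - w 1 ^ 2 - w 2 ^ 2 + w 3 ^ 2] :
        Fin 4 → ℂ) i ^ 2) ∧
    (v 0 ^ 2 + v 1 ^ 2 + v 2 ^ 2 + v 3 ^ 2) * (v 0 ^ 2 + v 1 ^ 2 - v 2 ^ 2 - v 3 ^ 2) *
      (v 0 ^ 2 - v 1 ^ 2 + v 2 ^ 2 - v 3 ^ 2) * (v 0 ^ 2 - v 1 ^ 2 - v 2 ^ 2 + v 3 ^ 2)
    = (w 0 ^ 2 + w 1 ^ 2 + w 2 ^ 2 + w 3 ^ 2) * (w 0 ^ 2 + w 1 ^ 2 - w 2 ^ 2 - w 3 ^ 2) *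
      (w 0 ^ 2 - w 1 ^ 2 + w 2 ^ 2 - w 3 ^ 2) * (w 0 ^ 2 - w 1 ^ 2 - w 2 ^ 2 + w 3 ^ 2) ∧
    v 0 * v 1 * v 2 * v 3 = w 0 * w 1 * w 2 * w 3 := by
  rw [quartics_eq, quartics_eq] at h
  have h0 := congrFun h 0
  have h1 := congrFun h 1
  have h2 := congrFun h 2
  have h3 := congrFun h 3
  have h4 := congrFun h 4
  simp only [Matrix.cons_val_zero, Matrix.cons_val_one, Matrix.cons_val] at h0 h1 h2 h3 h4
  clear h
  generalize v 0 = a, v 1 = b, v 2 = c, v 3 = d, w 0 = a', w 1 = b', w 2 = c', w 3 = d' at *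
  refine ⟨fun i => ?_, ?_, ?_⟩
  · fin_cases i <;> simp
    · linear_combination h0 + h1 + h2 + h3
    · linear_combination h0 + h1 - h2 - h3
    · linear_combination h0 - h1 + h2 - h3
    · linear_combination h0 - h1 - h2 + h3
  · -- The product of the four forms is `f₀² - f₁² - f₂² - f₃² + 2 f₄²`.
    have key : ∀ a b c d : ℂ, (a ^ 2 + b ^ 2 + c ^ 2 + d ^ 2) * (a ^ 2 + b ^ 2 - c ^ 2 - d ^ 2) *
        (a ^ 2 - b ^ 2 + c ^ 2 - d ^ 2) * (a ^ 2 - b ^ 2 - c ^ 2 + d ^ 2)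
        = (a ^ 4 + b ^ 4 + c ^ 4 + d ^ 4) ^ 2 - (2 * (a ^ 2 * b ^ 2 + c ^ 2 * d ^ 2)) ^ 2
          - (2 * (a ^ 2 * c ^ 2 + b ^ 2 * d ^ 2)) ^ 2 - (2 * (a ^ 2 * d ^ 2 + b ^ 2 * c ^ 2)) ^ 2
          + 2 * (4 * (a * b * c * d)) ^ 2 := by
      intros
      ring
    rw [key, key, h0, h1, h2, h3, h4]
  · linear_combination h4 / 4

/-- Two vectors at which the five quartics agree lie in one orbit. -/
theorem sameOrbit_of_quartics_eq {v w : V} (h : quartics v = quartics w) : SameOrbit v w := by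
  obtain ⟨h1, h2, h3⟩ := quartics_of_hadamard h
  obtain ⟨s0, s1, s2, g0, g1, g2, e0, e1, e2, e3⟩ := exists_even_signs h1 (by simpa using h2)
  simp only [Matrix.cons_val_zero, Matrix.cons_val_one, Matrix.cons_val] at e0 e1 e2 e3
  obtain ⟨c, hc⟩ : ∃ c : ℂ, c ^ 2 = s0 := by
    rcases g0 with rfl | rfl
    · exact ⟨1, by norm_num⟩
    · exact ⟨Complex.I, Complex.I_sq⟩
  have h00 : s0 * s0 = 1 := by rcases g0 with rfl | rfl <;> norm_num
  have hc4 : c ^ 4 = 1 := by linear_combination (c ^ 2 + s0) * hc + h00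
  have k1 : s1 = s0 ∨ s1 = -s0 := by
    rcases g0 with rfl | rfl <;> rcases g1 with rfl | rfl <;> simp
  have k2 : s2 = s0 ∨ s2 = -s0 := by
    rcases g0 with rfl | rfl <;> rcases g2 with rfl | rfl <;> simp
  have hT : ∀ {x : UnitQuaternions}, x ∈ binaryTetrahedral → ∀ w, SameOrbit (rep (x, 1) • w) w :=
    fun hx => sameOrbit_smul (rep_left_mem (tetrahedral_le_icosahedral hx))
  have h5 : s0 * s0 * s0 = s0 := by rw [h00, one_mul]
  rcases k1 with rfl | rfl <;> rcases k2 with rfl | rfl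
  · refine sameOrbit_of_sq hc4 (fun i => ?_) h3
    rw [h5] at e3
    rw [hc]
    fin_cases i <;> simp
    · linear_combination (e0 + e1 + e2 + e3) / 4
    · linear_combination (e0 + e1 - e2 - e3) / 4
    · linear_combination (e0 - e1 + e2 - e3) / 4
    · linear_combination (e0 - e1 - e2 + e3) / 4
  · refine SameOrbit.trans (sameOrbit_of_sq hc4 (fun i => ?_) ?_) (hT A1_mem w)
    · rw [mul_neg, h5] at e3
      rw [hc, A1_left]
      fin_cases i <;> simp
      · linear_combination (e0 + e1 + e2 + e3) / 4
      · linear_combination (e0 + e1 - e2 - e3) / 4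
      · linear_combination (e0 - e1 + e2 - e3) / 4
      · linear_combination (e0 - e1 - e2 + e3) / 4
    · rw [h3, A1_left]
      simp
      ring
  · refine SameOrbit.trans (sameOrbit_of_sq hc4 (fun i => ?_) ?_) (hT J1_mem w)
    · rw [mul_neg, neg_mul, h5] at e3
      rw [hc, J1_left]
      fin_cases i <;> simp
      · linear_combination (e0 + e1 + e2 + e3) / 4
      · linear_combination (e0 + e1 - e2 - e3) / 4
      · linear_combination (e0 - e1 + e2 - e3) / 4
      · linear_combination (e0 - e1 - e2 + e3) / 4
    · rw [h3, J1_left]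
      simp
      ring
  · refine SameOrbit.trans (sameOrbit_of_sq hc4 (fun i => ?_) ?_) (hT K1_mem w)
    · rw [show s0 * -s0 * -s0 = s0 by linear_combination s0 * h00] at e3
      rw [hc, K1_left]
      fin_cases i <;> simp
      · linear_combination (e0 + e1 + e2 + e3) / 4
      · linear_combination (e0 + e1 - e2 - e3) / 4
      · linear_combination (e0 - e1 + e2 - e3) / 4
      · linear_combination (e0 - e1 - e2 + e3) / 4
    · rw [h3, K1_left]
      simp
      ring

/-! ### Recognising orbits by their invariants -/

theorem s5_eq : s5 = 2 * ((tau : ℝ) : ℂ) - 1 := by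
  rw [s5, tau]
  push_cast
  ring

/-- `√2` as a complex number. -/
def s2 : ℂ := ((√2 : ℝ) : ℂ)

theorem s2_sq : s2 ^ 2 = 2 := by
  rw [s2, ← Complex.ofReal_pow, Real.sq_sqrt (by norm_num)]
  norm_num

theorem S_left (v : V) : rep (S, 1) • v =
    ![(v 0 - v 1 + v 2 - v 3) / 2, (v 0 + v 1 - v 2 - v 3) / 2,
      (-v 0 + v 1 + v 2 - v 3) / 2, (v 0 + v 1 + v 2 + v 3) / 2] := by
  rw [rep_left]
  ext i
  fin_cases i <;> simp [S, unitQuat, quat] <;> ring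

theorem S_right (v : V) : rep (1, S) • v =
    ![(v 0 + v 1 - v 2 + v 3) / 2, (-v 0 + v 1 - v 2 - v 3) / 2,
      (v 0 + v 1 + v 2 - v 3) / 2, (-v 0 + v 1 + v 2 + v 3) / 2] := by
  rw [rep_right]
  ext i
  fin_cases i <;> simp [S, unitQuat, quat] <;> ring

theorem R4_right (v : V) : rep (1, R4) • v =
    ![s2 / 2 * (v 0 + v 1), s2 / 2 * (v 1 - v 0), s2 / 2 * (v 2 - v 3),
      s2 / 2 * (v 2 + v 3)] := by
  rw [rep_right]
  ext i
  fin_cases i <;> simp [R4, unitQuat, quat, s2, Real.cos_pi_div_four, Real.sin_pi_div_four] <;> ring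

theorem U_left (v : V) : rep (U, 1) • v =
    ![((1 + s5) * v 0 - (s5 - 1) * v 2 - 2 * v 3) / 4,
      ((1 + s5) * v 1 - 2 * v 2 + (s5 - 1) * v 3) / 4,
      ((s5 - 1) * v 0 + 2 * v 1 + (1 + s5) * v 2) / 4,
      (2 * v 0 - (s5 - 1) * v 1 + (1 + s5) * v 3) / 4] := by
  rw [rep_left, s5_eq]
  ext i
  fin_cases i <;> simp [U, unitQuat, quat] <;> ring

/-- `s = ∑ fᵢ = q²` as a coordinate on the space of the five quartics. -/
def cs (a : Fin 5 → ℂ) : ℂ := a 0 + a 1 + a 2 + a 3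

/-- The quartics are determined by the coordinates `s, x, x', y, y'`. -/
theorem quartics_ext {a b : Fin 5 → ℂ} (hs : cs a = cs b) (hx : cx a = cx b) (hx' : cx' a = cx' b)
    (hy : cy a = cy b) (hy' : cy' a = cy' b) : a = b := by
  have hr : r3 ≠ 0 := by
    intro h
    have := r3_sq
    rw [h] at this
    norm_num at this
  unfold cs cx cx' cy cy' om at *
  have h4 : a 4 = b 4 := mul_left_cancel₀ hr (by linear_combination (hx' - hx) / 4)
  have h23 : a 2 - a 3 = b 2 - b 3 := mul_left_cancel₀ hr (by linear_combination (hy - hy') / 2)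
  have hm : a 0 - a 1 - a 2 - a 3 = b 0 - b 1 - b 2 - b 3 := by
    linear_combination (hx + hx') / 2
  have h1 : 2 * a 1 - a 2 - a 3 = 2 * b 1 - b 2 - b 3 := by linear_combination (hy + hy') / 2
  ext i
  fin_cases i
  · change a 0 = b 0
    linear_combination (hs + hm) / 2
  · change a 1 = b 1
    linear_combination (hs - hm) / 6 + h1 / 3
  · change a 2 = b 2
    linear_combination (hs - hm) / 6 - h1 / 6 + h23 / 2
  · change a 3 = b 3
    linear_combination (hs - hm) / 6 - h1 / 6 - h23 / 2
  · exact h4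

theorem coords_S_left (v : V) :
    cs (quartics (rep (S, 1) • v)) = cs (quartics v) ∧
    cx (quartics (rep (S, 1) • v)) = om * cx (quartics v) ∧
    cx' (quartics (rep (S, 1) • v)) = om ^ 2 * cx' (quartics v) ∧
    cy (quartics (rep (S, 1) • v)) = om * cy (quartics v) ∧
    cy' (quartics (rep (S, 1) • v)) = om ^ 2 * cy' (quartics v) := by
  rw [quartics_eq, quartics_eq, S_left, om_sq]
  simp only [cs, cx, cx', cy, cy', om, Matrix.cons_val_zero, Matrix.cons_val_one, Matrix.cons_val]
  have hr := r3_sq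
  generalize v 0 = a, v 1 = b, v 2 = c, v 3 = d, r3 = r at *
  refine ⟨by ring, ?_, ?_, ?_, ?_⟩ <;> grind

theorem coords_S_right (v : V) :
    cs (quartics (rep (1, S) • v)) = cs (quartics v) ∧
    cx (quartics (rep (1, S) • v)) = om ^ 2 * cx (quartics v) ∧
    cx' (quartics (rep (1, S) • v)) = om * cx' (quartics v) ∧
    cy (quartics (rep (1, S) • v)) = om * cy (quartics v) ∧
    cy' (quartics (rep (1, S) • v)) = om ^ 2 * cy' (quartics v) := by
  rw [quartics_eq, quartics_eq, S_right, om_sq]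
  simp only [cs, cx, cx', cy, cy', om, Matrix.cons_val_zero, Matrix.cons_val_one, Matrix.cons_val]
  have hr := r3_sq
  generalize v 0 = a, v 1 = b, v 2 = c, v 3 = d, r3 = r at *
  refine ⟨by ring, ?_, ?_, ?_, ?_⟩ <;> grind

theorem coords_R4_right (v : V) :
    cs (quartics (rep (1, R4) • v)) = cs (quartics v) ∧
    cx (quartics (rep (1, R4) • v)) = cy (quartics v) ∧
    cx' (quartics (rep (1, R4) • v)) = cy' (quartics v) ∧
    cy (quartics (rep (1, R4) • v)) = cx (quartics v) ∧
    cy' (quartics (rep (1, R4) • v)) = cx' (quartics v) := by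
  have h4 : (s2 / 2) ^ 4 = 1 / 4 := by linear_combination (s2 ^ 2 + 2) / 16 * s2_sq
  rw [quartics_eq, quartics_eq, R4_right]
  simp only [cs, cx, cx', cy, cy', om, Matrix.cons_val_zero, Matrix.cons_val_one, Matrix.cons_val]
  have hr := r3_sq
  generalize v 0 = a, v 1 = b, v 2 = c, v 3 = d, r3 = r, s2 / 2 = t at *
  refine ⟨?_, ?_, ?_, ?_, ?_⟩ <;> grind

theorem exists_om_pow {x x' y y' : ℂ} (h : x ^ 3 = y ^ 3) (h' : x' ^ 3 = y' ^ 3)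
    (hm : x * x' = y * y') : ∃ k : ℕ, x = om ^ k * y ∧ x' = om ^ (2 * k) * y' := by
  have hroot : ∀ {a b : ℂ}, a ^ 3 = b ^ 3 → ∃ k : ℕ, a = om ^ k * b := by
    intro a b h
    have : (a - b) * ((a - om * b) * (a - om ^ 2 * b)) = 0 := by
      linear_combination h + (a * b ^ 2 - b ^ 3) * om_cube + (a * b ^ 2 - a ^ 2 * b) * om_sq
    rcases mul_eq_zero.mp this with h | h
    · exact ⟨0, by linear_combination h⟩
    rcases mul_eq_zero.mp h with h | h
    · exact ⟨1, by linear_combination h⟩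
    · exact ⟨2, by linear_combination h⟩
  have hpow : ∀ k : ℕ, om ^ (3 * k) = 1 := fun k => by rw [pow_mul, om_cube, one_pow]
  by_cases hy : y = 0
  · subst hy
    have hx : x = 0 := by simpa using h
    obtain ⟨k, hk⟩ := hroot h'
    refine ⟨2 * k, by simp [hx], ?_⟩
    rw [hk, show 2 * (2 * k) = 3 * k + k by ring, pow_add, hpow, one_mul]
  · obtain ⟨k, hk⟩ := hroot h
    refine ⟨k, hk, ?_⟩
    apply mul_left_cancel₀ hy
    rw [hk] at hm
    have h3 := hpow k
    rw [show 3 * k = k + 2 * k by ring, pow_add] at h3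
    linear_combination om ^ (2 * k) * hm - y * x' * h3

theorem coords_S_left_pow (k : ℕ) (v : V) :
    cs (quartics (rep (S, 1) ^ k • v)) = cs (quartics v) ∧
    cx (quartics (rep (S, 1) ^ k • v)) = om ^ k * cx (quartics v) ∧
    cx' (quartics (rep (S, 1) ^ k • v)) = om ^ (2 * k) * cx' (quartics v) ∧
    cy (quartics (rep (S, 1) ^ k • v)) = om ^ k * cy (quartics v) ∧
    cy' (quartics (rep (S, 1) ^ k • v)) = om ^ (2 * k) * cy' (quartics v) := by
  induction k with
  | zero => simp
  | succ k ih =>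
    rw [pow_succ', mul_smul]
    obtain ⟨h1, h2, h3, h4, h5⟩ := coords_S_left (rep (S, 1) ^ k • v)
    obtain ⟨i1, i2, i3, i4, i5⟩ := ih
    rw [h1, h2, h3, h4, h5, i1, i2, i3, i4, i5]
    refine ⟨rfl, ?_, ?_, ?_, ?_⟩ <;> ring

theorem coords_S_right_pow (k : ℕ) (v : V) :
    cs (quartics (rep (1, S) ^ k • v)) = cs (quartics v) ∧
    cx (quartics (rep (1, S) ^ k • v)) = om ^ (2 * k) * cx (quartics v) ∧
    cx' (quartics (rep (1, S) ^ k • v)) = om ^ k * cx' (quartics v) ∧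
    cy (quartics (rep (1, S) ^ k • v)) = om ^ k * cy (quartics v) ∧
    cy' (quartics (rep (1, S) ^ k • v)) = om ^ (2 * k) * cy' (quartics v) := by
  induction k with
  | zero => simp
  | succ k ih =>
    rw [pow_succ', mul_smul]
    obtain ⟨h1, h2, h3, h4, h5⟩ := coords_S_right (rep (1, S) ^ k • v)
    obtain ⟨i1, i2, i3, i4, i5⟩ := ih
    rw [h1, h2, h3, h4, h5, i1, i2, i3, i4, i5]
    refine ⟨rfl, ?_, ?_, ?_, ?_⟩ <;> ring

theorem S_left_pow_mem (k : ℕ) : rep (S, 1) ^ k ∈ icosaOcta :=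
  pow_mem (rep_left_mem (tetrahedral_le_icosahedral S_mem)) k

theorem S_right_pow_mem (k : ℕ) : rep (1, S) ^ k ∈ icosaOcta :=
  pow_mem (rep_right_mem (tetrahedral_le_octahedral S_mem)) k

/-- The group generated by the left and the right multiplication by `S` acts on the two pairs of
coordinates by all pairs of cube roots of unity. -/
theorem sameOrbit_of_cubes {v w : V} (hs : cs (quartics v) = cs (quartics w))
    (h1 : cx (quartics v) ^ 3 = cx (quartics w) ^ 3)
    (h2 : cx' (quartics v) ^ 3 = cx' (quartics w) ^ 3)
    (h3 : cx (quartics v) * cx' (quartics v) = cx (quartics w) * cx' (quartics w))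
    (h4 : cy (quartics v) ^ 3 = cy (quartics w) ^ 3)
    (h5 : cy' (quartics v) ^ 3 = cy' (quartics w) ^ 3)
    (h6 : cy (quartics v) * cy' (quartics v) = cy (quartics w) * cy' (quartics w)) :
    SameOrbit v w := by
  obtain ⟨k, hk, hk'⟩ := exists_om_pow h1 h2 h3
  obtain ⟨l, hl, hl'⟩ := exists_om_pow h4 h5 h6
  have hpow : ∀ k n : ℕ, om ^ (3 * k + n) = om ^ n := fun k n => by
    rw [pow_add, pow_mul, om_cube, one_pow, one_mul]
  refine SameOrbit.trans (sameOrbit_of_quartics_eq (quartics_ext ?_ ?_ ?_ ?_ ?_))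
    ((sameOrbit_smul (S_left_pow_mem (2 * k + 2 * l)) (rep (1, S) ^ (2 * l + k) • w)).trans
      (sameOrbit_smul (S_right_pow_mem (2 * l + k)) w))
  all_goals
    obtain ⟨a1, a2, a3, a4, a5⟩ := coords_S_left_pow (2 * k + 2 * l) (rep (1, S) ^ (2 * l + k) • w)
    obtain ⟨b1, b2, b3, b4, b5⟩ := coords_S_right_pow (2 * l + k) w
  · rw [a1, b1, hs]
  · rw [a2, b2, hk, ← hpow (k + 2 * l) k]
    ring
  · rw [a3, b3, hk', ← hpow (k + 2 * l) (2 * k)]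
    ring
  · rw [a4, b4, hl, ← hpow (k + l) l]
    ring
  · rw [a5, b5, hl', ← hpow (2 * k + 2 * l) (2 * l)]
    ring

theorem quartics_smul (c : ℂ) (v : V) : quartics (c • v) = c ^ 4 • quartics v := by
  rw [quartics_eq, quartics_eq]
  ext i
  fin_cases i <;> simp <;> ring

theorem coords_smul (c : ℂ) (a : Fin 5 → ℂ) : cs (c • a) = c * cs a ∧ cx (c • a) = c * cx a ∧
    cx' (c • a) = c * cx' a ∧ cy (c • a) = c * cy a ∧ cy' (c • a) = c * cy' a := by
  simp only [cs, cx, cx', cy, cy', Pi.smul_apply, smul_eq_mul]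
  refine ⟨?_, ?_, ?_, ?_, ?_⟩ <;> ring

theorem exists_pow_four {s : ℂ} (hs : s ≠ 0) : ∃ c : ℂ, c ≠ 0 ∧ c ^ 4 * s = 1 := by
  obtain ⟨c, hc⟩ := IsAlgClosed.exists_pow_nat_eq s⁻¹ (n := 4) (by norm_num)
  refine ⟨c, ?_, by rw [hc, inv_mul_cancel₀ hs]⟩
  rintro rfl
  exact inv_ne_zero hs (by rw [← hc]; norm_num)

/-- A vector with `q² = 1` lies in the orbit of a vector with proportional invariants. -/
theorem sameOrbit_of_hasInvariants {v w : V} {u A A' z B B' s : ℂ} (hv : cs (quartics v) = 1)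
    (h : HasInvariants (cx (quartics v)) (cx' (quartics v)) (cy (quartics v)) (cy' (quartics v))
      u A A' z B B') (hs : s ≠ 0) (hw : cs (quartics w) = s)
    (h' : HasInvariants (cx (quartics w)) (cx' (quartics w)) (cy (quartics w)) (cy' (quartics w))
      (u * s ^ 2) (A * s ^ 3) (A' * s ^ 3) (z * s ^ 2) (B * s ^ 3) (B' * s ^ 3)) :
    SameOrbit v w := by
  obtain ⟨c, hc, hc4⟩ := exists_pow_four hs
  refine SameOrbit.trans ?_ (sameOrbit_smul_left hc w)
  obtain ⟨g1, g2, g3, g4, g5, g6⟩ := h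
  obtain ⟨k1, k2, k3, k4, k5, k6⟩ := h'
  obtain ⟨e1, e2, e3, e4, e5⟩ := coords_smul (c ^ 4) (quartics w)
  have h2 : (c ^ 4) ^ 2 * s ^ 2 = 1 := by rw [← mul_pow, hc4, one_pow]
  have h3 : (c ^ 4) ^ 3 * s ^ 3 = 1 := by rw [← mul_pow, hc4, one_pow]
  apply sameOrbit_of_cubes <;> rw [quartics_smul]
  · rw [e1, hw, hc4, hv]
  · rw [e2, mul_pow, k2, g2]
    linear_combination -A * h3
  · rw [e3, mul_pow, k3, g3]
    linear_combination -A' * h3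
  · rw [e2, e3, g1]
    linear_combination -u * h2 - (c ^ 4) ^ 2 * k1
  · rw [e4, mul_pow, k5, g5]
    linear_combination -B * h3
  · rw [e5, mul_pow, k6, g6]
    linear_combination -B' * h3
  · rw [e4, e5, g4]
    linear_combination -z * h2 - (c ^ 4) ^ 2 * k4

/-! ### Representatives of the four orbits -/

/-- A node of the surface with `λ = 0`. -/
def p0 : V := ![1, 0, 0, 0]

/-- A node of the surface with `λ = -1/8`. -/
def p2 : V := ![1 + s2, 1, 0, 0]

/-- For `e = √2` a node of the surface with `λ = c₂`, for `e = -√2` one of the surface with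
`λ = c₁`. -/
def pe (e : ℂ) : V := ![2 * e + s5, 1, -1, 1]

theorem hasInvariants_U_p0 : HasInvariants (cy (quartics ((4 : ℂ) • rep (U, 1) • p0)))
    (cy' (quartics ((4 : ℂ) • rep (U, 1) • p0))) (cx (quartics ((4 : ℂ) • rep (U, 1) • p0)))
    (cx' (quartics ((4 : ℂ) • rep (U, 1) • p0)))
    (1 / 4 * 256 ^ 2) ((11 - 3 * (s5 * r3)) / 128 * 256 ^ 3)
    ((11 + 3 * (s5 * r3)) / 128 * 256 ^ 3) (0 * 256 ^ 2) (0 * 256 ^ 3) (0 * 256 ^ 3) ∧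
    cs (quartics ((4 : ℂ) • rep (U, 1) • p0)) = 256 := by
  have h5 := s5_sq
  have hr := r3_sq
  have hq : quartics ((4 : ℂ) • rep (U, 1) • p0) = ![128, 48 - 16 * s5, 32, 48 + 16 * s5, 0] := by
    rw [quartics_eq, U_left]
    ext i
    fin_cases i <;> simp [p0] <;> grind
  rw [hq]
  simp only [HasInvariants, cs, cx, cx', cy, cy', om, Matrix.cons_val_zero, Matrix.cons_val_one,
    Matrix.cons_val]
  generalize s5 = s, r3 = r at *
  refine ⟨⟨?_, ?_, ?_, ?_, ?_, ?_⟩, ?_⟩ <;> grind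

theorem hasInvariants_pe {e : ℂ} (he : e ^ 2 = 2) {t : ℂ} (ht : t = -(s5 * e)) :
    HasInvariants (cx (quartics (pe e))) (cx' (quartics (pe e))) (cy (quartics (pe e)))
    (cy' (quartics (pe e))) ((10 + t) / 18 * (416 - 128 * t) ^ 2)
    ((905 + 140 * t + 15 * (s5 * r3) - 12 * t * (s5 * r3)) / 2160 * (416 - 128 * t) ^ 3)
    ((905 + 140 * t - 15 * (s5 * r3) + 12 * t * (s5 * r3)) / 2160 * (416 - 128 * t) ^ 3)
    (0 * (416 - 128 * t) ^ 2) (0 * (416 - 128 * t) ^ 3) (0 * (416 - 128 * t) ^ 3) ∧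
    cs (quartics (pe e)) = 416 - 128 * t := by
  have h5 := s5_sq
  have hr := r3_sq
  have hq : quartics (pe e) = ![332 + 104 * s5 * e, 28 + 8 * s5 * e, 28 + 8 * s5 * e,
      28 + 8 * s5 * e, -4 * s5 - 8 * e] := by
    rw [quartics_eq]
    ext i
    fin_cases i <;> simp [pe] <;> grind
  rw [hq, ht]
  simp only [HasInvariants, cs, cx, cx', cy, cy', om, Matrix.cons_val_zero, Matrix.cons_val_one,
    Matrix.cons_val]
  generalize s5 = s, r3 = r at *
  refine ⟨⟨?_, ?_, ?_, ?_, ?_, ?_⟩, ?_⟩ <;> grind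

theorem hasInvariants_U_pe {e : ℂ} (he : e ^ 2 = 2) {t : ℂ} (ht : t = s5 * e) :
    HasInvariants (cx (quartics ((4 : ℂ) • rep (U, 1) • pe e)))
    (cx' (quartics ((4 : ℂ) • rep (U, 1) • pe e))) (cy (quartics ((4 : ℂ) • rep (U, 1) • pe e)))
    (cy' (quartics ((4 : ℂ) • rep (U, 1) • pe e))) ((8 + t) / 54 * (106496 + 32768 * t) ^ 2)
    ((945 + 270 * t - 25 * (s5 * r3) + 34 * t * (s5 * r3)) / 19440 * (106496 + 32768 * t) ^ 3)
    ((945 + 270 * t + 25 * (s5 * r3) - 34 * t * (s5 * r3)) / 19440 * (106496 + 32768 * t) ^ 3)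
    ((8 + t) / 54 * (106496 + 32768 * t) ^ 2)
    ((945 + 270 * t - 25 * (s5 * r3) + 34 * t * (s5 * r3)) / 19440 * (106496 + 32768 * t) ^ 3)
    ((945 + 270 * t + 25 * (s5 * r3) - 34 * t * (s5 * r3)) / 19440 * (106496 + 32768 * t) ^ 3) ∧
    cs (quartics ((4 : ℂ) • rep (U, 1) • pe e)) = 106496 + 32768 * t := by
  have h5 := s5_sq
  have hr := r3_sq
  have hv : (4 : ℂ) • rep (U, 1) • pe e = ![2 + 2 * s5 + 2 * e + 2 * s5 * e, 2 + 2 * s5,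
      6 - 2 * s5 - 2 * e + 2 * s5 * e, 2 + 2 * s5 + 4 * e] := by
    rw [U_left]
    ext i
    fin_cases i <;> simp [pe] <;> grind
  have hq : quartics ((4 : ℂ) • rep (U, 1) • pe e) =
      ![59904 - 7680 * s5 - 12288 * e + 18432 * s5 * e,
        19968 - 2560 * s5 - 4096 * e + 6144 * s5 * e, 6656 + 2560 * s5 + 4096 * e + 2048 * s5 * e,
        19968 + 7680 * s5 + 12288 * e + 6144 * s5 * e,
        6656 + 2560 * s5 + 4096 * e + 2048 * s5 * e] := by
    rw [quartics_eq, hv]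
    ext i
    fin_cases i <;> simp <;> grind
  rw [hq, ht]
  simp only [HasInvariants, cs, cx, cx', cy, cy', om, Matrix.cons_val_zero, Matrix.cons_val_one,
    Matrix.cons_val]
  generalize s5 = s, r3 = r at *
  refine ⟨⟨?_, ?_, ?_, ?_, ?_, ?_⟩, ?_⟩ <;> grind

theorem hasInvariants_U_p2 :
    HasInvariants (cx (quartics ((4 : ℂ) • rep (U, 1) • p2)))
    (cx' (quartics ((4 : ℂ) • rep (U, 1) • p2))) (cy (quartics ((4 : ℂ) • rep (U, 1) • p2)))
    (cy' (quartics ((4 : ℂ) • rep (U, 1) • p2))) ((3 + s5) / 16 * (6144 + 4096 * s2) ^ 2)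
    ((5 + 2 * s5) * (95 + 9 * (s5 * r3)) / 5120 * (6144 + 4096 * s2) ^ 3)
    ((5 + 2 * s5) * (95 - 9 * (s5 * r3)) / 5120 * (6144 + 4096 * s2) ^ 3)
    ((3 - s5) / 16 * (6144 + 4096 * s2) ^ 2)
    ((5 - 2 * s5) * (95 + 9 * (s5 * r3)) / 5120 * (6144 + 4096 * s2) ^ 3)
    ((5 - 2 * s5) * (95 - 9 * (s5 * r3)) / 5120 * (6144 + 4096 * s2) ^ 3) ∧
    cs (quartics ((4 : ℂ) • rep (U, 1) • p2)) = 6144 + 4096 * s2 := by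
  have h5 := s5_sq
  have hr := r3_sq
  have he := s2_sq
  have hv : (4 : ℂ) • rep (U, 1) • p2 = ![1 + s5 + s2 + s5 * s2, 1 + s5,
      1 + s5 - s2 + s5 * s2, 3 - s5 + 2 * s2] := by
    rw [U_left]
    ext i
    fin_cases i <;> simp [p2] <;> grind
  have hq : quartics ((4 : ℂ) • rep (U, 1) • p2) =
      (6144 + 4096 * s2) • ![(27 - s5) / 64, (17 - 3 * s5) / 64, (11 + 3 * s5) / 64,
        (9 + s5) / 64, (3 + 3 * s5) / 64] := by
    rw [quartics_eq, hv]
    ext i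
    fin_cases i <;> simp <;> grind
  rw [hq]
  obtain ⟨e1, e2, e3, e4, e5⟩ := coords_smul (6144 + 4096 * s2) ![(27 - s5) / 64,
    (17 - 3 * s5) / 64, (11 + 3 * s5) / 64, (9 + s5) / 64, (3 + 3 * s5) / 64]
  rw [e1, e2, e3, e4, e5]
  clear e1 e2 e3 e4 e5 hq hv he
  generalize 6144 + 4096 * s2 = c
  simp only [HasInvariants, cs, cx, cx', cy, cy', om, Matrix.cons_val_zero, Matrix.cons_val_one,
    Matrix.cons_val]
  generalize s5 = s, r3 = r at *
  refine ⟨⟨?_, ?_, ?_, ?_, ?_, ?_⟩, ?_⟩ <;> grind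

/-! ### Invariance of the pencil -/

/-- The product of the six linear forms defining the planes orthogonal to the axes of order five of
the icosahedral group. -/
def icosaSextic (a b c : ℂ) : ℂ :=
  ((3 + s5) / 2 * c ^ 2 - b ^ 2) * ((3 + s5) / 2 * a ^ 2 - c ^ 2) * ((3 + s5) / 2 * b ^ 2 - a ^ 2)

/-- The sum of the values of `icosaSextic` at the three columns of the matrix of the rotation
`y ↦ v * y * star v` of the imaginary quaternions. -/
def rotationSum (v : V) : ℂ :=
  icosaSextic (v 0 ^ 2 + v 1 ^ 2 - v 2 ^ 2 - v 3 ^ 2) (2 * (v 1 * v 2 + v 0 * v 3))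
      (2 * (v 1 * v 3 - v 0 * v 2))
    + icosaSextic (2 * (v 1 * v 2 - v 0 * v 3)) (v 0 ^ 2 - v 1 ^ 2 + v 2 ^ 2 - v 3 ^ 2)
      (2 * (v 2 * v 3 + v 0 * v 1))
    + icosaSextic (2 * (v 1 * v 3 + v 0 * v 2)) (2 * (v 2 * v 3 - v 0 * v 1))
      (v 0 ^ 2 - v 1 ^ 2 - v 2 ^ 2 + v 3 ^ 2)

/-- The multiple of `icosaSextic` occurring in the invariant, as a cubic in the squares. -/
theorem icosaSextic_expand (a b c : ℂ) : -((s5 - 2) / 2) * icosaSextic a b c =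
    -2 * a ^ 2 * b ^ 2 * c ^ 2
      + (1 + s5) / 4 * (b ^ 2 * c ^ 4 + a ^ 2 * b ^ 4 + c ^ 2 * a ^ 4)
      + (1 - s5) / 4 * (b ^ 4 * c ^ 2 + c ^ 4 * a ^ 2 + a ^ 4 * b ^ 2) := by
  have h5 := s5_sq
  unfold icosaSextic
  generalize s5 = r at *
  set u := (3 + r) / 2 with hu
  have e1 : -((r - 2) / 2) * u ^ 1 = (1 - r) / 4 := by
    rw [hu]
    linear_combination -h5 / 4
  have e2 : -((r - 2) / 2) * u ^ 2 = -((1 + r) / 4) := by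
    rw [hu]
    linear_combination (-r - 4) / 8 * h5
  have e3 : -((r - 2) / 2) * (u ^ 3 - 1) = -2 := by
    rw [hu]
    linear_combination -(r ^ 2 + 7 * r + 14) / 16 * h5
  linear_combination a ^ 2 * b ^ 2 * c ^ 2 * e3
    - (b ^ 2 * c ^ 4 + a ^ 2 * b ^ 4 + c ^ 2 * a ^ 4) * e2
    + (b ^ 4 * c ^ 2 + c ^ 4 * a ^ 2 + a ^ 4 * b ^ 2) * e1

/-- The squares of the entries of the rotation matrix are linear combinations of the quartics. -/
theorem eval_invForm (v : V) : eval v invForm = -((s5 - 2) / 2) * rotationSum v := by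
  have h : eval v invForm = cubic s5 0 (eval v f0) (eval v f1) (eval v f2) (eval v f3)
      (eval v f4) := by
    rw [invForm_eq, sqrt5_eq, ← C_0, eval_cubic]
  have h11 : (v 0 ^ 2 + v 1 ^ 2 - v 2 ^ 2 - v 3 ^ 2) ^ 2
      = eval v f0 + eval v f1 - eval v f2 - eval v f3 := by
    rw [eval_f0, eval_f1, eval_f2, eval_f3]
    ring
  have h22 : (v 0 ^ 2 - v 1 ^ 2 + v 2 ^ 2 - v 3 ^ 2) ^ 2
      = eval v f0 - eval v f1 + eval v f2 - eval v f3 := by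
    rw [eval_f0, eval_f1, eval_f2, eval_f3]
    ring
  have h33 : (v 0 ^ 2 - v 1 ^ 2 - v 2 ^ 2 + v 3 ^ 2) ^ 2
      = eval v f0 - eval v f1 - eval v f2 + eval v f3 := by
    rw [eval_f0, eval_f1, eval_f2, eval_f3]
    ring
  have h21 : (2 * (v 1 * v 2 + v 0 * v 3)) ^ 2 = 2 * eval v f3 + 2 * eval v f4 := by
    rw [eval_f3, eval_f4]
    ring
  have h12 : (2 * (v 1 * v 2 - v 0 * v 3)) ^ 2 = 2 * eval v f3 - 2 * eval v f4 := by
    rw [eval_f3, eval_f4]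
    ring
  have h13 : (2 * (v 1 * v 3 + v 0 * v 2)) ^ 2 = 2 * eval v f2 + 2 * eval v f4 := by
    rw [eval_f2, eval_f4]
    ring
  have h31 : (2 * (v 1 * v 3 - v 0 * v 2)) ^ 2 = 2 * eval v f2 - 2 * eval v f4 := by
    rw [eval_f2, eval_f4]
    ring
  have h32 : (2 * (v 2 * v 3 + v 0 * v 1)) ^ 2 = 2 * eval v f1 + 2 * eval v f4 := by
    rw [eval_f1, eval_f4]
    ring
  have h23 : (2 * (v 2 * v 3 - v 0 * v 1)) ^ 2 = 2 * eval v f1 - 2 * eval v f4 := by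
    rw [eval_f1, eval_f4]
    ring
  have hp : ∀ z : ℂ, z ^ 4 = (z ^ 2) ^ 2 := fun z => by rw [← pow_mul]
  rw [h, rotationSum, mul_add, mul_add, icosaSextic_expand, icosaSextic_expand, icosaSextic_expand]
  simp only [hp, h11, h22, h33, h21, h12, h13, h31, h32, h23]
  unfold cubic
  ring

/-- The six linear forms, with the golden ratio `t`. -/
theorem icosaSextic_eq_mul (a b c : ℂ) {t : ℂ} (ht : t = (1 + s5) / 2) : icosaSextic a b c =
    (t * c + b) * (t * c - b) * ((t * a + c) * (t * a - c)) * ((t * b + a) * (t * b - a)) := by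
  have h : (3 + s5) / 2 = t ^ 2 := by
    rw [ht]
    linear_combination -s5_sq / 4
  rw [icosaSextic, h]
  ring

/-- The rotation of order five permutes the six linear forms up to signs. -/
theorem icosaSextic_U (a b c : ℂ) :
    icosaSextic (((s5 - 1) * a - (1 + s5) * b + 2 * c) / 4)
      (((1 + s5) * a + 2 * b + (s5 - 1) * c) / 4) ((-2 * a + (s5 - 1) * b + (1 + s5) * c) / 4)
      = icosaSextic a b c := by
  have h5 := s5_sq
  rw [icosaSextic_eq_mul _ _ _ rfl, icosaSextic_eq_mul _ _ _ rfl]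
  generalize s5 = r at *
  set t := (1 + r) / 2 with ht
  set A := ((r - 1) * a - (1 + r) * b + 2 * c) / 4 with hA
  set B := ((1 + r) * a + 2 * b + (r - 1) * c) / 4 with hB
  set D := (-2 * a + (r - 1) * b + (1 + r) * c) / 4 with hD
  have e1 : t * D + B = t * c + b := by grind
  have e2 : t * D - B = -(t * a - c) := by grind
  have e3 : t * A + D = t * c - b := by grind
  have e4 : t * A - D = -(t * b - a) := by grind
  have e5 : t * B + A = t * a + c := by grind
  have e6 : t * B - A = t * b + a := by grind
  rw [e1, e2, e3, e4, e5, e6]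
  ring

theorem icosaSextic_congr {a b c a' b' c' : ℂ} (ha : a = a') (hb : b = b') (hc : c = c') :
    icosaSextic a b c = icosaSextic a' b' c' := by rw [ha, hb, hc]

theorem icosaSextic_congr_sq {a b c a' b' c' : ℂ} (ha : a ^ 2 = a' ^ 2) (hb : b ^ 2 = b' ^ 2)
    (hc : c ^ 2 = c' ^ 2) : icosaSextic a b c = icosaSextic a' b' c' := by
  unfold icosaSextic
  rw [ha, hb, hc]

theorem icosaSextic_rotate (a b c : ℂ) : icosaSextic b c a = icosaSextic a b c := by
  unfold icosaSextic
  ring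

theorem rotationSum_U_left (v : V) : rotationSum (rep (U, 1) • v) = rotationSum v := by
  have h5 := s5_sq
  unfold rotationSum
  rw [U_left]
  simp only [Matrix.cons_val_zero, Matrix.cons_val_one, Matrix.cons_val]
  generalize v 0 = x0, v 1 = x1, v 2 = x2, v 3 = x3
  refine congr_arg₂ _ (congr_arg₂ _ ?_ ?_) ?_
  all_goals
    refine (icosaSextic_congr ?_ ?_ ?_).trans (icosaSextic_U _ _ _)
    all_goals
      generalize s5 = r at *
      grind

theorem rotationSum_A1_left (v : V) : rotationSum (rep (A1, 1) • v) = rotationSum v := by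
  unfold rotationSum
  rw [A1_left]
  simp only [Matrix.cons_val_zero, Matrix.cons_val_one, Matrix.cons_val]
  refine congr_arg₂ _ (congr_arg₂ _ ?_ ?_) ?_ <;>
  exact icosaSextic_congr_sq (by ring) (by ring) (by ring)

theorem rotationSum_S_left (v : V) : rotationSum (rep (S, 1) • v) = rotationSum v := by
  unfold rotationSum
  rw [S_left]
  simp only [Matrix.cons_val_zero, Matrix.cons_val_one, Matrix.cons_val]
  refine congr_arg₂ _ (congr_arg₂ _ ?_ ?_) ?_ <;>
  exact (icosaSextic_congr_sq (by ring) (by ring) (by ring)).trans (icosaSextic_rotate _ _ _)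

theorem rotationSum_A1_right (v : V) : rotationSum (rep (1, A1) • v) = rotationSum v := by
  unfold rotationSum
  rw [A1_right]
  simp only [Matrix.cons_val_zero, Matrix.cons_val_one, Matrix.cons_val]
  refine congr_arg₂ _ (congr_arg₂ _ ?_ ?_) ?_ <;>
  exact icosaSextic_congr_sq (by ring) (by ring) (by ring)

theorem rotationSum_S_right (v : V) : rotationSum (rep (1, S) • v) = rotationSum v := by
  unfold rotationSum
  rw [S_right]
  simp only [Matrix.cons_val_zero, Matrix.cons_val_one, Matrix.cons_val]
  rw [← add_rotate]
  refine congr_arg₂ _ (congr_arg₂ _ ?_ ?_) ?_ <;>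
  exact icosaSextic_congr_sq (by ring) (by ring) (by ring)

theorem rotationSum_R4_right (v : V) : rotationSum (rep (1, R4) • v) = rotationSum v := by
  have h2 := s2_sq
  unfold rotationSum
  rw [R4_right]
  simp only [Matrix.cons_val_zero, Matrix.cons_val_one, Matrix.cons_val]
  generalize v 0 = x0, v 1 = x1, v 2 = x2, v 3 = x3, s2 = t at *
  rw [add_right_comm]
  refine congr_arg₂ _ (congr_arg₂ _ ?_ ?_) ?_ <;>
  exact icosaSextic_congr_sq (by grind) (by grind) (by grind)

theorem isInvariant_q_of_left (a : UnitQuaternions) : IsInvariant (rep (a, 1)) q := by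
  intro v
  have h := congrArg (fun x : ℝ => (x : ℂ)) (sq_sum_of_mem a)
  push_cast at h
  rw [eval_q, eval_q, rep_left]
  simp only [Matrix.cons_val_zero, Matrix.cons_val_one, Matrix.cons_val]
  linear_combination (v 0 ^ 2 + v 1 ^ 2 + v 2 ^ 2 + v 3 ^ 2) * h

theorem isInvariant_q_of_right (a : UnitQuaternions) : IsInvariant (rep (1, a)) q := by
  intro v
  have h := congrArg (fun x : ℝ => (x : ℂ)) (sq_sum_of_mem a)
  push_cast at h
  rw [eval_q, eval_q, rep_right]
  simp only [Matrix.cons_val_zero, Matrix.cons_val_one, Matrix.cons_val]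
  linear_combination (v 0 ^ 2 + v 1 ^ 2 + v 2 ^ 2 + v 3 ^ 2) * h

/-- The linear automorphisms leaving `F` invariant. -/
def invarianceGroup (F : Poly) : Subgroup GL4 where
  carrier := {g | IsInvariant g F}
  one_mem' v := by rw [one_smul]
  mul_mem' {g h} hg hh v := by rw [mul_smul, hg, hh]
  inv_mem' {g} hg v := by rw [← hg (g⁻¹ • v), smul_inv_smul]

theorem icosaOcta_le {G : Subgroup GL4} (hl : ∀ a ∈ ({A1, S, U} : Set UnitQuaternions),
    rep (a, 1) ∈ G) (hr : ∀ b ∈ ({A1, R4, S} : Set UnitQuaternions), rep (1, b) ∈ G) :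
    icosaOcta ≤ G := by
  have hl' : binaryIcosahedral ≤ G.comap (rep.comp (MonoidHom.inl _ _)) :=
    (Subgroup.closure_le _).mpr hl
  have hr' : binaryOctahedral ≤ G.comap (rep.comp (MonoidHom.inr _ _)) :=
    (Subgroup.closure_le _).mpr hr
  rw [icosaOcta, Subgroup.map_le_iff_le_comap]
  rintro ⟨a, b⟩ hab
  obtain ⟨ha, hb⟩ := Subgroup.mem_prod.mp hab
  have : rep (a, b) = rep (a, 1) * rep (1, b) := by rw [← map_mul]; simp
  change rep (a, b) ∈ G
  rw [this]
  exact mul_mem (hl' ha) (hr' hb)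

theorem isInvariant_q {g : GL4} (hg : g ∈ icosaOcta) : IsInvariant g q :=
  icosaOcta_le (G := invarianceGroup q) (fun a _ => isInvariant_q_of_left a)
    (fun b _ => isInvariant_q_of_right b) hg

theorem isInvariant_invForm {g : GL4} (hg : g ∈ icosaOcta) : IsInvariant g invForm := by
  refine icosaOcta_le (G := invarianceGroup invForm) ?_ ?_ hg
  · rintro a (rfl | rfl | rfl) v <;> rw [eval_invForm, eval_invForm]
    · rw [rotationSum_A1_left]
    · rw [rotationSum_S_left]
    · rw [rotationSum_U_left]
  · rintro a (rfl | rfl | rfl) v <;> rw [eval_invForm, eval_invForm]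
    · rw [rotationSum_A1_right]
    · rw [rotationSum_R4_right]
    · rw [rotationSum_S_right]

theorem isInvariant_pencil (lam : ℂ) {g : GL4} (hg : g ∈ icosaOcta) :
    IsInvariant g (pencil lam) := by
  intro v
  simp only [pencil, map_add, map_mul, map_pow, eval_C]
  rw [isInvariant_invForm hg v, isInvariant_q hg v]

theorem isHomogeneous_q : q.IsHomogeneous 2 := by
  have h : ∀ i : Fin 4, (X i ^ 2 : Poly).IsHomogeneous 2 := fun i => isHomogeneous_X_pow i 2
  exact (((h 0).add (h 1)).add (h 2)).add (h 3)

theorem isHomogeneous_q_pow : (q ^ 6).IsHomogeneous 12 := isHomogeneous_q.pow 6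

theorem isHomogeneous_pencil (lam : ℂ) : (pencil lam).IsHomogeneous 12 := by
  have hX : ∀ i : Fin 4, (X i : Poly).IsHomogeneous 1 := isHomogeneous_X ℂ
  have hC : ∀ (z : ℂ), (C z : Poly).IsHomogeneous 0 := isHomogeneous_C _
  have h2 : (2 : Poly).IsHomogeneous 0 := by simpa only [map_ofNat] using hC 2
  have h4 : (4 : Poly).IsHomogeneous 0 := by simpa only [map_ofNat] using hC 4
  have e0 : f0.IsHomogeneous 4 :=
    ((((hX 0).pow 4).add ((hX 1).pow 4)).add ((hX 2).pow 4)).add ((hX 3).pow 4)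
  have e1 : f1.IsHomogeneous 4 :=
    h2.mul ((((hX 0).pow 2).mul ((hX 1).pow 2)).add (((hX 2).pow 2).mul ((hX 3).pow 2)))
  have e2 : f2.IsHomogeneous 4 :=
    h2.mul ((((hX 0).pow 2).mul ((hX 2).pow 2)).add (((hX 1).pow 2).mul ((hX 3).pow 2)))
  have e3 : f3.IsHomogeneous 4 :=
    h2.mul ((((hX 0).pow 2).mul ((hX 3).pow 2)).add (((hX 1).pow 2).mul ((hX 2).pow 2)))
  have e4 : f4.IsHomogeneous 4 := h4.mul ((((hX 0).mul (hX 1)).mul (hX 2)).mul (hX 3))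
  have hn : ∀ n : ℕ, [n.AtLeastTwo] → (OfNat.ofNat n : Poly).IsHomogeneous 0 := by
    intro n _
    simpa only [map_ofNat] using hC (OfNat.ofNat n)
  have h5 : sqrt5.IsHomogeneous 0 := hC _
  have hm := ((e0.sub e1).sub e2).sub e3
  rw [pencil_eq]
  unfold cubic
  refine IsHomogeneous.add (IsHomogeneous.add (IsHomogeneous.add (IsHomogeneous.sub
    (IsHomogeneous.sub (IsHomogeneous.add (IsHomogeneous.add (IsHomogeneous.add ?_ ?_) ?_) ?_)
    ?_) ?_) ?_) ?_) ?_
  · exact (((e1.pow 3).add (e2.pow 3)).add (e3.pow 3)).neg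
  · exact (hn 11).mul ((((e1.pow 2).mul (e2.add e3)).add ((e2.pow 2).mul (e1.add e3))).add
      ((e3.pow 2).mul (e1.add e2)))
  · exact ((e0.pow 2).sub ((hn 14).mul (e4.pow 2))).mul ((e1.add e2).add e3)
  · exact ((hn 30).mul e0).mul (e4.pow 2)
  · exact ((hn 8).mul e0).mul (((e1.mul e2).add (e1.mul e3)).add (e2.mul e3))
  · exact (((hn 30).mul e1).mul e2).mul e3
  · exact ((((hn 3).mul h5).mul e4)).mul (((hn 4).mul (e4.pow 2)).sub (hm.pow 2))
  · exact ((hn 6).mul h5).mul ((((((((e1.pow 2).mul e2).add ((e3.pow 2).mul e1)).add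
      ((e2.pow 2).mul e3)).sub (e1.mul (e2.pow 2))).sub (e3.mul (e1.pow 2))).sub
      (e2.mul (e3.pow 2))))
  · exact (hC lam).mul ((((e0.add e1).add e2).add e3).pow 3)

/-! ### The singular points on the quadric -/

/-- The parametrisation of the quadric `q = 0` by pairs of vectors `(u₁, u₂)`, `(w₁, w₂)`; for fixed
`w` or fixed `u` it is linear and parametrises a line of the quadric. -/
def spin (u1 u2 w1 w2 : ℂ) : V :=
  ![u1 * w1 + u2 * w2, Complex.I * (u2 * w2 - u1 * w1), u1 * w2 - u2 * w1,
    -Complex.I * (u1 * w2 + u2 * w1)]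

theorem spin_add_smul (u1 u2 e1 e2 w1 w2 t : ℂ) :
    spin u1 u2 w1 w2 + t • spin e1 e2 w1 w2 = spin (u1 + t * e1) (u2 + t * e2) w1 w2 := by
  ext i
  fin_cases i <;> simp [spin] <;> ring

theorem eval_q_spin (u1 u2 w1 w2 : ℂ) : eval (spin u1 u2 w1 w2) q = 0 := by
  have hI := Complex.I_sq
  rw [eval_q, spin]
  simp only [Matrix.cons_val_zero, Matrix.cons_val_one, Matrix.cons_val]
  generalize Complex.I = ι at *
  grind

theorem exists_spin {v : V} (h : eval v q = 0) : ∃ u1 u2 w1 w2, v = spin u1 u2 w1 w2 := by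
  have hI := Complex.I_sq
  rw [eval_q] at h
  set ι := Complex.I with hι
  have hdet : (v 0 + ι * v 1) * (v 0 - ι * v 1) = -(v 2 + ι * v 3) * (v 2 - ι * v 3) := by
    linear_combination h - (v 1 ^ 2 + v 3 ^ 2) * hI
  have key : ∀ u1 u2 w1 w2 : ℂ, v 0 + ι * v 1 = 2 * (u1 * w1) → v 0 - ι * v 1 = 2 * (u2 * w2) →
      v 2 + ι * v 3 = 2 * (u1 * w2) → v 2 - ι * v 3 = -2 * (u2 * w1) → v = spin u1 u2 w1 w2 := by
    intro u1 u2 w1 w2 h1 h2 h3 h4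
    ext i
    fin_cases i <;> simp [spin, ← hι]
    · linear_combination (h1 + h2) / 2
    · linear_combination (-ι / 2) * (h1 - h2) + v 1 * hI
    · linear_combination (h3 + h4) / 2
    · linear_combination (-ι / 2) * (h3 - h4) + v 3 * hI
  by_cases ha : v 0 + ι * v 1 = 0
  · by_cases hb : v 2 + ι * v 3 = 0
    · exact ⟨0, 1, -(v 2 - ι * v 3) / 2, (v 0 - ι * v 1) / 2,
        key _ _ _ _ (by rw [ha]; ring) (by ring) (by rw [hb]; ring) (by ring)⟩
    · have h4 : v 2 - ι * v 3 = 0 := by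
        rw [ha, zero_mul] at hdet
        exact (mul_eq_zero.mp hdet.symm).resolve_left (neg_ne_zero.mpr hb)
      refine ⟨1, (v 0 - ι * v 1) / (v 2 + ι * v 3), 0, (v 2 + ι * v 3) / 2,
        key _ _ _ _ (by rw [ha]; ring) (by field_simp) (by ring) (by rw [h4]; ring)⟩
  · refine ⟨1, -(v 2 - ι * v 3) / (v 0 + ι * v 1), (v 0 + ι * v 1) / 2, (v 2 + ι * v 3) / 2,
      key _ _ _ _ (by ring) ?_ (by ring) (by field_simp)⟩
    field_simp
    linear_combination hdet

/-- On the quadric the pencil is the product of a form of degree twelve in `u` and the square of a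
sextic in `w`. -/
theorem eval_pencil_spin (lam u1 u2 w1 w2 : ℂ) : eval (spin u1 u2 w1 w2) (pencil lam)
    = 384 * (s5 * ((u1 ^ 4 + u2 ^ 4) ^ 3 - 36 * (u1 ^ 2 * u2 ^ 2) ^ 2 * (u1 ^ 4 + u2 ^ 4))
      - 22 * ((u1 ^ 2 * u2 ^ 2) * ((u1 ^ 4 + u2 ^ 4) ^ 2 - 4 * (u1 ^ 2 * u2 ^ 2) ^ 2)))
      * (w1 * w2 * (w1 ^ 4 - w2 ^ 4)) ^ 2 := by
  have h4 : eval (spin u1 u2 w1 w2) f4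
      = 4 * ((u2 ^ 2 * w2 ^ 2 - u1 ^ 2 * w1 ^ 2) * (u1 ^ 2 * w2 ^ 2 - u2 ^ 2 * w1 ^ 2)) := by
    rw [eval_f4, spin]
    simp only [Matrix.cons_val_zero, Matrix.cons_val_one, Matrix.cons_val]
    linear_combination -4 * ((u2 ^ 2 * w2 ^ 2 - u1 ^ 2 * w1 ^ 2)
      * (u1 ^ 2 * w2 ^ 2 - u2 ^ 2 * w1 ^ 2)) * Complex.I_sq
  have h1 : eval (spin u1 u2 w1 w2) f1
      = -2 * ((u1 ^ 2 * w1 ^ 2 - u2 ^ 2 * w2 ^ 2) ^ 2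
        + (u1 ^ 2 * w2 ^ 2 - u2 ^ 2 * w1 ^ 2) ^ 2) := by
    have hI := Complex.I_sq
    rw [eval_f1, spin]
    simp only [Matrix.cons_val_zero, Matrix.cons_val_one, Matrix.cons_val]
    generalize Complex.I = ι at *
    grind
  have h2 : eval (spin u1 u2 w1 w2) f2
      = 4 * (((u1 ^ 2 - u2 ^ 2) * (w1 * w2)) ^ 2 + (u1 * u2 * (w1 ^ 2 - w2 ^ 2)) ^ 2) := by
    have hI : Complex.I ^ 4 = 1 := Complex.I_pow_four
    rw [eval_f2, spin]
    simp only [Matrix.cons_val_zero, Matrix.cons_val_one, Matrix.cons_val]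
    generalize Complex.I = ι at *
    grind
  have h3 : eval (spin u1 u2 w1 w2) f3
      = -4 * (((u1 ^ 2 + u2 ^ 2) * (w1 * w2)) ^ 2 + (u1 * u2 * (w1 ^ 2 + w2 ^ 2)) ^ 2) := by
    have hI := Complex.I_sq
    rw [eval_f3, spin]
    simp only [Matrix.cons_val_zero, Matrix.cons_val_one, Matrix.cons_val]
    generalize Complex.I = ι at *
    grind
  have h0 : eval (spin u1 u2 w1 w2) f0 = -(eval (spin u1 u2 w1 w2) f1)
      - eval (spin u1 u2 w1 w2) f2 - eval (spin u1 u2 w1 w2) f3 := by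
    have := congrArg (eval (spin u1 u2 w1 w2)) q_sq
    simp only [map_pow, map_add, eval_q_spin] at this
    linear_combination -this
  rw [eval_pencil, h0, h1, h2, h3, h4]
  unfold cubic
  ring

/-- The surfaces of the pencil are singular along six lines, given here as three pairs indexed by
the two square roots `ε` of `-1`. -/
theorem dir_pencil_eq_zero {ε : ℂ} (hε : ε ^ 2 = -1) (lam s t : ℂ) (v : V)
    (hv : v = ![s, ε * s, t, -ε * t] ∨ v = ![s, t, ε * s, ε * t] ∨ v = ![s, ε * t, t, ε * s])
    (i : Fin 4) : eval v (pderiv i (pencil lam)) = 0 := by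
  have h5 := s5_sq
  rw [eval_pderiv_pencil, Matrix.mulVec, dotProduct, Fin.sum_univ_five, cubicGrad, eval_f0, eval_f1,
    eval_f2, eval_f3, eval_f4]
  generalize s5 = r at *
  rcases hv with rfl | rfl | rfl
  · have e0 : s ^ 4 + (ε * s) ^ 4 + (t) ^ 4 + (-ε * t) ^ 4 = 2 * (s ^ 4 + t ^ 4) := by grind
    have e1 : 2 * ((s) ^ 2 * (ε * s) ^ 2 + (t) ^ 2 * (-ε * t) ^ 2) = -(2 * (s ^ 4 + t ^ 4)) := by
      grind
    have e2 : 2 * ((s) ^ 2 * (t) ^ 2 + (ε * s) ^ 2 * (-ε * t) ^ 2) = 4 * (s ^ 2 * t ^ 2) := by grind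
    have e3 : 2 * ((s) ^ 2 * (-ε * t) ^ 2 + (ε * s) ^ 2 * (t) ^ 2) = -(4 * (s ^ 2 * t ^ 2)) := by
      grind
    have e4 : 4 * (s * (ε * s) * (t) * (-ε * t)) = 4 * (s ^ 2 * t ^ 2) := by grind
    simp only [Matrix.cons_val_zero, Matrix.cons_val_one, Matrix.cons_val, e0, e1, e2, e3, e4]
    clear e0 e1 e2 e3 e4
    fin_cases i <;> simp [jac, cubic0, cubic1, cubic4] <;> grind
  · have e0 : s ^ 4 + (t) ^ 4 + (ε * s) ^ 4 + (ε * t) ^ 4 = 2 * (s ^ 4 + t ^ 4) := by grind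
    have e1 : 2 * ((s) ^ 2 * (t) ^ 2 + (ε * s) ^ 2 * (ε * t) ^ 2) = 4 * (s ^ 2 * t ^ 2) := by grind
    have e2 : 2 * ((s) ^ 2 * (ε * s) ^ 2 + (t) ^ 2 * (ε * t) ^ 2) = -(2 * (s ^ 4 + t ^ 4)) := by
      grind
    have e3 : 2 * ((s) ^ 2 * (ε * t) ^ 2 + (t) ^ 2 * (ε * s) ^ 2) = -(4 * (s ^ 2 * t ^ 2)) := by
      grind
    have e4 : 4 * (s * (t) * (ε * s) * (ε * t)) = -(4 * (s ^ 2 * t ^ 2)) := by grind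
    simp only [Matrix.cons_val_zero, Matrix.cons_val_one, Matrix.cons_val, e0, e1, e2, e3, e4]
    clear e0 e1 e2 e3 e4
    fin_cases i <;> simp [jac, cubic0, cubic1, cubic4] <;> grind
  · have e0 : s ^ 4 + (ε * t) ^ 4 + (t) ^ 4 + (ε * s) ^ 4 = 2 * (s ^ 4 + t ^ 4) := by grind
    have e1 : 2 * ((s) ^ 2 * (ε * t) ^ 2 + (t) ^ 2 * (ε * s) ^ 2) = -(4 * (s ^ 2 * t ^ 2)) := by
      grind
    have e2 : 2 * ((s) ^ 2 * (t) ^ 2 + (ε * t) ^ 2 * (ε * s) ^ 2) = 4 * (s ^ 2 * t ^ 2) := by grind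
    have e3 : 2 * ((s) ^ 2 * (ε * s) ^ 2 + (ε * t) ^ 2 * (t) ^ 2) = -(2 * (s ^ 4 + t ^ 4)) := by
      grind
    have e4 : 4 * (s * (ε * t) * (t) * (ε * s)) = -(4 * (s ^ 2 * t ^ 2)) := by grind
    simp only [Matrix.cons_val_zero, Matrix.cons_val_one, Matrix.cons_val, e0, e1, e2, e3, e4]
    clear e0 e1 e2 e3 e4
    fin_cases i <;> simp [jac, cubic0, cubic1, cubic4] <;> grind

/-- Over the six zeros of the sextic in `w`, the lines of the quadric are singular lines. -/
theorem singAt_spin (lam u1 u2 w1 w2 : ℂ) (hw : w1 * w2 * (w1 ^ 4 - w2 ^ 4) = 0) :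
    SingAt (pencil lam) (spin u1 u2 w1 w2) := by
  refine singAt_iff.mpr ⟨by rw [eval_pencil_spin, hw]; ring, ?_⟩
  have hI := Complex.I_sq
  have hI' : (-Complex.I) ^ 2 = -1 := by rw [neg_sq, hI]
  have : w1 * (w2 * ((w1 - w2) * ((w1 + w2) * ((w1 - Complex.I * w2) * (w1 + Complex.I * w2)))))
      = 0 := by
    linear_combination hw - w1 * w2 * (w1 ^ 2 - w2 ^ 2) * w2 ^ 2 * hI
  rcases mul_eq_zero.mp this with h | h
  · refine dir_pencil_eq_zero hI lam (u2 * w2) (u1 * w2) _ (Or.inl ?_)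
    rw [spin, h]
    ext i
    fin_cases i <;> simp
  rcases mul_eq_zero.mp h with h | h
  · refine dir_pencil_eq_zero hI' lam (u1 * w1) (-(u2 * w1)) _ (Or.inl ?_)
    rw [spin, h]
    ext i
    fin_cases i <;> simp
  rcases mul_eq_zero.mp h with h | h
  · refine dir_pencil_eq_zero hI' lam ((u1 + u2) * w2) ((u1 - u2) * w2) _ (Or.inr (Or.inr ?_))
    rw [spin, sub_eq_zero.mp h]
    ext i
    fin_cases i <;> simp <;> ring
  rcases mul_eq_zero.mp h with h | h
  · refine dir_pencil_eq_zero hI lam ((u2 - u1) * w2) ((u1 + u2) * w2) _ (Or.inr (Or.inr ?_))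
    rw [spin, eq_neg_of_add_eq_zero_left h]
    ext i
    fin_cases i <;> simp <;> ring
  rcases mul_eq_zero.mp h with h | h
  · refine dir_pencil_eq_zero hI' lam ((Complex.I * u1 + u2) * w2) ((u1 + Complex.I * u2) * w2) _
      (Or.inr (Or.inl ?_))
    rw [spin, sub_eq_zero.mp h]
    ext i
    fin_cases i <;> simp
    · ring
    · linear_combination -u1 * w2 * hI
    · linear_combination u1 * w2 * hI
    · ring
  · refine dir_pencil_eq_zero hI lam ((u2 - Complex.I * u1) * w2) ((Complex.I * u2 - u1) * w2) _
      (Or.inr (Or.inl ?_))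
    rw [spin, eq_neg_of_add_eq_zero_left h]
    ext i
    fin_cases i <;> simp
    · ring
    · linear_combination u1 * w2 * hI
    · linear_combination u1 * w2 * hI
    · ring

/-- The form of degree twelve in `u` has no multiple zeros. -/
theorem eq_zero_of_partials_eq_zero {u1 u2 : ℂ} (h1 : u1 * ((s5 * (3 * (u1 ^ 4 + u2 ^ 4) ^ 2
      - 36 * (u1 ^ 2 * u2 ^ 2) ^ 2) - 44 * (u1 ^ 2 * u2 ^ 2) * (u1 ^ 4 + u2 ^ 4)) * (2 * u1 ^ 2)
      + (-(72 * s5) * (u1 ^ 2 * u2 ^ 2) * (u1 ^ 4 + u2 ^ 4) - 22 * ((u1 ^ 4 + u2 ^ 4) ^ 2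
        - 12 * (u1 ^ 2 * u2 ^ 2) ^ 2)) * u2 ^ 2) = 0)
    (h2 : u2 * ((s5 * (3 * (u1 ^ 4 + u2 ^ 4) ^ 2
      - 36 * (u1 ^ 2 * u2 ^ 2) ^ 2) - 44 * (u1 ^ 2 * u2 ^ 2) * (u1 ^ 4 + u2 ^ 4)) * (2 * u2 ^ 2)
      + (-(72 * s5) * (u1 ^ 2 * u2 ^ 2) * (u1 ^ 4 + u2 ^ 4) - 22 * ((u1 ^ 4 + u2 ^ 4) ^ 2
        - 12 * (u1 ^ 2 * u2 ^ 2) ^ 2)) * u1 ^ 2) = 0) : u1 = 0 ∧ u2 = 0 := by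
  have h5 := s5_sq
  have hs0 : s5 ≠ 0 := by
    intro h
    rw [h] at h5
    norm_num at h5
  by_cases hu1 : u1 = 0
  · refine ⟨hu1, ?_⟩
    rw [hu1] at h2
    have : s5 * u2 ^ 11 = 0 := by linear_combination h2 / 6
    exact pow_eq_zero_iff (by norm_num) |>.mp ((mul_eq_zero.mp this).resolve_left hs0)
  by_cases hu2 : u2 = 0
  · refine ⟨?_, hu2⟩
    rw [hu2] at h1
    have : s5 * u1 ^ 11 = 0 := by linear_combination h1 / 6
    exact pow_eq_zero_iff (by norm_num) |>.mp ((mul_eq_zero.mp this).resolve_left hs0)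
  exfalso
  replace h1 := (mul_eq_zero.mp h1).resolve_left hu1
  replace h2 := (mul_eq_zero.mp h2).resolve_left hu2
  set A := u1 ^ 2 with hA
  set B := u2 ^ 2 with hB
  have hA0 : A ≠ 0 := pow_ne_zero 2 hu1
  have hB0 : B ≠ 0 := pow_ne_zero 2 hu2
  have e1 : u1 ^ 4 = A ^ 2 := by rw [hA]; ring
  have e2 : u2 ^ 4 = B ^ 2 := by rw [hB]; ring
  rw [e1, e2] at h1 h2
  clear_value A B
  set G := s5 * (3 * (A ^ 2 + B ^ 2) ^ 2 - 36 * (A * B) ^ 2) - 44 * (A * B) * (A ^ 2 + B ^ 2)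
    with hG
  set K := -(72 * s5) * (A * B) * (A ^ 2 + B ^ 2) - 22 * ((A ^ 2 + B ^ 2) ^ 2 - 12 * (A * B) ^ 2)
    with hK
  by_cases hAB : A ^ 2 = B ^ 2
  · rcases sq_eq_sq_iff_eq_or_eq_neg.mp hAB with h | h
    · have : s5 * A ^ 5 = 0 := by
        subst h
        linear_combination -h1 / 192
      exact pow_ne_zero 5 hA0 ((mul_eq_zero.mp this).resolve_left hs0)
    · have : s5 * B ^ 5 = 0 := by
        subst h
        linear_combination h1 / 192
      exact pow_ne_zero 5 hB0 ((mul_eq_zero.mp this).resolve_left hs0)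
  · have hG0 : G = 0 := by
      have : G * (2 * (A ^ 2 - B ^ 2)) = 0 := by linear_combination A * h1 - B * h2
      exact (mul_eq_zero.mp this).resolve_right (mul_ne_zero two_ne_zero (sub_ne_zero.mpr hAB))
    have hK0 : K = 0 := by
      have : K * (A ^ 2 - B ^ 2) = 0 := by linear_combination A * h2 - B * h1
      exact (mul_eq_zero.mp this).resolve_right (sub_ne_zero.mpr hAB)
    have h3 : (A * B) * (A ^ 2 + B ^ 2) = 0 := by
      rw [hG] at hG0
      rw [hK] at hK0
      linear_combination (-22 / 2048) * hG0 - 3 * s5 / 2048 * hK0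
        - 27 / 256 * (A * B) * (A ^ 2 + B ^ 2) * h5
    have h4 : (A ^ 2 + B ^ 2) = 0 := (mul_eq_zero.mp h3).resolve_left (mul_ne_zero hA0 hB0)
    have h6 : (A * B) ^ 2 = 0 := by
      rw [hK, h4] at hK0
      linear_combination hK0 / 264
    exact mul_ne_zero hA0 hB0 (pow_eq_zero_iff (by norm_num) |>.mp h6)

theorem exists_spin_not_smul {u1 u2 w1 w2 : ℂ} (h : spin u1 u2 w1 w2 ≠ 0) :
    ∃ e1 e2, ¬∃ c : ℂ, spin e1 e2 w1 w2 = c • spin u1 u2 w1 w2 := by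
  have key : ∀ e1 e2 c : ℂ, spin e1 e2 w1 w2 = c • spin u1 u2 w1 w2 →
      (e1 - c * u1) * w1 = 0 ∧ (e1 - c * u1) * w2 = 0 ∧ (e2 - c * u2) * w1 = 0 ∧
        (e2 - c * u2) * w2 = 0 := by
    intro e1 e2 c hc
    have h0 := congrFun hc 0
    have h1 := congrFun hc 1
    have h2 := congrFun hc 2
    have h3 := congrFun hc 3
    have hI := Complex.I_sq
    simp [spin] at h0 h1 h2 h3
    generalize Complex.I = ι at *
    refine ⟨?_, ?_, ?_, ?_⟩ <;> grind
  have hw : ¬ (w1 = 0 ∧ w2 = 0) := by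
    rintro ⟨rfl, rfl⟩
    apply h
    ext i
    fin_cases i <;> simp [spin]
  by_cases hu : u1 = 0
  · refine ⟨1, 0, ?_⟩
    rintro ⟨c, hc⟩
    obtain ⟨h1, h2, -, -⟩ := key _ _ _ hc
    exact hw ⟨by simpa [hu] using h1, by simpa [hu] using h2⟩
  · refine ⟨0, 1, ?_⟩
    rintro ⟨c, hc⟩
    obtain ⟨h1, h2, h3, h4⟩ := key _ _ _ hc
    by_cases hc0 : c = 0
    · exact hw ⟨by simpa [hc0] using h3, by simpa [hc0] using h4⟩
    · exact hw ⟨by simpa [hc0, hu] using h1, by simpa [hc0, hu] using h2⟩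

/-- A singular point on the quadric lies on one of the six lines along which all surfaces of the
pencil are singular. -/
theorem sextic_eq_zero_of_singAt {lam u1 u2 w1 w2 : ℂ} (hv : spin u1 u2 w1 w2 ≠ 0)
    (h : SingAt (pencil lam) (spin u1 u2 w1 w2)) : w1 * w2 * (w1 ^ 4 - w2 ^ 4) = 0 := by
  by_contra ho
  -- the derivative in the directions `spin e1 e2 w1 w2`, which are tangent to the quadric
  have key : ∀ e1 e2 : ℂ, (s5 * (3 * (u1 ^ 4 + u2 ^ 4) ^ 2
      - 36 * (u1 ^ 2 * u2 ^ 2) ^ 2) - 44 * (u1 ^ 2 * u2 ^ 2) * (u1 ^ 4 + u2 ^ 4))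
        * (4 * u1 ^ 3 * e1 + 4 * u2 ^ 3 * e2)
      + (-(72 * s5) * (u1 ^ 2 * u2 ^ 2) * (u1 ^ 4 + u2 ^ 4) - 22 * ((u1 ^ 4 + u2 ^ 4) ^ 2
        - 12 * (u1 ^ 2 * u2 ^ 2) ^ 2)) * (2 * u1 * e1 * u2 ^ 2 + u1 ^ 2 * (2 * u2 * e2)) = 0 := by
    intro e1 e2
    have h1 := hasDerivAt_eval_line_zero (pencil lam) (spin u1 u2 w1 w2) (spin e1 e2 w1 w2)
    rw [h.2] at h1
    simp only [spin_add_smul, eval_pencil_spin] at h1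
    have ha : HasDerivAt (fun t : ℂ => u1 + t * e1) e1 0 := by
      simpa using ((hasDerivAt_id (0 : ℂ)).mul_const e1).const_add u1
    have hb : HasDerivAt (fun t : ℂ => u2 + t * e2) e2 0 := by
      simpa using ((hasDerivAt_id (0 : ℂ)).mul_const e2).const_add u2
    have hα := (ha.fun_pow 2).fun_mul (hb.fun_pow 2)
    have hβ := (ha.fun_pow 4).fun_add (hb.fun_pow 4)
    have h2 := (((((hβ.fun_pow 3).fun_sub
      (((hα.fun_pow 2).const_mul 36).fun_mul hβ)).const_mul s5).fun_sub
      ((hα.fun_mul ((hβ.fun_pow 2).fun_sub ((hα.fun_pow 2).const_mul 4))).const_mul 22)).const_mul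
      384).mul_const ((w1 * w2 * (w1 ^ 4 - w2 ^ 4)) ^ 2)
    have h3 := h2.unique h1
    refine (mul_eq_zero.mp (h3.symm.trans ?_ |>.symm)).resolve_right
      (mul_ne_zero (pow_ne_zero 2 ho) (by norm_num : (384 : ℂ) ≠ 0))
    push_cast
    ring
  have hu := eq_zero_of_partials_eq_zero (u1 := u1) (u2 := u2)
    (by linear_combination key 1 0 / 2) (by linear_combination key 0 1 / 2)
  apply hv
  rw [hu.1, hu.2]
  ext i
  fin_cases i <;> simp [spin]

/-- No singular point on the quadric is isolated. -/
theorem exists_line_of_singAt_pencil {lam : ℂ} {v : V} (hv : v ≠ 0) (hq : eval v q = 0)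
    (h : SingAt (pencil lam) v) :
    ∃ w : V, (¬∃ c : ℂ, w = c • v) ∧ ∀ t : ℂ, SingAt (pencil lam) (v + t • w) := by
  obtain ⟨u1, u2, w1, w2, rfl⟩ := exists_spin hq
  obtain ⟨e1, e2, he⟩ := exists_spin_not_smul hv
  refine ⟨_, he, fun t => ?_⟩
  rw [spin_add_smul]
  exact singAt_spin _ _ _ _ _ (sextic_eq_zero_of_singAt hv h)

theorem singAt_q_pow_iff {v : V} : SingAt (q ^ 6) v ↔ eval v q = 0 := by
  refine ⟨fun h => ?_, fun h => singAt_iff.mpr ⟨by rw [map_pow, h]; norm_num, fun i => ?_⟩⟩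
  · have := h.1
    rw [map_pow] at this
    exact pow_eq_zero_iff (by norm_num) |>.mp this
  · rw [Derivation.leibniz_pow]
    simp [h]

theorem exists_line_of_singAt_q_pow {v : V} (hv : v ≠ 0) (h : SingAt (q ^ 6) v) :
    ∃ w : V, (¬∃ c : ℂ, w = c • v) ∧ ∀ t : ℂ, SingAt (q ^ 6) (v + t • w) := by
  obtain ⟨u1, u2, w1, w2, rfl⟩ := exists_spin (singAt_q_pow_iff.mp h)
  obtain ⟨e1, e2, he⟩ := exists_spin_not_smul hv
  refine ⟨_, he, fun t => ?_⟩
  rw [spin_add_smul]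
  exact singAt_q_pow_iff.mpr (eval_q_spin _ _ _ _)

/-! ### Classification of the singular points off the quadric -/

/-- `v` lies in the `IO`-orbit of one of the four representatives. -/
def IsNodal (v : V) : Prop :=
  SameOrbit v p0 ∨ SameOrbit v p2 ∨ SameOrbit v (pe s2) ∨ SameOrbit v (pe (-s2))

theorem IsNodal.of_sameOrbit {v w : V} (h : SameOrbit v w) (hw : IsNodal w) : IsNodal v := by
  rcases hw with hw | hw | hw | hw
  · exact Or.inl (h.trans hw)
  · exact Or.inr (Or.inl (h.trans hw))
  · exact Or.inr (Or.inr (Or.inl (h.trans hw)))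
  · exact Or.inr (Or.inr (Or.inr (h.trans hw)))

theorem SingAt.of_sameOrbit {lam : ℂ} {v w : V} (h : SingAt (pencil lam) v)
    (hvw : SameOrbit v w) : SingAt (pencil lam) w := by
  obtain ⟨g, hg, c, -, rfl⟩ := hvw.symm
  exact (h.smul_of_isInvariant (isInvariant_pencil lam hg)).smul (isHomogeneous_pencil lam) c

theorem NodeAt.of_sameOrbit {lam : ℂ} {v w : V} (h : NodeAt (pencil lam) v)
    (hvw : SameOrbit v w) : NodeAt (pencil lam) w := by
  obtain ⟨g, hg, c, hc, rfl⟩ := hvw.symm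
  exact (h.smul_of_isInvariant (isInvariant_pencil lam hg)).smul (isHomogeneous_pencil lam) hc

theorem isNodal_pe {e : ℂ} (he : e ^ 2 = 2) : IsNodal (pe e) := by
  rw [← s2_sq] at he
  rcases sq_eq_sq_iff_eq_or_eq_neg.mp he with rfl | rfl
  · exact Or.inr (Or.inr (Or.inl (SameOrbit.refl _)))
  · exact Or.inr (Or.inr (Or.inr (SameOrbit.refl _)))

theorem HasInvariants.swap {x x' y y' u A A' w B B' : ℂ}
    (h : HasInvariants x x' y y' u A A' w B B') : HasInvariants y y' x x' w B B' u A A' :=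
  ⟨h.2.2.2.1, h.2.2.2.2.1, h.2.2.2.2.2, h.1, h.2.1, h.2.2.1⟩

theorem sameOrbit_smul_rep_U (w : V) : SameOrbit ((4 : ℂ) • rep (U, 1) • w) w :=
  (sameOrbit_smul_left (by norm_num) _).trans (sameOrbit_smul (rep_left_mem U_mem) _)

/-- `R₄`, acting from the right, exchanges the two pairs of invariants. -/
theorem hasInvariants_R4_right {v : V} {u A A' w B B' : ℂ}
    (h : HasInvariants (cx (quartics v)) (cx' (quartics v)) (cy (quartics v)) (cy' (quartics v))
      u A A' w B B') :
    HasInvariants (cx (quartics (rep (1, R4) • v))) (cx' (quartics (rep (1, R4) • v)))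
      (cy (quartics (rep (1, R4) • v))) (cy' (quartics (rep (1, R4) • v))) w B B' u A A' := by
  obtain ⟨-, e1, e2, e3, e4⟩ := coords_R4_right v
  rw [e1, e2, e3, e4]
  exact h.swap

/-- For each of the four classes of invariants of critical points, a vector with proportional
invariants is exhibited: a representative, in three cases transformed by `U`. -/
theorem isNodal_of_critClass {v : V} (hv : cs (quartics v) = 1)
    (h : CritClass (s5 * r3) s5 (cx (quartics v)) (cx' (quartics v)) (cy (quartics v))
      (cy' (quartics v))) : IsNodal v := by
  have h5 := s5_sq
  rcases h with h | ⟨t, ht, h⟩ | ⟨t, ht, h⟩ | h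
  · refine IsNodal.of_sameOrbit (sameOrbit_smul (rep_right_mem R4_mem) v).symm
      (Or.inl (SameOrbit.trans ?_ (sameOrbit_smul_rep_U p0)))
    obtain ⟨k, ks⟩ := hasInvariants_U_p0
    refine sameOrbit_of_hasInvariants ?_ (hasInvariants_R4_right h) (by norm_num) ks k.swap
    rw [(coords_R4_right v).1, hv]
  · have he : (-(t * s5 / 5)) ^ 2 = 2 := by
      linear_combination s5 ^ 2 / 25 * ht + 10 / 25 * h5
    obtain ⟨k, ks⟩ := hasInvariants_pe he (t := t) (by linear_combination -t / 5 * h5)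
    refine IsNodal.of_sameOrbit (sameOrbit_of_hasInvariants hv h ?_ ks k) (isNodal_pe he)
    intro h0
    have h1 : t = 13 / 4 := by linear_combination -h0 / 128
    rw [h1] at ht
    norm_num at ht
  · have he : (t * s5 / 5) ^ 2 = 2 := by
      linear_combination s5 ^ 2 / 25 * ht + 10 / 25 * h5
    obtain ⟨k, ks⟩ := hasInvariants_U_pe he (t := t) (by linear_combination -t / 5 * h5)
    refine IsNodal.of_sameOrbit ((sameOrbit_of_hasInvariants hv h ?_ ks k).trans
      (sameOrbit_smul_rep_U _)) (isNodal_pe he)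
    intro h0
    have h1 : t = -13 / 4 := by linear_combination h0 / 32768
    rw [h1] at ht
    norm_num at ht
  · obtain ⟨k, ks⟩ := hasInvariants_U_p2
    refine Or.inr (Or.inl ((sameOrbit_of_hasInvariants hv h ?_ ks k).trans
      (sameOrbit_smul_rep_U _)))
    intro h0
    have h1 : s2 = -3 / 2 := by linear_combination h0 / 4096
    have := s2_sq
    rw [h1] at this
    norm_num at this

theorem sameOrbit_p0_of_snd_eq_zero {c : ℂ} (hc : c ≠ 0) : SameOrbit ![c, 0, 0, 0] p0 := by
  have : ![c, 0, 0, 0] = c • p0 := by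
    ext i
    fin_cases i <;> simp [p0]
  rw [this]
  exact sameOrbit_smul_left hc _

theorem sameOrbit_p0_of_fst_eq_zero {d : ℂ} (hd : d ≠ 0) : SameOrbit ![0, d, 0, 0] p0 := by
  have : ![0, d, 0, 0] = d • rep (A1, 1) • p0 := by
    rw [A1_left]
    ext i
    fin_cases i <;> simp [p0]
  rw [this]
  exact (sameOrbit_smul_left hd _).trans
    (sameOrbit_smul (rep_left_mem (tetrahedral_le_icosahedral A1_mem)) _)

theorem sameOrbit_p0_of_eq_or {c d : ℂ} (hc : c ≠ 0) (hd : d = c ∨ d = -c) :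
    SameOrbit ![c, d, 0, 0] p0 := by
  have hs : s2 ≠ 0 := by
    intro h
    have := s2_sq
    rw [h] at this
    norm_num at this
  have h1 : SameOrbit ![c, -c, 0, 0] p0 := by
    have : ![c, -c, 0, 0] = (c * s2) • rep (1, R4) • p0 := by
      rw [R4_right]
      ext i
      fin_cases i <;> simp [p0]
      · linear_combination -c / 2 * s2_sq
      · linear_combination -c / 2 * s2_sq
    rw [this]
    exact (sameOrbit_smul_left (mul_ne_zero hc hs) _).trans
      (sameOrbit_smul (rep_right_mem R4_mem) _)
  rcases hd with rfl | rfl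
  · refine SameOrbit.trans ?_ h1
    have : ![d, d, 0, 0] = rep (A1, 1) • ![d, -d, 0, 0] := by
      rw [A1_left]
      ext i
      fin_cases i <;> simp
    rw [this]
    exact sameOrbit_smul (rep_left_mem (tetrahedral_le_icosahedral A1_mem)) _
  · exact h1

theorem quartics_pair (c d : ℂ) : quartics ![c, d, 0, 0]
    = ![c ^ 4 + d ^ 4, 2 * (c ^ 2 * d ^ 2), 0, 0, 0] := by
  rw [quartics_eq]
  ext i
  fin_cases i <;> simp

/-- The orbits meeting the line `x₂ = x₃ = 0`. This line is mapped to the singular locus of the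
quartic, where there need not be a Lagrange multiplier. -/
theorem isNodal_pair {lam c d : ℂ} (hcd : c ^ 2 + d ^ 2 = 1)
    (h : SingAt (pencil lam) ![c, d, 0, 0]) : IsNodal ![c, d, 0, 0] := by
  have h0 := (singAt_iff.mp h).2 0
  have h1 := (singAt_iff.mp h).2 1
  rw [eval_pderiv_pencil, Matrix.mulVec, dotProduct, Fin.sum_univ_five, cubicGrad, eval_f0, eval_f1,
    eval_f2, eval_f3, eval_f4] at h0 h1
  simp [jac, cubic0, cubic1, cubic4] at h0 h1
  by_cases hc : c = 0
  · subst hc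
    exact Or.inl (sameOrbit_p0_of_fst_eq_zero (by rintro rfl; norm_num at hcd))
  by_cases hd : d = 0
  · subst hd
    exact Or.inl (sameOrbit_p0_of_snd_eq_zero hc)
  set a := 2 * (c ^ 2 * d ^ 2) with ha
  have ha0 : c ^ 4 + d ^ 4 = 1 - a := by
    rw [ha]
    linear_combination (c ^ 2 + d ^ 2 + 1) * hcd
  set G0 := 2 * (1 - a) * a + 3 * lam with hG0
  set G1 := -3 * a ^ 2 + (1 - a) ^ 2 + 3 * lam with hG1
  have e0 : c ^ 2 * G0 + d ^ 2 * G1 = 0 := by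
    have : c * (c ^ 2 * G0 + d ^ 2 * G1) = 0 := by
      rw [ha0] at h0
      rw [hG0, hG1]
      linear_combination h0 / 4
    exact (mul_eq_zero.mp this).resolve_left hc
  have e1 : d ^ 2 * G0 + c ^ 2 * G1 = 0 := by
    have : d * (d ^ 2 * G0 + c ^ 2 * G1) = 0 := by
      rw [ha0] at h1
      rw [hG0, hG1]
      linear_combination h1 / 4
    exact (mul_eq_zero.mp this).resolve_left hd
  have e2 : (d - c) * ((d + c) * (G0 - G1)) = 0 := by linear_combination e1 - e0
  rcases mul_eq_zero.mp e2 with e2 | e2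
  · exact Or.inl (sameOrbit_p0_of_eq_or hc (Or.inl (sub_eq_zero.mp e2)))
  rcases mul_eq_zero.mp e2 with e2 | e2
  · exact Or.inl (sameOrbit_p0_of_eq_or hc (Or.inr (eq_neg_of_add_eq_zero_left e2)))
  have ha4 : a = 1 / 4 := by
    rw [hG0, hG1] at e2
    linear_combination e2 / 4
  refine Or.inr (Or.inl ?_)
  have hq : quartics ![c, d, 0, 0] = ![3 / 4, 1 / 4, 0, 0, 0] := by
    rw [quartics_pair, ha0, ← ha, ha4]
    norm_num
  have h2 := s2_sq
  have hp : quartics p2 = ![18 + 12 * s2, 6 + 4 * s2, 0, 0, 0] := by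
    rw [p2, quartics_pair]
    ext i
    fin_cases i <;> simp <;> grind
  refine sameOrbit_of_hasInvariants (s := 24 + 16 * s2) (u := 1 / 4) (A := 1 / 8) (A' := 1 / 8)
    (z := 1 / 4) (B := 1 / 8) (B' := 1 / 8) ?_ ?_ ?_ ?_ ?_
  · rw [hq]
    simp [cs]
    norm_num
  · rw [hq]
    simp only [HasInvariants, cx, cx', cy, cy', Matrix.cons_val_zero, Matrix.cons_val_one,
      Matrix.cons_val]
    norm_num
  · intro h0
    have h1 : s2 = -3 / 2 := by linear_combination h0 / 16
    rw [h1] at h2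
    norm_num at h2
  · rw [hp]
    simp [cs]
    ring
  · rw [hp]
    simp only [HasInvariants, cx, cx', cy, cy', Matrix.cons_val_zero, Matrix.cons_val_one,
      Matrix.cons_val]
    refine ⟨?_, ?_, ?_, ?_, ?_, ?_⟩ <;> ring

/-- The normalised points of the line `x₂ = x₃ = 0` realise all values of the invariant `m`. -/
theorem exists_pair (m : ℂ) : ∃ c d : ℂ, c ^ 2 + d ^ 2 = 1 ∧ 4 * (c ^ 2 * d ^ 2) = 1 - m := by
  obtain ⟨r, hr⟩ := IsAlgClosed.exists_pow_nat_eq m (n := 2) (by norm_num)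
  obtain ⟨c, hc⟩ := IsAlgClosed.exists_pow_nat_eq ((1 + r) / 2) (n := 2) (by norm_num)
  obtain ⟨d, hd⟩ := IsAlgClosed.exists_pow_nat_eq ((1 - r) / 2) (n := 2) (by norm_num)
  refine ⟨c, d, ?_, ?_⟩ <;> rw [hc, hd]
  · ring
  · linear_combination -hr

/-- The singular points off the quadric lie in the four orbits. -/
theorem isNodal_of_singAt {lam : ℂ} {v : V} (hq : eval v q ≠ 0) (h : SingAt (pencil lam) v) :
    IsNodal v := by
  have hs : ∀ w : V, cs (quartics w) = eval w q ^ 2 := by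
    intro w
    rw [← map_pow, q_sq]
    simp [cs, quartics]
  -- normalise to `q² = 1`
  obtain ⟨c, hc, hc4⟩ := exists_pow_four (pow_ne_zero 2 hq)
  rw [← hs] at hc4
  have hcs : cs (quartics (c • v)) = 1 := by
    rw [quartics_smul, (coords_smul _ _).1, hc4]
  have h' := h.smul (isHomogeneous_pencil lam) c
  refine IsNodal.of_sameOrbit (sameOrbit_smul_left hc v).symm ?_
  generalize c • v = w at *
  -- either the vector is equivalent to one on a line where the quartic is singular, or its
  -- invariants, possibly after exchanging the two pairs, are in one of the four classes
  rcases hasInvariants_of_singAt h' hcs with ⟨m, hm⟩ | hk | hk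
  · obtain ⟨c, d, hcd, hd⟩ := exists_pair m
    have ho : SameOrbit w ![c, d, 0, 0] := by
      have hp : quartics ![c, d, 0, 0] = ![(1 + m) / 2, (1 - m) / 2, 0, 0, 0] := by
        rw [quartics_pair]
        ext i
        fin_cases i <;> simp
        · linear_combination (c ^ 2 + d ^ 2 + 1) * hcd - hd / 2
        · linear_combination hd / 2
      refine sameOrbit_of_hasInvariants (s := 1) hcs hm one_ne_zero ?_ ?_
      · rw [hp]
        simp [cs]
        ring
      · rw [hp]
        simp only [HasInvariants, cx, cx', cy, cy', Matrix.cons_val_zero, Matrix.cons_val_one,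
          Matrix.cons_val]
        refine ⟨?_, ?_, ?_, ?_, ?_, ?_⟩ <;> ring
    exact IsNodal.of_sameOrbit ho (isNodal_pair hcd (h'.of_sameOrbit ho))
  · exact isNodal_of_critClass hcs hk
  · refine IsNodal.of_sameOrbit (sameOrbit_smul (rep_right_mem R4_mem) w).symm
      (isNodal_of_critClass ?_ ?_)
    · rw [(coords_R4_right w).1, hcs]
    · obtain ⟨-, e1, e2, e3, e4⟩ := coords_R4_right w
      rwa [e1, e2, e3, e4]

/-! ### Second derivatives of the pencil -/

/-- The second partial derivative of `cubic` with respect to `a0`;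
the entries of the Hessian matrix not listed arise by cyclic permutation of `a1`, `a2`, `a3`. -/
def cubicHess00 {R : Type*} [CommRing R] (r l a0 a1 a2 a3 a4 : R) : R :=
  2 * (a1 + a2 + a3) - 6 * r * a4 + 6 * l * (a0 + a1 + a2 + a3)

/-- The second partial derivative of `cubic` with respect to `a0` and `a1`. -/
def cubicHess01 {R : Type*} [CommRing R] (r l a0 a1 a2 a3 a4 : R) : R :=
  2 * a0 - 8 * (a2 + a3) + 6 * r * a4 + 6 * l * (a0 + a1 + a2 + a3)

/-- The second partial derivative of `cubic` with respect to `a0` and `a4`. -/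
def cubicHess04 {R : Type*} [CommRing R] (r a0 a1 a2 a3 a4 : R) : R :=
  60 * a4 - 6 * r * (a0 - a1 - a2 - a3)

/-- The second partial derivative of `cubic` with respect to `a1`. -/
def cubicHess11 {R : Type*} [CommRing R] (r l a0 a1 a2 a3 a4 : R) : R :=
  -6 * a1 + 22 * (a2 + a3) - 6 * r * a4 + 12 * r * (a2 - a3) + 6 * l * (a0 + a1 + a2 + a3)

/-- The second partial derivative of `cubic` with respect to `a1` and `a2`. -/
def cubicHess12 {R : Type*} [CommRing R] (r l a0 a1 a2 a3 a4 : R) : R :=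
  22 * (a1 + a2) - 8 * a0 - 30 * a3 - 6 * r * a4 + 12 * r * (a1 - a2)
    + 6 * l * (a0 + a1 + a2 + a3)

/-- The second partial derivative of `cubic` with respect to `a1` and `a4`. -/
def cubicHess14 {R : Type*} [CommRing R] (r a0 a1 a2 a3 a4 : R) : R :=
  -28 * a4 + 6 * r * (a0 - a1 - a2 - a3)

/-- The second partial derivative of `cubic` with respect to `a4`. -/
def cubicHess44 {R : Type*} [CommRing R] (r a0 a1 a2 a3 a4 : R) : R :=
  -28 * (a1 + a2 + a3) + 60 * a0 + 72 * r * a4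

section Derivatives

variable (D : Derivation ℂ Poly Poly) (b l : ℂ) (a0 a1 a2 a3 a4 : Poly)

theorem derivation_cubic0 : D (cubic0 (C b) (C l) a0 a1 a2 a3 a4)
    = cubicHess00 (C b) (C l) a0 a1 a2 a3 a4 * D a0 + cubicHess01 (C b) (C l) a0 a1 a2 a3 a4 * D a1
      + cubicHess01 (C b) (C l) a0 a2 a3 a1 a4 * D a2
      + cubicHess01 (C b) (C l) a0 a3 a1 a2 a4 * D a3
      + cubicHess04 (C b) a0 a1 a2 a3 a4 * D a4 := by
  have hC : ∀ c : ℂ, D (C c) = 0 := fun c => D.map_algebraMap c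
  have hn : ∀ n : ℕ, ∀ [n.AtLeastTwo], D (OfNat.ofNat n : Poly) = 0 := fun n _ => D.map_natCast n
  unfold cubic0 cubicHess00 cubicHess01 cubicHess04
  simp only [map_add, map_sub, Derivation.leibniz, Derivation.leibniz_pow, hC, hn,
    smul_eq_mul, nsmul_eq_mul]
  push_cast
  ring

theorem derivation_cubic1 : D (cubic1 (C b) (C l) a0 a1 a2 a3 a4)
    = cubicHess01 (C b) (C l) a0 a1 a2 a3 a4 * D a0 + cubicHess11 (C b) (C l) a0 a1 a2 a3 a4 * D a1
      + cubicHess12 (C b) (C l) a0 a1 a2 a3 a4 * D a2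
      + cubicHess12 (C b) (C l) a0 a3 a1 a2 a4 * D a3
      + cubicHess14 (C b) a0 a1 a2 a3 a4 * D a4 := by
  have hC : ∀ c : ℂ, D (C c) = 0 := fun c => D.map_algebraMap c
  have hn : ∀ n : ℕ, ∀ [n.AtLeastTwo], D (OfNat.ofNat n : Poly) = 0 := fun n _ => D.map_natCast n
  unfold cubic1 cubicHess01 cubicHess11 cubicHess12 cubicHess14
  simp only [map_add, map_sub, map_neg, Derivation.leibniz, Derivation.leibniz_pow, hC, hn,
    smul_eq_mul, nsmul_eq_mul]
  push_cast
  ring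

theorem derivation_cubic4 : D (cubic4 (C b) a0 a1 a2 a3 a4)
    = cubicHess04 (C b) a0 a1 a2 a3 a4 * D a0 + cubicHess14 (C b) a0 a1 a2 a3 a4 * D a1
      + cubicHess14 (C b) a0 a2 a3 a1 a4 * D a2
      + cubicHess14 (C b) a0 a3 a1 a2 a4 * D a3
      + cubicHess44 (C b) a0 a1 a2 a3 a4 * D a4 := by
  have hC : ∀ c : ℂ, D (C c) = 0 := fun c => D.map_algebraMap c
  have hn : ∀ n : ℕ, ∀ [n.AtLeastTwo], D (OfNat.ofNat n : Poly) = 0 := fun n _ => D.map_natCast n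
  unfold cubic4 cubicHess04 cubicHess14 cubicHess44
  simp only [map_add, map_sub, map_neg, Derivation.leibniz, Derivation.leibniz_pow, hC, hn,
    smul_eq_mul, nsmul_eq_mul]
  push_cast
  ring

theorem eval_cubicHess00 (v : V) : eval v (cubicHess00 (C b) (C l) a0 a1 a2 a3 a4)
    = cubicHess00 b l (eval v a0) (eval v a1) (eval v a2) (eval v a3) (eval v a4) := by
  simp [cubicHess00]

theorem eval_cubicHess01 (v : V) : eval v (cubicHess01 (C b) (C l) a0 a1 a2 a3 a4)
    = cubicHess01 b l (eval v a0) (eval v a1) (eval v a2) (eval v a3) (eval v a4) := by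
  simp [cubicHess01]

theorem eval_cubicHess04 (v : V) : eval v (cubicHess04 (C b) a0 a1 a2 a3 a4)
    = cubicHess04 b (eval v a0) (eval v a1) (eval v a2) (eval v a3) (eval v a4) := by
  simp [cubicHess04]

theorem eval_cubicHess11 (v : V) : eval v (cubicHess11 (C b) (C l) a0 a1 a2 a3 a4)
    = cubicHess11 b l (eval v a0) (eval v a1) (eval v a2) (eval v a3) (eval v a4) := by
  simp [cubicHess11]

theorem eval_cubicHess12 (v : V) : eval v (cubicHess12 (C b) (C l) a0 a1 a2 a3 a4)
    = cubicHess12 b l (eval v a0) (eval v a1) (eval v a2) (eval v a3) (eval v a4) := by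
  simp [cubicHess12]

theorem eval_cubicHess14 (v : V) : eval v (cubicHess14 (C b) a0 a1 a2 a3 a4)
    = cubicHess14 b (eval v a0) (eval v a1) (eval v a2) (eval v a3) (eval v a4) := by
  simp [cubicHess14]

theorem eval_cubicHess44 (v : V) : eval v (cubicHess44 (C b) a0 a1 a2 a3 a4)
    = cubicHess44 b (eval v a0) (eval v a1) (eval v a2) (eval v a3) (eval v a4) := by
  simp [cubicHess44]

end Derivatives

/-- The Hessian matrix of the cubic at the point with coordinates `a`. -/
def cubicHess (lam : ℂ) (a : Fin 5 → ℂ) : Matrix (Fin 5) (Fin 5) ℂ :=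
  !![cubicHess00 s5 lam (a 0) (a 1) (a 2) (a 3) (a 4),
      cubicHess01 s5 lam (a 0) (a 1) (a 2) (a 3) (a 4),
      cubicHess01 s5 lam (a 0) (a 2) (a 3) (a 1) (a 4),
      cubicHess01 s5 lam (a 0) (a 3) (a 1) (a 2) (a 4),
      cubicHess04 s5 (a 0) (a 1) (a 2) (a 3) (a 4);
    cubicHess01 s5 lam (a 0) (a 1) (a 2) (a 3) (a 4),
      cubicHess11 s5 lam (a 0) (a 1) (a 2) (a 3) (a 4),
      cubicHess12 s5 lam (a 0) (a 1) (a 2) (a 3) (a 4),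
      cubicHess12 s5 lam (a 0) (a 3) (a 1) (a 2) (a 4),
      cubicHess14 s5 (a 0) (a 1) (a 2) (a 3) (a 4);
    cubicHess01 s5 lam (a 0) (a 2) (a 3) (a 1) (a 4),
      cubicHess12 s5 lam (a 0) (a 1) (a 2) (a 3) (a 4),
      cubicHess11 s5 lam (a 0) (a 2) (a 3) (a 1) (a 4),
      cubicHess12 s5 lam (a 0) (a 2) (a 3) (a 1) (a 4),
      cubicHess14 s5 (a 0) (a 2) (a 3) (a 1) (a 4);
    cubicHess01 s5 lam (a 0) (a 3) (a 1) (a 2) (a 4),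
      cubicHess12 s5 lam (a 0) (a 3) (a 1) (a 2) (a 4),
      cubicHess12 s5 lam (a 0) (a 2) (a 3) (a 1) (a 4),
      cubicHess11 s5 lam (a 0) (a 3) (a 1) (a 2) (a 4),
      cubicHess14 s5 (a 0) (a 3) (a 1) (a 2) (a 4);
    cubicHess04 s5 (a 0) (a 1) (a 2) (a 3) (a 4),
      cubicHess14 s5 (a 0) (a 1) (a 2) (a 3) (a 4),
      cubicHess14 s5 (a 0) (a 2) (a 3) (a 1) (a 4),
      cubicHess14 s5 (a 0) (a 3) (a 1) (a 2) (a 4),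
      cubicHess44 s5 (a 0) (a 1) (a 2) (a 3) (a 4)]

/-- The derivative of the Jacobian matrix `jac` in the direction `w`. -/
def jacDir (v w : V) : Matrix (Fin 4) (Fin 5) ℂ :=
  let p (a b c : Fin 4) := 4 * (w a * v b * v c + v a * w b * v c + v a * v b * w c)
  !![p 0 0 0, p 0 1 1, p 0 2 2, p 0 3 3, p 1 2 3;
     p 1 1 1, p 1 0 0, p 1 3 3, p 1 2 2, p 0 2 3;
     p 2 2 2, p 2 3 3, p 2 0 0, p 2 1 1, p 0 1 3;
     p 3 3 3, p 3 2 2, p 3 1 1, p 3 0 0, p 0 1 2]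

/-- The derivation of the polynomial ring with constant coefficients `w`. -/
def dirDer (w : V) : Derivation ℂ Poly Poly :=
  w 0 • pderiv 0 + w 1 • pderiv 1 + w 2 • pderiv 2 + w 3 • pderiv 3

theorem dirDer_X (w : V) (k : Fin 4) : dirDer w (X k) = C (w k) := by
  fin_cases k <;> simp [dirDer, pderiv_X, smul_eq_C_mul]

theorem eval_dirDer (F : Poly) (v w : V) : eval v (dirDer w F) = dir F v w := by
  simp [dirDer, dir, Fin.sum_univ_four, smul_eval]

theorem eval_dirDer_quartics (v w : V) :
    (![eval v (dirDer w f0), eval v (dirDer w f1), eval v (dirDer w f2), eval v (dirDer w f3),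
      eval v (dirDer w f4)] : Fin 5 → ℂ) = Matrix.vecMul w (jac v) := by
  have hn : ∀ n : ℕ, ∀ [n.AtLeastTwo], dirDer w (OfNat.ofNat n : Poly) = 0 :=
    fun n _ => (dirDer w).map_natCast n
  ext k
  fin_cases k <;>
  · simp [f0, f1, f2, f3, f4, jac, Derivation.leibniz, Derivation.leibniz_pow, dirDer_X, hn,
      Matrix.vecMul, dotProduct, Fin.sum_univ_four]
    ring

theorem eval_dirDer_pderiv (v w : V) (i : Fin 4) (k : Fin 5) :
    eval v (dirDer w (pderiv i ((![f0, f1, f2, f3, f4] : Fin 5 → Poly) k))) = jacDir v w i k := by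
  have hn : ∀ n : ℕ, ∀ [n.AtLeastTwo], dirDer w (OfNat.ofNat n : Poly) = 0 :=
    fun n _ => (dirDer w).map_natCast n
  have h2 : ∀ i : Fin 4, pderiv i (2 : Poly) = 0 := fun i => (pderiv i).map_natCast 2
  have h4 : ∀ i : Fin 4, pderiv i (4 : Poly) = 0 := fun i => (pderiv i).map_natCast 4
  fin_cases i <;> fin_cases k <;>
  · simp [f0, f1, f2, f3, f4, jacDir, Derivation.leibniz, Derivation.leibniz_pow, dirDer_X, hn, h2,
      h4, pderiv_X]
    try ring1

theorem dir_pderiv_pencil (lam : ℂ) (v w : V) (i : Fin 4) : dir (pderiv i (pencil lam)) v w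
    = Matrix.mulVec (jacDir v w) (cubicGrad lam v) i
      + Matrix.mulVec (jac v) (Matrix.mulVec (cubicHess lam (quartics v))
        (Matrix.vecMul w (jac v))) i := by
  rw [← eval_dirDer_quartics, ← eval_dirDer]
  have hj : ∀ k, jac v i k = eval v (pderiv i ((![f0, f1, f2, f3, f4] : Fin 5 → Poly) k)) := by
    have h2 : ∀ i : Fin 4, pderiv i (2 : Poly) = 0 := fun i => (pderiv i).map_natCast 2
    have h4 : ∀ i : Fin 4, pderiv i (4 : Poly) = 0 := fun i => (pderiv i).map_natCast 4
    intro k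
    fin_cases i <;> fin_cases k <;>
    · simp [f0, f1, f2, f3, f4, jac, Derivation.leibniz, Derivation.leibniz_pow, pderiv_X, h2, h4]
      try ring1
  rw [Matrix.mulVec, Matrix.mulVec, dotProduct, dotProduct, Fin.sum_univ_five, Fin.sum_univ_five,
    pencil_eq, sqrt5_eq, derivation_cubic]
  simp only [hj, ← eval_dirDer_pderiv]
  simp only [map_add, Derivation.leibniz, derivation_cubic0, derivation_cubic1, derivation_cubic4,
    smul_eq_mul, map_mul]
  simp only [eval_cubic0, eval_cubic1, eval_cubic4, cubicGrad, cubicHess, Matrix.mulVec, dotProduct,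
    Fin.sum_univ_five, quartics, eval_cubicHess00, eval_cubicHess01, eval_cubicHess04,
    eval_cubicHess11, eval_cubicHess12, eval_cubicHess14, eval_cubicHess44, Matrix.of_apply,
    Matrix.cons_val_zero, Matrix.cons_val_one, Matrix.cons_val]
  ring

/-! ### The four representatives are nodes -/

theorem cubicGrad_eq (lam : ℂ) (v : V) : cubicGrad lam v =
    ![cubic0 s5 lam (quartics v 0) (quartics v 1) (quartics v 2) (quartics v 3) (quartics v 4),
      cubic1 s5 lam (quartics v 0) (quartics v 1) (quartics v 2) (quartics v 3) (quartics v 4),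
      cubic1 s5 lam (quartics v 0) (quartics v 2) (quartics v 3) (quartics v 1) (quartics v 4),
      cubic1 s5 lam (quartics v 0) (quartics v 3) (quartics v 1) (quartics v 2) (quartics v 4),
      cubic4 s5 (quartics v 0) (quartics v 1) (quartics v 2) (quartics v 3) (quartics v 4)] := rfl

theorem eval_pencil_eq (lam : ℂ) (v : V) : eval v (pencil lam) = cubic s5 lam (quartics v 0)
    (quartics v 1) (quartics v 2) (quartics v 3) (quartics v 4) := eval_pencil lam v

/-- A singular point is a node if the kernel of its Hessian matrix is spanned by the point. -/
theorem nodeAt_of_kernel {lam : ℂ} {v : V} (h0 : eval v (pencil lam) = 0)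
    (h1 : ∀ i, Matrix.mulVec (jac v) (cubicGrad lam v) i = 0)
    (h2 : ∀ w : V, (∀ i, Matrix.mulVec (jacDir v w) (cubicGrad lam v) i
      + Matrix.mulVec (jac v) (Matrix.mulVec (cubicHess lam (quartics v))
        (Matrix.vecMul w (jac v))) i = 0) → ∃ c : ℂ, w = c • v) : NodeAt (pencil lam) v := by
  refine ⟨singAt_iff.mpr ⟨h0, fun i => by rw [eval_pderiv_pencil, h1]⟩,
    fun w hw => h2 w fun i => ?_⟩
  rw [← dir_pderiv_pencil]
  have := hw (Pi.single i 1)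
  simpa [dir2, Pi.single_apply] using this

theorem quartics_p0 : quartics p0 = ![1, 0, 0, 0, 0] := by
  rw [quartics_eq]
  ext i
  fin_cases i <;> simp [p0]

theorem quartics_p2 : quartics p2 = ![18 + 12 * s2, 6 + 4 * s2, 0, 0, 0] := by
  have h2 := s2_sq
  rw [p2, quartics_pair]
  ext i
  fin_cases i <;> simp <;> grind

theorem quartics_pe {e : ℂ} (he : e ^ 2 = 2) : quartics (pe e) = ![332 + 104 * s5 * e,
    28 + 8 * s5 * e, 28 + 8 * s5 * e, 28 + 8 * s5 * e, -4 * s5 - 8 * e] := by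
  have h5 := s5_sq
  rw [quartics_eq]
  ext i
  fin_cases i <;> simp [pe] <;> grind

/-- The value of the parameter for which the surface passes through `p0`. -/
theorem eq_zero_of_eval_p0 {lam : ℂ} (h : eval p0 (pencil lam) = 0) : lam = 0 := by
  rw [eval_pencil_eq, quartics_p0] at h
  simpa [cubic] using h

theorem eq_of_eval_p2 {lam : ℂ} (h : eval p2 (pencil lam) = 0) : lam = -1 / 8 := by
  have h2 := s2_sq
  rw [eval_pencil_eq, quartics_p2] at h
  simp [cubic] at h
  have hs : (24 + 16 * s2) ^ 3 ≠ 0 := by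
    apply pow_ne_zero
    intro h0
    have h1 : s2 = -3 / 2 := by linear_combination h0 / 16
    rw [h1] at h2
    norm_num at h2
  have : (24 + 16 * s2) ^ 3 * (8 * lam + 1) = 0 := by grind
  linear_combination (mul_eq_zero.mp this).resolve_left hs / 8

theorem eq_of_eval_pe {e lam : ℂ} (he : e ^ 2 = 2) (h : eval (pe e) (pencil lam) = 0) :
    lam = -74 / 972 - 4 / 243 * (s5 * e) := by
  have h5 := s5_sq
  rw [eval_pencil_eq, quartics_pe he] at h
  simp [cubic] at h
  generalize s5 = s at *
  have hs : (416 + 128 * (s * e)) ^ 3 ≠ 0 := by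
    apply pow_ne_zero
    intro h0
    have h1 : s * e = -13 / 4 := by linear_combination h0 / 128
    have h2 : (s * e) ^ 2 = 10 := by rw [mul_pow, h5, he]; norm_num
    rw [h1] at h2
    norm_num at h2
  have : (416 + 128 * (s * e)) ^ 3 * (486 * lam + 37 + 8 * (s * e)) = 0 := by grind
  linear_combination (mul_eq_zero.mp this).resolve_left hs / 486

theorem nodeAt_p0 : NodeAt (pencil 0) p0 := by
  apply nodeAt_of_kernel
  · rw [eval_pencil_eq, quartics_p0]
    simp [cubic]
  · intro i
    rw [cubicGrad_eq, quartics_p0]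
    fin_cases i <;> simp [jac, p0, Matrix.mulVec, dotProduct, Fin.sum_univ_five, cubic0]
  · intro w hw
    rw [cubicGrad_eq, quartics_p0] at hw
    have h1 := hw 1
    have h2 := hw 2
    have h3 := hw 3
    simp [jac, jacDir, p0, Matrix.mulVec, dotProduct, Fin.sum_univ_five, cubic0, cubic1, cubic4]
      at h1 h2 h3
    refine ⟨w 0, ?_⟩
    ext i
    fin_cases i <;> simp [p0, h1, h2, h3]

theorem nodeAt_p2 : NodeAt (pencil (-1 / 8)) p2 := by
  have h2 := s2_sq
  have h5 := s5_sq
  apply nodeAt_of_kernel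
  · rw [eval_pencil_eq, quartics_p2]
    simp [cubic]
    grind
  · intro i
    rw [cubicGrad_eq, quartics_p2]
    fin_cases i <;>
      simp [jac, p2, Matrix.mulVec, dotProduct, Fin.sum_univ_five, cubic0, cubic1] <;> grind
  · intro w hw
    rw [cubicGrad_eq, quartics_p2] at hw
    have k1 := hw 1
    have k2 := hw 2
    have k3 := hw 3
    simp [jac, jacDir, p2, Matrix.mulVec, Matrix.vecMul, dotProduct, Fin.sum_univ_five,
      Fin.sum_univ_four, cubic0, cubic1, cubic4, cubicHess, cubicHess00, cubicHess01, cubicHess04,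
      cubicHess11, cubicHess12, cubicHess14, cubicHess44] at k1 k2 k3
    clear hw
    generalize hw0 : w 0 = w0, hw1 : w 1 = w1, hw2 : w 2 = w2, hw3 : w 3 = w3 at *
    generalize s5 = s, he : s2 = e at *
    have l1 : (10496 + 7424 * e) * (w0 - (1 + e) * w1) = 0 := by
      linear_combination (norm := skip) k1
      clear k1 k2 k3
      grind
    have l2 : 64 * (41 + 29 * e) * ((-5 * e + 3 * s) * w2 - 3 * s * w3) = 0 := by
      linear_combination (norm := skip) k2
      clear k1 k2 k3
      grind
    have l3 : 64 * (41 + 29 * e) * (-3 * s * w2 + (-5 * e - 3 * s) * w3) = 0 := by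
      linear_combination (norm := skip) k3
      clear k1 k2 k3
      grind
    clear k1 k2 k3
    have hκ : 64 * (41 + 29 * e) ≠ 0 := by
      intro h0
      have h1 : e = -41 / 29 := by linear_combination h0 / 1856
      rw [h1] at h2
      norm_num at h2
    have hκ' : 10496 + 7424 * e ≠ 0 := by
      intro h0
      exact hκ (by linear_combination h0 / 4)
    have m1 := (mul_eq_zero.mp l1).resolve_left hκ'
    have m2 := (mul_eq_zero.mp l2).resolve_left hκ
    have m3 := (mul_eq_zero.mp l3).resolve_left hκ
    have n2 : w2 = 0 := by grind
    have n3 : w3 = 0 := by grind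
    refine ⟨w1, ?_⟩
    ext i
    fin_cases i
    · simp [p2, hw0, he]
      linear_combination m1
    · simp [p2, hw1]
    · simp [p2, hw2, n2]
    · simp [p2, hw3, n3]

theorem nodeAt_pe {e : ℂ} (he : e ^ 2 = 2) {lam : ℂ} (hl : lam = -74 / 972 - 4 / 243 * (s5 * e)) :
    NodeAt (pencil lam) (pe e) := by
  have h5 := s5_sq
  replace hl : 486 * lam = -37 - 8 * (s5 * e) := by rw [hl]; ring
  apply nodeAt_of_kernel
  · rw [eval_pencil_eq, quartics_pe he]
    simp [cubic]
    grind
  · intro i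
    rw [cubicGrad_eq, quartics_pe he]
    fin_cases i <;>
      simp [jac, pe, Matrix.mulVec, dotProduct, Fin.sum_univ_five, cubic0, cubic1, cubic4] <;>
      grind
  · intro w hw
    rw [cubicGrad_eq, quartics_pe he] at hw
    have k0 := hw 0
    have k1 := hw 1
    have k2 := hw 2
    have k3 := hw 3
    simp [jac, jacDir, pe, Matrix.mulVec, Matrix.vecMul, dotProduct, Fin.sum_univ_five,
      Fin.sum_univ_four, cubic0, cubic1, cubic4, cubicHess, cubicHess00, cubicHess01, cubicHess04,
      cubicHess11, cubicHess12, cubicHess14, cubicHess44] at k0 k1 k2 k3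
    clear hw
    generalize hw0 : w 0 = w0, hw1 : w 1 = w1, hw2 : w 2 = w2, hw3 : w 3 = w3 at *
    generalize hs : s5 = s at *
    have l12 : (14090240 + 4456448 * (s * e)) * (w1 + w2) = 0 := by
      linear_combination (norm := skip) - k1 - k2
      clear k0 k1 k2 k3
      grind
    have l13 : (14090240 + 4456448 * (s * e)) * (w1 - w3) = 0 := by
      linear_combination (norm := skip) - k1 + k3
      clear k0 k1 k2 k3
      grind
    have hse : (s * e) ^ 2 = 10 := by rw [mul_pow, h5, he]; norm_num
    have hne : ∀ a : ℂ, a ^ 2 ≠ 10 → s * e ≠ a := by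
      rintro a ha rfl
      exact ha hse
    have hA : 14090240 + 4456448 * (s * e) ≠ 0 := fun h0 =>
      hne (-14090240 / 4456448) (by norm_num) (by linear_combination h0 / 4456448)
    have hB : 6684672 + 2113536 * (s * e) ≠ 0 := fun h0 =>
      hne (-6684672 / 2113536) (by norm_num) (by linear_combination h0 / 2113536)
    have m2 := (mul_eq_zero.mp l12).resolve_left hA
    have m3 := (mul_eq_zero.mp l13).resolve_left hA
    have n2 : w2 = -w1 := by linear_combination m2
    have n3 : w3 = w1 := by linear_combination -m3
    rw [n2, n3] at k0
    have l0 : (6684672 + 2113536 * (s * e)) * (w0 - (2 * e + s) * w1) = 0 := by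
      linear_combination (norm := skip) -k0
      clear k0 k1 k2 k3
      grind
    have m0 := (mul_eq_zero.mp l0).resolve_left hB
    refine ⟨w1, ?_⟩
    ext i
    fin_cases i
    · simp [pe, hw0, hs]
      linear_combination m0
    · simp [pe, hw1]
    · simp [pe, hw2]
      linear_combination m2
    · simp [pe, hw3]
      linear_combination -m3

/-! ### The action of the binary octahedral group on the diagonals of the cube -/

theorem quat_mul (a b c d a' b' c' d' : ℝ) : quat a b c d * quat a' b' c' d'
    = quat (a * a' - b * b' - c * c' - d * d') (a * b' + b * a' + c * d' - d * c')
        (a * c' - b * d' + c * a' + d * b') (a * d' + b * c' - c * b' + d * a') := by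
  apply Quaternion.ext
  · exact Quaternion.re_mul _ _
  · exact Quaternion.imI_mul _ _
  · exact Quaternion.imJ_mul _ _
  · exact Quaternion.imK_mul _ _

theorem quat_neg (a b c d : ℝ) : -quat a b c d = quat (-a) (-b) (-c) (-d) := rfl

theorem quat_inj {a b c d a' b' c' d' : ℝ} :
    quat a b c d = quat a' b' c' d' ↔ a = a' ∧ b = b' ∧ c = c' ∧ d = d' := by
  refine ⟨fun h => ⟨congrArg (fun x : ℍ[ℝ] => x.re) h, congrArg (fun x : ℍ[ℝ] => x.imI) h,
    congrArg (fun x : ℍ[ℝ] => x.imJ) h, congrArg (fun x : ℍ[ℝ] => x.imK) h⟩, ?_⟩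
  rintro ⟨rfl, rfl, rfl, rfl⟩
  rfl

theorem quat_eta (x : ℍ[ℝ]) : quat x.re x.imI x.imJ x.imK = x := rfl

theorem coe_unitQuat (a b c d : ℝ) (h : a ^ 2 + b ^ 2 + c ^ 2 + d ^ 2 = 1) :
    (unitQuat a b c d h).1 = quat a b c d := rfl

theorem ne_zero_of_unit (b : UnitQuaternions) : b.1 ≠ 0 := by
  intro h
  have := sq_sum_of_mem b
  rw [h] at this
  norm_num at this

/-- The four diagonals of the cube, up to sign. -/
def diagonal : Fin 4 → ℍ[ℝ] :=
  ![quat 0 1 1 1, quat 0 1 (-1) (-1), quat 0 (-1) 1 (-1), quat 0 (-1) (-1) 1]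

theorem diagonal_injective {i j : Fin 4} (h : diagonal i = diagonal j ∨ diagonal i = -diagonal j) :
    i = j := by
  fin_cases i <;> fin_cases j <;> simp [diagonal, quat_neg, quat_inj] at h ⊢ <;> norm_num at h

/-- The rotation defined by `b` induces the permutation `σ` of the four diagonals. -/
def Permutes (b : UnitQuaternions) (σ : Equiv.Perm (Fin 4)) : Prop :=
  ∀ i, b.1 * diagonal i = diagonal (σ i) * b.1 ∨ b.1 * diagonal i = -(diagonal (σ i) * b.1)

theorem Permutes.unique {b : UnitQuaternions} {σ τ : Equiv.Perm (Fin 4)} (h : Permutes b σ)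
    (h' : Permutes b τ) : σ = τ := by
  ext1 i
  apply diagonal_injective
  have hb := ne_zero_of_unit b
  rcases h i with h1 | h1 <;> rcases h' i with h2 | h2 <;> rw [h1] at h2
  · exact Or.inl (mul_right_cancel₀ hb h2)
  · exact Or.inr (mul_right_cancel₀ hb (by rw [h2, neg_mul]))
  · exact Or.inr (mul_right_cancel₀ hb (by rw [neg_mul, ← h2, neg_neg]))
  · exact Or.inl (mul_right_cancel₀ hb (neg_injective h2))

theorem Permutes.mul {b c : UnitQuaternions} {σ τ : Equiv.Perm (Fin 4)} (hb : Permutes b σ)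
    (hc : Permutes c τ) : Permutes (b * c) (σ * τ) := by
  intro i
  change b.1 * c.1 * _ = diagonal (σ (τ i)) * (b.1 * c.1) ∨
    b.1 * c.1 * _ = -(diagonal (σ (τ i)) * (b.1 * c.1))
  rcases hc i with h1 | h1 <;> rcases hb (τ i) with h2 | h2 <;> rw [mul_assoc, h1]
  · exact Or.inl (by rw [← mul_assoc, h2, mul_assoc])
  · exact Or.inr (by rw [← mul_assoc, h2, neg_mul, mul_assoc])
  · exact Or.inr (by rw [mul_neg, ← mul_assoc, h2, mul_assoc])
  · exact Or.inl (by rw [mul_neg, ← mul_assoc, h2, neg_mul, neg_neg, mul_assoc])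

theorem Permutes.one : Permutes 1 1 := fun i => Or.inl (by simp)

theorem Permutes.inv {b : UnitQuaternions} {σ : Equiv.Perm (Fin 4)} (hb : Permutes b σ) :
    Permutes b⁻¹ σ⁻¹ := by
  intro i
  have h0 : b.1 * (b⁻¹).1 = 1 := congrArg Subtype.val (mul_inv_cancel b)
  have h0' : (b⁻¹).1 * b.1 = 1 := congrArg Subtype.val (inv_mul_cancel b)
  have h1 := hb (σ⁻¹ i)
  rw [show σ (σ⁻¹ i) = i from σ.apply_symm_apply i] at h1
  rcases h1 with h1 | h1
  · left
    calc (b⁻¹).1 * diagonal i = (b⁻¹).1 * (diagonal i * b.1) * (b⁻¹).1 := by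
          rw [mul_assoc, mul_assoc, h0, mul_one]
      _ = diagonal (σ⁻¹ i) * (b⁻¹).1 := by rw [← h1, ← mul_assoc, h0', one_mul]
  · right
    calc (b⁻¹).1 * diagonal i = (b⁻¹).1 * (diagonal i * b.1) * (b⁻¹).1 := by
          rw [mul_assoc, mul_assoc, h0, mul_one]
      _ = -(diagonal (σ⁻¹ i) * (b⁻¹).1) := by
          rw [← neg_neg (diagonal i * b.1), ← h1, mul_neg, ← mul_assoc, h0', one_mul, neg_mul]

/-- The unit quaternions whose rotations permute the diagonals of the cube. -/
def cubeGroup : Subgroup UnitQuaternions where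
  carrier := {b | ∃ σ, Permutes b σ}
  one_mem' := ⟨1, Permutes.one⟩
  mul_mem' := fun ⟨σ, hσ⟩ ⟨τ, hτ⟩ => ⟨σ * τ, hσ.mul hτ⟩
  inv_mem' := fun ⟨σ, hσ⟩ => ⟨σ⁻¹, hσ.inv⟩

/-- The action on the diagonals as a homomorphism to the symmetric group. -/
def diagPerm : cubeGroup →* Equiv.Perm (Fin 4) where
  toFun b := b.2.choose
  map_one' := (Subtype.prop (1 : cubeGroup)).choose_spec.unique Permutes.one
  map_mul' b c := (Subtype.prop (b * c)).choose_spec.unique (b.2.choose_spec.mul c.2.choose_spec)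

theorem permutes_diagPerm (b : cubeGroup) : Permutes b.1 (diagPerm b) := b.2.choose_spec

theorem diagPerm_eq {b : cubeGroup} {σ : Equiv.Perm (Fin 4)} (h : Permutes b.1 σ) :
    diagPerm b = σ := (permutes_diagPerm b).unique h

theorem eq_one_or_of_permutes_one {b : UnitQuaternions} (h : Permutes b 1) : b = 1 ∨ b = -1 := by
  have h0 := h 0
  have h1 := h 1
  have h2 := h 2
  have h3 := h 3
  have hn := sq_sum_of_mem b
  simp only [Equiv.Perm.one_apply, diagonal, Matrix.cons_val_zero, Matrix.cons_val_one,
    Matrix.cons_val] at h0 h1 h2 h3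
  rw [← quat_eta b.1, quat_mul, quat_mul, quat_neg, quat_inj, quat_inj] at h0 h1 h2 h3
  have hx : b.1.imI = 0 ∧ b.1.imJ = 0 ∧ b.1.imK = 0 := by
    generalize b.1.re = r, b.1.imI = x, b.1.imJ = y, b.1.imK = z at *
    rcases h0 with h0 | h0 <;> rcases h1 with h1 | h1 <;> rcases h2 with h2 | h2 <;>
      rcases h3 with h3 | h3 <;>
    · obtain ⟨d0, a0, b0, c0⟩ := h0
      obtain ⟨d1, a1, b1, c1⟩ := h1
      obtain ⟨d2, a2, b2, c2⟩ := h2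
      obtain ⟨d3, a3, b3, c3⟩ := h3
      refine ⟨?_, ?_, ?_⟩ <;> linarith
  obtain ⟨hx, hy, hz⟩ := hx
  rw [hx, hy, hz] at hn
  have hr : (b.1.re - 1) * (b.1.re + 1) = 0 := by linarith
  rcases mul_eq_zero.mp hr with hr | hr
  · left
    apply Subtype.ext
    apply Quaternion.ext
    exacts [sub_eq_zero.mp hr, hx, hy, hz]
  · right
    apply Subtype.ext
    apply Quaternion.ext
    exacts [eq_neg_of_add_eq_zero_left hr, hx.trans neg_zero.symm, hy.trans neg_zero.symm,
      hz.trans neg_zero.symm]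

theorem permutes_neg {b : UnitQuaternions} {σ : Equiv.Perm (Fin 4)} (h : Permutes b σ) :
    Permutes (-b) σ := by
  intro i
  change -b.1 * _ = _ * -b.1 ∨ -b.1 * _ = -(_ * -b.1)
  rcases h i with h | h <;> simp [h]

open Equiv in
theorem permutes_A1 : Permutes A1 (swap 0 1 * swap 2 3) := by
  intro i
  have h : ∀ i : Fin 4, (swap 0 1 * swap 2 3 : Perm (Fin 4)) i = ![1, 0, 3, 2] i := by decide
  rw [h, A1, coe_unitQuat]
  fin_cases i <;> simp [diagonal, quat_mul, quat_neg, quat_inj]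

open Equiv in
theorem permutes_S : Permutes S (swap 0 3 * swap 3 1) := by
  intro i
  have h : ∀ i : Fin 4, (swap 0 3 * swap 3 1 : Perm (Fin 4)) i = ![3, 0, 2, 1] i := by decide
  rw [h, S, coe_unitQuat]
  fin_cases i <;> simp [diagonal, quat_mul, quat_neg, quat_inj] <;> norm_num

open Equiv in
theorem permutes_R4 : Permutes R4 (swap 0 2 * swap 2 1 * swap 1 3) := by
  intro i
  have h : ∀ i : Fin 4, (swap 0 2 * swap 2 1 * swap 1 3 : Perm (Fin 4)) i = ![2, 3, 1, 0] i := by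
    decide
  rw [h, R4, coe_unitQuat]
  fin_cases i <;> simp [diagonal, quat_mul, quat_neg, quat_inj]
  · right
    ring
  · right
    ring

theorem octahedral_le_cubeGroup : binaryOctahedral ≤ cubeGroup := by
  refine (Subgroup.closure_le _).mpr ?_
  rintro x (rfl | rfl | rfl)
  · exact ⟨_, permutes_A1⟩
  · exact ⟨_, permutes_R4⟩
  · exact ⟨_, permutes_S⟩

theorem tetrahedral_le_cubeGroup : binaryTetrahedral ≤ cubeGroup :=
  tetrahedral_le_octahedral.trans octahedral_le_cubeGroup

theorem neg_one_mem : (-1 : UnitQuaternions) ∈ binaryTetrahedral := by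
  have : (-1 : UnitQuaternions) = A1 * A1 := by
    apply Subtype.ext
    change (-1 : ℍ[ℝ]) = A1.1 * A1.1
    rw [A1, coe_unitQuat, quat_mul]
    ext <;> simp [quat]
  rw [this]
  exact mul_mem A1_mem A1_mem

theorem neg_mem_of_le {G : Subgroup UnitQuaternions} (hG : binaryTetrahedral ≤ G)
    {b : UnitQuaternions} (hb : b ∈ G) : -b ∈ G := by
  rw [← neg_one_mul]
  exact mul_mem (hG neg_one_mem) hb

theorem neg_one_ne_one : (-1 : UnitQuaternions) ≠ 1 := by
  intro h
  have h1 : (-1 : ℝ) = 1 := congrArg (fun x : UnitQuaternions => x.1.re) h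
  norm_num at h1

/-- A group containing `-1` and acting on the diagonals has twice the order of its image in the
symmetric group. -/
theorem card_of_le_cubeGroup {G : Subgroup UnitQuaternions} (hG : binaryTetrahedral ≤ G)
    (hG' : G ≤ cubeGroup) :
    Nat.card G = 2 * Nat.card (diagPerm.comp (Subgroup.inclusion hG')).range := by
  set F := diagPerm.comp (Subgroup.inclusion hG') with hF
  have hker : ∀ b : G, b ∈ F.ker ↔ b.1 = 1 ∨ b.1 = -1 := by
    intro b
    rw [MonoidHom.mem_ker]
    constructor
    · intro h
      have := permutes_diagPerm (Subgroup.inclusion hG' b)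
      rw [show diagPerm (Subgroup.inclusion hG' b) = 1 from h] at this
      exact eq_one_or_of_permutes_one this
    · rintro (h | h)
      · exact diagPerm_eq (by rw [Subgroup.coe_inclusion, h]; exact Permutes.one)
      · exact diagPerm_eq (by rw [Subgroup.coe_inclusion, h]; exact permutes_neg Permutes.one)
  have h2 : Nat.card F.ker = 2 := by
    rw [Nat.card_eq_two_iff]
    refine ⟨1, ⟨⟨-1, hG neg_one_mem⟩, (hker _).mpr (Or.inr rfl)⟩, ?_, ?_⟩
    · intro h
      exact neg_one_ne_one (congrArg (fun x : F.ker => x.1.1) h).symm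
    · ext x
      simp only [Set.mem_insert_iff, Set.mem_singleton_iff, Set.mem_univ, iff_true]
      rcases (hker x.1).mp x.2 with h | h
      · exact Or.inl (Subtype.ext (Subtype.ext h))
      · exact Or.inr (Subtype.ext (Subtype.ext h))
  rw [Subgroup.card_eq_card_quotient_mul_card_subgroup F.ker, h2, mul_comm,
    Nat.card_congr (QuotientGroup.quotientKerEquivRange F).toEquiv]

open Equiv in
theorem alternating_le_closure : alternatingGroup (Fin 4)
    ≤ Subgroup.closure {swap 0 1 * swap 2 3, swap 0 3 * swap 3 1} := by
  have h : ∀ σ : Perm (Fin 4), Perm.sign σ = 1 → ∃ i j : Fin 2, ∃ k : Fin 3,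
      σ = (swap 0 1 * swap 2 3) ^ (i : ℕ) * ((swap 0 3 * swap 3 1) * (swap 0 1 * swap 2 3)
        * (swap 0 3 * swap 3 1)⁻¹) ^ (j : ℕ) * (swap 0 3 * swap 3 1) ^ (k : ℕ) := by
    decide
  intro σ hσ
  obtain ⟨i, j, k, rfl⟩ := h σ (Perm.mem_alternatingGroup.mp hσ)
  have h1 : (swap 0 1 * swap 2 3 : Perm (Fin 4))
      ∈ Subgroup.closure {swap 0 1 * swap 2 3, swap 0 3 * swap 3 1} :=
    Subgroup.subset_closure (by simp)
  have h2 : (swap 0 3 * swap 3 1 : Perm (Fin 4))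
      ∈ Subgroup.closure {swap 0 1 * swap 2 3, swap 0 3 * swap 3 1} :=
    Subgroup.subset_closure (by simp)
  exact mul_mem (mul_mem (pow_mem h1 _) (pow_mem (mul_mem (mul_mem h2 h1) (inv_mem h2)) _))
    (pow_mem h2 _)

theorem card_binaryTetrahedral : Nat.card binaryTetrahedral = 24 := by
  have hle : binaryTetrahedral ≤ ((alternatingGroup (Fin 4)).comap diagPerm).map
      cubeGroup.subtype := by
    refine (Subgroup.closure_le _).mpr ?_
    rintro x (rfl | rfl)
    · refine ⟨⟨A1, tetrahedral_le_cubeGroup A1_mem⟩, ?_, rfl⟩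
      change diagPerm _ ∈ alternatingGroup (Fin 4)
      rw [diagPerm_eq (σ := Equiv.swap 0 1 * Equiv.swap 2 3) permutes_A1,
        Equiv.Perm.mem_alternatingGroup]
      decide
    · refine ⟨⟨S, tetrahedral_le_cubeGroup S_mem⟩, ?_, rfl⟩
      change diagPerm _ ∈ alternatingGroup (Fin 4)
      rw [diagPerm_eq (σ := Equiv.swap 0 3 * Equiv.swap 3 1) permutes_S,
        Equiv.Perm.mem_alternatingGroup]
      decide
  have : (diagPerm.comp (Subgroup.inclusion tetrahedral_le_cubeGroup)).range
      = alternatingGroup (Fin 4) := by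
    apply le_antisymm
    · rintro σ ⟨b, rfl⟩
      obtain ⟨c, hc, hcb⟩ := hle b.2
      have : Subgroup.inclusion tetrahedral_le_cubeGroup b = c := Subtype.ext hcb.symm
      rw [MonoidHom.comp_apply, this]
      exact hc
    · refine alternating_le_closure.trans ((Subgroup.closure_le _).mpr ?_)
      rintro σ (rfl | rfl)
      · exact ⟨⟨A1, A1_mem⟩, diagPerm_eq permutes_A1⟩
      · exact ⟨⟨S, S_mem⟩, diagPerm_eq permutes_S⟩
  rw [card_of_le_cubeGroup le_rfl tetrahedral_le_cubeGroup, this, nat_card_alternatingGroup]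
  simp [Nat.factorial]

theorem card_binaryOctahedral : Nat.card binaryOctahedral = 48 := by
  have : (diagPerm.comp (Subgroup.inclusion octahedral_le_cubeGroup)).range = ⊤ := by
    set G := (diagPerm.comp (Subgroup.inclusion octahedral_le_cubeGroup)).range with hG
    have h1 : alternatingGroup (Fin 4) ≤ G := by
      refine alternating_le_closure.trans ((Subgroup.closure_le _).mpr ?_)
      rintro σ (rfl | rfl)
      · exact ⟨⟨A1, tetrahedral_le_octahedral A1_mem⟩, diagPerm_eq permutes_A1⟩
      · exact ⟨⟨S, tetrahedral_le_octahedral S_mem⟩, diagPerm_eq permutes_S⟩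
    have h2 : (Equiv.swap 0 2 * Equiv.swap 2 1 * Equiv.swap 1 3 : Equiv.Perm (Fin 4)) ∈ G :=
      ⟨⟨R4, R4_mem⟩, diagPerm_eq permutes_R4⟩
    rw [eq_top_iff]
    rintro σ -
    have h3 : ∀ σ : Equiv.Perm (Fin 4), Equiv.Perm.sign σ = 1 ∨ Equiv.Perm.sign
        (σ * (Equiv.swap 0 2 * Equiv.swap 2 1 * Equiv.swap 1 3)) = 1 := by decide
    rcases h3 σ with h | h
    · exact h1 (Equiv.Perm.mem_alternatingGroup.mpr h)
    · exact (Subgroup.mul_mem_cancel_right G h2).mp (h1 (Equiv.Perm.mem_alternatingGroup.mpr h))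
  rw [card_of_le_cubeGroup tetrahedral_le_octahedral octahedral_le_cubeGroup, this]
  rw [Subgroup.card_top, Nat.card_perm, Nat.card_fin]
  decide

/-! ### The binary icosahedral group -/

/-- The real numbers in `ℚ(√5)`. -/
def InSqrtFive (r : ℝ) : Prop := ∃ a b : ℚ, r = a + b * √5

theorem InSqrtFive.add {r s : ℝ} (hr : InSqrtFive r) (hs : InSqrtFive s) : InSqrtFive (r + s) := by
  obtain ⟨a, b, rfl⟩ := hr
  obtain ⟨c, d, rfl⟩ := hs
  exact ⟨a + c, b + d, by push_cast; ring⟩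

theorem InSqrtFive.neg {r : ℝ} (hr : InSqrtFive r) : InSqrtFive (-r) := by
  obtain ⟨a, b, rfl⟩ := hr
  exact ⟨-a, -b, by push_cast; ring⟩

theorem InSqrtFive.sub {r s : ℝ} (hr : InSqrtFive r) (hs : InSqrtFive s) : InSqrtFive (r - s) :=
  sub_eq_add_neg r s ▸ hr.add hs.neg

theorem InSqrtFive.mul {r s : ℝ} (hr : InSqrtFive r) (hs : InSqrtFive s) : InSqrtFive (r * s) := by
  obtain ⟨a, b, rfl⟩ := hr
  obtain ⟨c, d, rfl⟩ := hs
  have h5 : √5 ^ 2 = 5 := Real.sq_sqrt (by norm_num)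
  exact ⟨a * c + 5 * b * d, a * d + b * c, by push_cast; linear_combination (b * d : ℝ) * h5⟩

theorem not_isSquare_of_lt {m n : ℕ} (h : m * m < n) (h' : n < (m + 1) * (m + 1)) :
    ¬IsSquare n := by
  rintro ⟨k, rfl⟩
  exact absurd (Nat.mul_self_lt_mul_self_iff.mp h') (not_lt.mpr (Nat.mul_self_lt_mul_self_iff.mp h))

theorem not_exists_sq_eq {n : ℕ} (hn : ¬IsSquare n) (a : ℚ) : a ^ 2 ≠ n := by
  intro h
  have h1 := irrational_sqrt_natCast_iff.mpr hn
  apply h1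
  refine ⟨|a|, ?_⟩
  have h2 : ((a : ℝ)) ^ 2 = n := by exact_mod_cast h
  rw [← h2, Real.sqrt_sq_eq_abs]
  push_cast
  rfl

/-- `1 / √2` does not lie in `ℚ(√5)`. -/
theorem InSqrtFive.two_mul_sq_ne_one {r : ℝ} (hr : InSqrtFive r) : 2 * r ^ 2 ≠ 1 := by
  obtain ⟨a, b, rfl⟩ := hr
  intro h
  have h5 : √5 ^ 2 = 5 := Real.sq_sqrt (by norm_num)
  have h1 : (4 * a * b : ℝ) * √5 = 1 - 2 * a ^ 2 - 10 * b ^ 2 := by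
    linear_combination h - 2 * (b : ℝ) ^ 2 * h5
  have h2 : a * b = 0 := by
    by_contra h0
    have h4 : (4 * a * b : ℚ) ≠ 0 := by
      rw [mul_assoc]
      exact mul_ne_zero (by norm_num) h0
    have h4' : (4 * a * b : ℝ) ≠ 0 := by exact_mod_cast h4
    apply not_exists_sq_eq (n := 5) (not_isSquare_of_lt (m := 2) (by norm_num) (by norm_num))
      ((1 - 2 * a ^ 2 - 10 * b ^ 2) / (4 * a * b))
    have h6 : √5 = (1 - 2 * a ^ 2 - 10 * b ^ 2) / (4 * a * b) := by
      rw [eq_div_iff h4', mul_comm, h1]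
    rw [h6] at h5
    exact_mod_cast h5
  have h3 : (1 - 2 * a ^ 2 - 10 * b ^ 2 : ℚ) = 0 := by
    have h2' : (a * b : ℝ) = 0 := by exact_mod_cast h2
    have : (1 - 2 * a ^ 2 - 10 * b ^ 2 : ℝ) = 0 := by rw [← h1]; linear_combination 4 * √5 * h2'
    exact_mod_cast this
  rcases mul_eq_zero.mp h2 with h0 | h0 <;> rw [h0] at h3
  · exact not_exists_sq_eq (n := 10) (not_isSquare_of_lt (m := 3) (by norm_num) (by norm_num))
      (10 * b) (by push_cast; linear_combination -10 * h3)
  · exact not_exists_sq_eq (n := 2) (not_isSquare_of_lt (m := 1) (by norm_num) (by norm_num))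
      (2 * a) (by push_cast; linear_combination -2 * h3)

/-- The unit quaternions with coordinates in `ℚ(√5)`. -/
def sqrtFiveGroup : Subgroup UnitQuaternions where
  carrier := {a | InSqrtFive a.1.re ∧ InSqrtFive a.1.imI ∧ InSqrtFive a.1.imJ ∧ InSqrtFive a.1.imK}
  one_mem' := ⟨⟨1, 0, by simp⟩, ⟨0, 0, by simp⟩, ⟨0, 0, by simp⟩, ⟨0, 0, by simp⟩⟩
  mul_mem' := by
    rintro a b ⟨a0, a1, a2, a3⟩ ⟨b0, b1, b2, b3⟩
    change InSqrtFive (a.1 * b.1).re ∧ InSqrtFive (a.1 * b.1).imI ∧ InSqrtFive (a.1 * b.1).imJ ∧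
      InSqrtFive (a.1 * b.1).imK
    rw [Quaternion.re_mul, Quaternion.imI_mul, Quaternion.imJ_mul, Quaternion.imK_mul]
    exact ⟨(((a0.mul b0).sub (a1.mul b1)).sub (a2.mul b2)).sub (a3.mul b3),
      (((a0.mul b1).add (a1.mul b0)).add (a2.mul b3)).sub (a3.mul b2),
      (((a0.mul b2).sub (a1.mul b3)).add (a2.mul b0)).add (a3.mul b1),
      (((a0.mul b3).add (a1.mul b2)).sub (a2.mul b1)).add (a3.mul b0)⟩
  inv_mem' := by
    rintro a ⟨a0, a1, a2, a3⟩
    change InSqrtFive (star a.1).re ∧ InSqrtFive (star a.1).imI ∧ InSqrtFive (star a.1).imJ ∧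
      InSqrtFive (star a.1).imK
    rw [Quaternion.re_star, Quaternion.imI_star, Quaternion.imJ_star, Quaternion.imK_star]
    exact ⟨a0, a1.neg, a2.neg, a3.neg⟩

theorem icosahedral_le_sqrtFiveGroup : binaryIcosahedral ≤ sqrtFiveGroup := by
  have h1 : ∀ c : ℚ, InSqrtFive c := fun c => ⟨c, 0, by simp⟩
  have h2 : ∀ a b : ℚ, InSqrtFive (a + b * √5) := fun a b => ⟨a, b, rfl⟩
  refine (Subgroup.closure_le _).mpr ?_
  rintro x (rfl | rfl | rfl)
  · exact ⟨⟨0, 0, by simp [A1, unitQuat, quat]⟩, ⟨1, 0, by simp [A1, unitQuat, quat]⟩,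
      ⟨0, 0, by simp [A1, unitQuat, quat]⟩, ⟨0, 0, by simp [A1, unitQuat, quat]⟩⟩
  · exact ⟨⟨1 / 2, 0, by simp [S, unitQuat, quat]⟩, ⟨1 / 2, 0, by simp [S, unitQuat, quat]⟩,
      ⟨-1 / 2, 0, by simp [S, unitQuat, quat]⟩, ⟨1 / 2, 0, by simp [S, unitQuat, quat]⟩⟩
  · exact ⟨⟨1 / 4, 1 / 4, by simp [U, unitQuat, quat, tau]; ring⟩,
      ⟨0, 0, by simp [U, unitQuat, quat]⟩,
      ⟨-1 / 4, 1 / 4, by simp [U, unitQuat, quat, tau]; ring⟩,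
      ⟨1 / 2, 0, by simp [U, unitQuat, quat]⟩⟩

theorem re_sq_of_sq (a : UnitQuaternions) : (a * a).1.re = 2 * a.1.re ^ 2 - 1 := by
  change (a.1 * a.1).re = _
  rw [Quaternion.re_mul]
  linear_combination -sq_sum_of_mem a

/-- The binary icosahedral group has no elements of order eight. -/
theorem pow_four_ne_neg_one {a : UnitQuaternions} (ha : a ∈ binaryIcosahedral) : a ^ 4 ≠ -1 := by
  intro h
  have h1 : ((a * a) * (a * a)).1.re = -1 := by
    rw [show (a * a) * (a * a) = a ^ 4 by simp only [pow_succ, pow_zero, one_mul, mul_assoc], h]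
    rfl
  rw [re_sq_of_sq, re_sq_of_sq] at h1
  have h2 : (2 * a.1.re ^ 2 - 1) = 0 := by
    apply pow_eq_zero_iff (n := 2) (by norm_num) |>.mp
    linarith
  exact (icosahedral_le_sqrtFiveGroup ha).1.two_mul_sq_ne_one (by linarith)

theorem coe_U_sq : (U * U).1 = quat ((tau - 1) / 2) 0 (1 / 2) (tau / 2) := by
  have h := tau_sq
  change U.1 * U.1 = _
  rw [U, coe_unitQuat, quat_mul, quat_inj]
  generalize tau = t at *
  refine ⟨?_, ?_, ?_, ?_⟩ <;> grind

theorem coe_U_pow_three : (U * U * U).1 = quat ((1 - tau) / 2) 0 (1 / 2) (tau / 2) := by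
  have h := tau_sq
  change (U * U).1 * U.1 = _
  rw [coe_U_sq, U, coe_unitQuat, quat_mul, quat_inj]
  generalize tau = t at *
  refine ⟨?_, ?_, ?_, ?_⟩ <;> grind

theorem coe_S_sq : (S * S).1 = quat (-1 / 2) (1 / 2) (-1 / 2) (1 / 2) := by
  change S.1 * S.1 = _
  rw [S, coe_unitQuat, quat_mul, quat_inj]
  norm_num

theorem U_pow_five : U * U * U * (U * U) = -1 := by
  have h := tau_sq
  apply Subtype.ext
  change (U * U * U).1 * (U * U).1 = -1
  rw [coe_U_pow_three, coe_U_sq, quat_mul, show (-1 : ℍ[ℝ]) = quat (-1) 0 0 0 by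
    ext <;> simp [quat], quat_inj]
  generalize tau = t at *
  refine ⟨?_, ?_, ?_, ?_⟩ <;> grind

theorem A1_mul_U : A1 * U = U⁻¹ * A1 := by
  rw [A1, U, unitQuat_inv, unitQuat_mul, unitQuat_mul]
  apply unitQuat_congr <;> ring

/-- Left multiplication by `S` permutes the cosets of the binary tetrahedral group represented by
the powers of `U`; this is the coset of `U`. -/
theorem S_mul_U : S * U = U * -(K1 * (S * S)) := by
  have h := tau_sq
  apply Subtype.ext
  change S.1 * U.1 = U.1 * -(K1.1 * (S * S).1)
  rw [coe_S_sq, S, U, K1, coe_unitQuat, coe_unitQuat, coe_unitQuat, quat_mul, quat_mul, quat_neg,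
    quat_mul, quat_inj]
  generalize tau = t at *
  refine ⟨?_, ?_, ?_, ?_⟩ <;> grind

theorem S_mul_U_sq : S * (U * U) = U * U * U * -(S * S) := by
  have h := tau_sq
  apply Subtype.ext
  change S.1 * (U * U).1 = (U * U * U).1 * -(S * S).1
  rw [coe_S_sq, coe_U_pow_three, coe_U_sq, S, coe_unitQuat, quat_mul, quat_neg, quat_mul, quat_inj]
  generalize tau = t at *
  refine ⟨?_, ?_, ?_, ?_⟩ <;> grind

theorem S_mul_U_pow_three : S * (U * U * U) = U * U * (U * U) * (J1 * S) := by
  have h := tau_sq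
  apply Subtype.ext
  change S.1 * (U * U * U).1 = (U * U).1 * (U * U).1 * (J1.1 * S.1)
  rw [coe_U_pow_three, coe_U_sq, S, J1, coe_unitQuat, coe_unitQuat, quat_mul, quat_mul, quat_mul,
    quat_mul, quat_inj]
  generalize tau = t at *
  refine ⟨?_, ?_, ?_, ?_⟩ <;> grind

theorem S_mul_U_pow_four : S * (U * U * (U * U)) = U * U * J1 := by
  have h := tau_sq
  apply Subtype.ext
  change S.1 * ((U * U).1 * (U * U).1) = (U * U).1 * J1.1
  rw [coe_U_sq, S, J1, coe_unitQuat, coe_unitQuat, quat_mul, quat_mul,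
    quat_mul, quat_inj]
  generalize tau = t at *
  refine ⟨?_, ?_, ?_, ?_⟩ <;> grind

theorem zpow_five_mul_mem (m : ℤ) : U ^ (5 * m) ∈ binaryTetrahedral := by
  have h : U ^ 5 = -1 := by
    rw [← U_pow_five]
    simp only [pow_succ, pow_zero, one_mul, mul_assoc]
  rw [zpow_mul, show U ^ (5 : ℤ) = -1 from mod_cast h]
  exact Subgroup.zpow_mem _ neg_one_mem m

/-- The cosets of the binary tetrahedral group in the binary icosahedral group are represented by
the powers of `U`. -/
theorem exists_eq_pow_mul {a : UnitQuaternions} (ha : a ∈ binaryIcosahedral) :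
    ∃ j : Fin 5, ∃ t ∈ binaryTetrahedral, a = U ^ (j : ℕ) * t := by
  have hz : ∀ k : ℤ, ∀ t ∈ binaryTetrahedral, ∃ j : Fin 5, ∃ t' ∈ binaryTetrahedral,
      U ^ k * t = U ^ (j : ℕ) * t' := by
    intro k t ht
    have h0 : 0 ≤ k % 5 := Int.emod_nonneg k (by norm_num)
    have h1 : k % 5 < 5 := Int.emod_lt_of_pos k (by norm_num)
    refine ⟨⟨(k % 5).toNat, by omega⟩, U ^ (5 * (k / 5)) * t, mul_mem (zpow_five_mul_mem _) ht, ?_⟩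
    rw [← mul_assoc, ← zpow_natCast, ← zpow_add]
    congr 2
    change k = ((k % 5).toNat : ℤ) + 5 * (k / 5)
    omega
  have hA : ∀ a, (∃ j : Fin 5, ∃ t ∈ binaryTetrahedral, a = U ^ (j : ℕ) * t) →
      ∃ j : Fin 5, ∃ t ∈ binaryTetrahedral, A1 * a = U ^ (j : ℕ) * t := by
    rintro _ ⟨j, t, ht, rfl⟩
    have : A1 * U ^ (j : ℕ) = U ^ (-(j : ℕ) : ℤ) * A1 := by
      rw [zpow_neg, zpow_natCast, ← inv_pow]
      exact (SemiconjBy.pow_right (show SemiconjBy A1 U U⁻¹ from A1_mul_U) j)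
    rw [← mul_assoc, this, mul_assoc]
    exact hz _ _ (mul_mem A1_mem ht)
  have hS : ∀ a, (∃ j : Fin 5, ∃ t ∈ binaryTetrahedral, a = U ^ (j : ℕ) * t) →
      ∃ j : Fin 5, ∃ t ∈ binaryTetrahedral, S * a = U ^ (j : ℕ) * t := by
    rintro _ ⟨j, t, ht, rfl⟩
    have hSS := mul_mem S_mem S_mem
    have e2 : U ^ 2 = U * U := sq U
    have e3 : U ^ 3 = U * U * U := by rw [pow_succ, e2]
    have e4 : U ^ 4 = U * U * (U * U) := by rw [← e2, ← pow_add]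
    fin_cases j
    · exact ⟨0, S * t, mul_mem S_mem ht, by simp⟩
    · refine ⟨1, _, mul_mem (neg_mem_of_le le_rfl (mul_mem K1_mem hSS)) ht, ?_⟩
      simp only [Fin.isValue, Fin.coe_ofNat_eq_mod, Nat.one_mod, pow_one]
      rw [← mul_assoc, S_mul_U, mul_assoc]
    · refine ⟨3, _, mul_mem (neg_mem_of_le le_rfl hSS) ht, ?_⟩
      change S * (U ^ 2 * t) = U ^ 3 * _
      rw [e2, e3, ← mul_assoc, S_mul_U_sq, mul_assoc]
    · refine ⟨4, _, mul_mem (mul_mem J1_mem S_mem) ht, ?_⟩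
      change S * (U ^ 3 * t) = U ^ 4 * _
      rw [e3, e4, ← mul_assoc, S_mul_U_pow_three, mul_assoc]
    · refine ⟨2, _, mul_mem J1_mem ht, ?_⟩
      change S * (U ^ 4 * t) = U ^ 2 * _
      rw [e4, e2, ← mul_assoc, S_mul_U_pow_four, mul_assoc]
  have hneg : ∀ a, (∃ j : Fin 5, ∃ t ∈ binaryTetrahedral, a = U ^ (j : ℕ) * t) →
      ∃ j : Fin 5, ∃ t ∈ binaryTetrahedral, -a = U ^ (j : ℕ) * t := by
    rintro _ ⟨j, t, ht, rfl⟩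
    exact ⟨j, -t, neg_mem_of_le le_rfl ht, (mul_neg _ _).symm⟩
  have hAinv : A1⁻¹ = -A1 := by
    rw [inv_eq_iff_mul_eq_one]
    apply Subtype.ext
    change A1.1 * -A1.1 = 1
    rw [A1, coe_unitQuat, quat_neg, quat_mul, show (1 : ℍ[ℝ]) = quat 1 0 0 0 by
      ext <;> simp [quat], quat_inj]
    norm_num
  have hSinv : S⁻¹ = -(S * S) := by
    rw [inv_eq_iff_mul_eq_one]
    apply Subtype.ext
    change S.1 * -(S * S).1 = 1
    rw [coe_S_sq, S, coe_unitQuat, quat_neg, quat_mul, show (1 : ℍ[ℝ]) = quat 1 0 0 0 by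
      ext <;> simp [quat], quat_inj]
    norm_num
  induction ha using Subgroup.closure_induction_left with
  | one => exact ⟨0, 1, one_mem _, by simp⟩
  | mul_left x hx y _ ih =>
    rcases hx with rfl | rfl | rfl
    · exact hA _ ih
    · exact hS _ ih
    · obtain ⟨j, t, ht, rfl⟩ := ih
      rw [← mul_assoc, ← pow_succ', ← zpow_natCast]
      exact hz _ _ ht
  | inv_mul_cancel x hx y _ ih =>
    rcases hx with rfl | rfl | rfl
    · rw [hAinv, neg_mul]
      exact hneg _ (hA _ ih)
    · rw [hSinv, neg_mul, mul_assoc]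
      exact hneg _ (hS _ (hS _ ih))
    · obtain ⟨j, t, ht, rfl⟩ := ih
      rw [← mul_assoc, ← zpow_neg_one, ← zpow_natCast, ← zpow_add]
      exact hz _ _ ht

theorem card_binaryIcosahedral : Nat.card binaryIcosahedral = 120 := by
  have hfin : Finite binaryTetrahedral :=
    Nat.finite_of_card_ne_zero (by rw [card_binaryTetrahedral]; norm_num)
  let F : Fin 5 × binaryTetrahedral → binaryIcosahedral := fun p =>
    ⟨U ^ (p.1 : ℕ) * p.2.1, mul_mem (pow_mem U_mem _) (tetrahedral_le_icosahedral p.2.2)⟩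
  have hF : Function.Surjective F := by
    intro a
    obtain ⟨j, t, ht, h⟩ := exists_eq_pow_mul a.2
    exact ⟨(j, ⟨t, ht⟩), Subtype.ext h.symm⟩
  have hfin' : Finite binaryIcosahedral := Finite.of_surjective F hF
  have hle : Nat.card binaryIcosahedral ≤ 120 := by
    refine (Nat.card_le_card_of_surjective F hF).trans ?_
    rw [Nat.card_prod, card_binaryTetrahedral, Nat.card_fin]
  -- the order is divisible by 24 and by the order 5 of `U²`
  have h24 : 24 ∣ Nat.card binaryIcosahedral := by
    rw [← card_binaryTetrahedral]
    exact Subgroup.card_dvd_of_le tetrahedral_le_icosahedral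
  have h5 : 5 ∣ Nat.card binaryIcosahedral := by
    have hU : orderOf (U * U) = 5 := by
      have : Fact (Nat.Prime 5) := ⟨by norm_num⟩
      apply orderOf_eq_prime
      · have : (U * U) ^ 5 = (U * U * U * (U * U)) * (U * U * U * (U * U)) := by
          simp only [pow_succ, pow_zero, one_mul, mul_assoc]
        rw [this, U_pow_five, neg_mul_neg, one_mul]
      · intro h
        have h1 : (U * U).1.imJ = 0 := by
          rw [h]
          rfl
        rw [coe_U_sq] at h1
        norm_num [quat] at h1
    rw [← hU]
    exact Subgroup.orderOf_dvd_natCard _ (mul_mem U_mem U_mem)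
  have h120 : 120 ∣ Nat.card binaryIcosahedral :=
    Nat.Coprime.mul_dvd_of_dvd_of_dvd (by norm_num : Nat.Coprime 24 5) h24 h5
  exact le_antisymm hle (Nat.le_of_dvd Nat.card_pos h120)

/-! ### Fix groups of real points -/

theorem neg_one_smul_vec (v : V) : (-1 : GL4) • v = -v := by
  change ((-1 : GL4) : Module.End ℂ V) v = -v
  simp

theorem mem_signs {g : GL4} : g ∈ signs ↔ g = 1 ∨ g = -1 := by
  constructor
  · intro h
    obtain ⟨k, rfl⟩ := Subgroup.mem_zpowers_iff.mp h
    have h2 : (-1 : GL4) ^ (2 : ℤ) = 1 := by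
      rw [zpow_ofNat]
      exact Units.ext (by simp)
    rcases Int.even_or_odd' k with ⟨m, rfl | rfl⟩
    · left
      rw [zpow_mul, h2, one_zpow]
    · right
      rw [zpow_add, zpow_mul, h2, one_zpow, one_mul, zpow_one]
  · rintro (rfl | rfl)
    · exact one_mem _
    · exact Subgroup.mem_zpowers _

/-- The real vector in `ℂ⁴` whose coordinates are those of the quaternion `x`. -/
def realVec (x : ℍ[ℝ]) : V := fun i => (coords x i : ℂ)

theorem rep_smul_realVec (a b : UnitQuaternions) (x : ℍ[ℝ]) :
    rep (a, b) • realVec x = realVec (a.1 * x * star b.1) := rep_smul_coords a b x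

theorem realVec_smul (c : ℝ) (x : ℍ[ℝ]) : realVec (c • x) = (c : ℂ) • realVec x := by
  ext i
  fin_cases i <;> simp [realVec, coords]

theorem realVec_injective {x y : ℍ[ℝ]} (h : realVec x = realVec y) : x = y := by
  have h' : ∀ i, coords x i = coords y i := fun i => Complex.ofReal_injective (congrFun h i)
  apply Quaternion.ext
  exacts [h' 0, h' 1, h' 2, h' 3]

theorem realVec_ne_zero {x : ℍ[ℝ]} (hx : x ≠ 0) : realVec x ≠ 0 := by
  intro h
  apply hx
  apply realVec_injective
  rw [h]
  ext i
  fin_cases i <;> simp [realVec, coords]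

theorem mul_star_of_unit (b : UnitQuaternions) : b.1 * star b.1 = 1 := b.2.2

theorem star_mul_of_unit (b : UnitQuaternions) : star b.1 * b.1 = 1 := b.2.1

theorem conj_eq_iff {a b : UnitQuaternions} {x y : ℍ[ℝ]} :
    a.1 * x * star b.1 = y ↔ a.1 * x = y * b.1 := by
  constructor
  · rintro rfl
    rw [mul_assoc, star_mul_of_unit, mul_one]
  · intro h
    rw [h, mul_assoc, mul_star_of_unit, mul_one]

/-- Two elements of `GL(4, ℂ)` which agree on real vectors are equal. -/
theorem gl_ext_realVec {g h : GL4} (H : ∀ x, g • realVec x = h • realVec x) : g = h := by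
  apply Units.ext
  refine LinearMap.pi_ext' fun k => LinearMap.ext_ring ?_
  have hi : ∀ i : Fin 4, ∃ x, realVec x = Pi.single i 1 := by
    intro i
    refine ⟨quat (if i = 0 then 1 else 0) (if i = 1 then 1 else 0) (if i = 2 then 1 else 0)
      (if i = 3 then 1 else 0), ?_⟩
    ext j
    fin_cases i <;> fin_cases j <;> simp [realVec, coords, quat]
  obtain ⟨x, hx⟩ := hi k
  have := H x
  rw [hx] at this
  exact this

theorem realVec_neg (x : ℍ[ℝ]) : realVec (-x) = -realVec x := by
  ext i
  fin_cases i <;> simp [realVec, coords]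

theorem rep_neg_left (a b : UnitQuaternions) : rep (-a, b) = -rep (a, b) := by
  apply gl_ext_realVec
  intro x
  rw [rep_smul_realVec]
  change _ = -(rep (a, b) • realVec x)
  rw [rep_smul_realVec, ← realVec_neg]
  congr 1
  change -a.1 * x * star b.1 = _
  rw [neg_mul, neg_mul]

theorem eq_one_or_of_commute {b : UnitQuaternions} (h : ∀ x : ℍ[ℝ], b.1 * x = x * b.1) :
    b = 1 ∨ b = -1 :=
  eq_one_or_of_permutes_one fun _ => Or.inl (h _)

/-- A pair acting as `±1` has central components; only the second one is needed. -/
theorem rep_mem_signs {a b : UnitQuaternions} (h : rep (a, b) ∈ signs) : b = 1 ∨ b = -1 := by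
  apply eq_one_or_of_commute
  rcases mem_signs.mp h with h | h
  · have h1 : ∀ x : ℍ[ℝ], a.1 * x = x * b.1 := by
      intro x
      rw [← conj_eq_iff]
      apply realVec_injective
      rw [← rep_smul_realVec, h, one_smul]
    have hab := h1 1
    rw [mul_one, one_mul] at hab
    rw [← hab]
    rwa [← hab] at h1
  · have h1 : ∀ x : ℍ[ℝ], a.1 * x = -x * b.1 := by
      intro x
      rw [← conj_eq_iff]
      apply realVec_injective
      rw [← rep_smul_realVec, h, neg_one_smul_vec, realVec_neg]
    have hab := h1 1
    rw [mul_one, neg_one_mul] at hab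
    intro x
    have := h1 x
    rw [hab, neg_mul, neg_mul] at this
    exact neg_injective this

/-- The pairs `(a, b)` with `a x b⁻¹ = x`. -/
def pairStabilizer (x : ℍ[ℝ]) : Subgroup (UnitQuaternions × UnitQuaternions) where
  carrier := {p | p.1 ∈ binaryIcosahedral ∧ p.2 ∈ binaryOctahedral ∧ p.1.1 * x = x * p.2.1}
  one_mem' := ⟨one_mem _, one_mem _, by simp⟩
  mul_mem' := by
    rintro ⟨a, b⟩ ⟨a', b'⟩ ⟨h1, h2, h3⟩ ⟨h1', h2', h3'⟩
    refine ⟨mul_mem h1 h1', mul_mem h2 h2', ?_⟩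
    change a.1 * a'.1 * x = x * (b.1 * b'.1)
    dsimp only at h3 h3'
    rw [mul_assoc, h3', ← mul_assoc, h3, mul_assoc]
  inv_mem' := by
    rintro ⟨a, b⟩ ⟨h1, h2, h3⟩
    refine ⟨inv_mem h1, inv_mem h2, ?_⟩
    change star a.1 * x = x * star b.1
    dsimp only at h3
    calc star a.1 * x = star a.1 * (x * b.1) * star b.1 := by
          rw [mul_assoc, mul_assoc, mul_star_of_unit, mul_one]
      _ = x * star b.1 := by rw [← h3, ← mul_assoc, star_mul_of_unit, one_mul]

theorem normSq_of_unit (a : UnitQuaternions) : Quaternion.normSq a.1 = 1 :=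
  (mem_unitary_iff_normSq a.1).mp a.2

/-- A pair fixing the projective point of `x` fixes `x` up to a sign, which can be absorbed in
`a`. -/
theorem eq_or_neg_of_unit_smul {a b : UnitQuaternions} {x : ℍ[ℝ]} (hx : x ≠ 0) {c : ℂ}
    (h : rep (a, b) • realVec x = c • realVec x) : a.1 * x = x * b.1 ∨ (-a).1 * x = x * b.1 := by
  rw [rep_smul_realVec] at h
  -- the factor is real, since both vectors are, and of absolute value `1`, since norms agree
  have hc : ∃ r : ℝ, (r : ℂ) = c := by
    obtain ⟨i, hi⟩ := Function.ne_iff.mp (realVec_ne_zero hx)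
    have := congrFun h i
    refine ⟨coords (a.1 * x * star b.1) i / coords x i, ?_⟩
    rw [Complex.ofReal_div]
    exact (div_eq_iff (show (coords x i : ℂ) ≠ 0 from hi)).mpr this
  obtain ⟨r, rfl⟩ := hc
  rw [← realVec_smul] at h
  have h1 := realVec_injective h
  have h2 := congrArg Quaternion.normSq h1
  rw [map_mul, map_mul, Quaternion.normSq_star, normSq_of_unit, normSq_of_unit,
    Quaternion.normSq_smul, one_mul, mul_one] at h2
  have h3 : r ^ 2 = 1 :=
    mul_right_cancel₀ (Quaternion.normSq_ne_zero.mpr hx) (by rw [← h2, one_mul])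
  rcases sq_eq_sq_iff_eq_or_eq_neg.mp (h3.trans (one_pow 2).symm) with rfl | rfl
  · left
    rw [← conj_eq_iff, h1, one_smul]
  · right
    change -a.1 * x = _
    rw [neg_mul, show a.1 * x = -x * b.1 by rw [← conj_eq_iff, h1, neg_one_smul], neg_mul, neg_neg]

theorem mem_fixGroup_iff {x : ℍ[ℝ]} (hx : x ≠ 0) {g : GL4} :
    g ∈ fixGroup (Projectivization.mk ℂ (realVec x) (realVec_ne_zero hx)) ↔
      g ∈ icosaOcta ∧ ∃ c : ℂ, g • realVec x = c • realVec x := by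
  rw [fixGroup, Subgroup.mem_inf, MulAction.mem_stabilizer_iff, Projectivization.smul_mk,
    Projectivization.mk_eq_mk_iff']
  simp only [eq_comm]

/-- The homomorphism from the pairs `(a, b)` with `a x b⁻¹ = x` to the fix group modulo signs of
the point of projective space given by `x`. -/
def pairToFix {x : ℍ[ℝ]} (hx : x ≠ 0) : pairStabilizer x →*
    FixGroupModSigns (Projectivization.mk ℂ (realVec x) (realVec_ne_zero hx)) :=
  (QuotientGroup.mk' _).comp ((rep.comp (pairStabilizer x).subtype).codRestrict (fixGroup _)
    fun p => (mem_fixGroup_iff hx).mpr ⟨rep_mem p.2.1 p.2.2.1, 1, by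
      rw [one_smul]
      refine (rep_smul_realVec p.1.1 p.1.2 x).trans ?_
      rw [conj_eq_iff.mpr p.2.2.2]⟩)

theorem pairToFix_eq_one_iff {x : ℍ[ℝ]} (hx : x ≠ 0) (p : pairStabilizer x) :
    pairToFix hx p = 1 ↔ rep p.1 ∈ signs :=
  QuotientGroup.eq_one_iff (N := signs.subgroupOf (fixGroup _)) _

theorem pairToFix_surjective {x : ℍ[ℝ]} (hx : x ≠ 0) : Function.Surjective (pairToFix hx) := by
  intro g
  obtain ⟨⟨g, hg⟩, rfl⟩ := QuotientGroup.mk'_surjective _ g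
  obtain ⟨⟨⟨a, b⟩, hab, rfl⟩, c, hc⟩ := (mem_fixGroup_iff hx).mp hg
  obtain ⟨ha, hb⟩ := Subgroup.mem_prod.mp hab
  rcases eq_or_neg_of_unit_smul hx hc with h | h
  · exact ⟨⟨(a, b), ha, hb, h⟩, rfl⟩
  · refine ⟨⟨(-a, b), neg_mem_of_le tetrahedral_le_icosahedral ha, hb, h⟩, ?_⟩
    refine QuotientGroup.eq.mpr ?_
    change (rep (-a, b))⁻¹ * rep (a, b) ∈ signs
    rw [← map_inv, ← map_mul]
    have : ((-a, b)⁻¹ * (a, b) : UnitQuaternions × UnitQuaternions) = (-1, 1) := by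
      rw [Prod.inv_mk, Prod.mk_mul_mk, inv_mul_cancel]
      refine Prod.ext ?_ rfl
      change (-a)⁻¹ * a = -1
      rw [inv_mul_eq_iff_eq_mul, neg_mul_neg, mul_one]
    rw [this, rep_neg_left, mem_signs,
      show ((1 : UnitQuaternions), (1 : UnitQuaternions)) = 1 from rfl, map_one]
    exact Or.inr rfl

/-- The action of the pairs `(a, b)` with `a x b⁻¹ = x` on the diagonals of the cube,
through `b`. -/
def pairPerm (x : ℍ[ℝ]) : pairStabilizer x →* Equiv.Perm (Fin 4) :=
  diagPerm.comp (((MonoidHom.snd _ _).comp (pairStabilizer x).subtype).codRestrict cubeGroup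
    fun p => octahedral_le_cubeGroup p.2.2.1)

theorem permutes_pairPerm {x : ℍ[ℝ]} (p : pairStabilizer x) : Permutes p.1.2 (pairPerm x p) :=
  permutes_diagPerm ⟨p.1.2, octahedral_le_cubeGroup p.2.2.1⟩

theorem pairPerm_eq_one_iff {x : ℍ[ℝ]} (p : pairStabilizer x) :
    pairPerm x p = 1 ↔ p.1.2 = 1 ∨ p.1.2 = -1 := by
  constructor
  · intro h
    have := permutes_pairPerm p
    rw [h] at this
    exact eq_one_or_of_permutes_one this
  · intro h
    refine (permutes_pairPerm p).unique ?_
    rcases h with h | h <;> rw [h]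
    · exact Permutes.one
    · exact permutes_neg Permutes.one

theorem rep_mem_signs_iff {x : ℍ[ℝ]} (hx : x ≠ 0) {a b : UnitQuaternions}
    (h : a.1 * x = x * b.1) : rep (a, b) ∈ signs ↔ b = 1 ∨ b = -1 := by
  refine ⟨rep_mem_signs, fun hb => ?_⟩
  have hc : ∀ y : ℍ[ℝ], b.1 * y = y * b.1 := by
    intro y
    rcases hb with hb | hb <;> rw [hb]
    · change 1 * y = y * 1
      rw [one_mul, mul_one]
    · change -1 * y = y * -1
      rw [neg_one_mul, mul_neg_one]
  have hab : a.1 = b.1 := mul_right_cancel₀ hx (h.trans (hc x).symm)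
  have : rep (a, b) = 1 := by
    apply gl_ext_realVec
    intro y
    rw [rep_smul_realVec, one_smul, conj_eq_iff.mpr (show a.1 * y = y * b.1 by rw [hab, hc y])]
  rw [this]
  exact one_mem _

theorem ker_pairToFix {x : ℍ[ℝ]} (hx : x ≠ 0) : (pairToFix hx).ker = (pairPerm x).ker := by
  ext p
  rw [MonoidHom.mem_ker, MonoidHom.mem_ker, pairToFix_eq_one_iff, pairPerm_eq_one_iff]
  exact rep_mem_signs_iff hx p.2.2.2

/-- Modulo signs, the fix group of a real point acts faithfully on the diagonals of the cube. -/
theorem nonempty_fixGroupModSigns_equiv {x : ℍ[ℝ]} (hx : x ≠ 0) : Nonempty (FixGroupModSigns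
    (Projectivization.mk ℂ (realVec x) (realVec_ne_zero hx)) ≃* (pairPerm x).range) :=
  ⟨(QuotientGroup.quotientKerEquivOfSurjective _ (pairToFix_surjective hx)).symm.trans
    ((QuotientGroup.quotientMulEquivOfEq (ker_pairToFix hx)).trans
      (QuotientGroup.quotientKerEquivRange _))⟩

theorem mem_range_pairPerm {x : ℍ[ℝ]} {a b : UnitQuaternions} {σ : Equiv.Perm (Fin 4)}
    (ha : a ∈ binaryIcosahedral) (hb : b ∈ binaryOctahedral) (h : a.1 * x = x * b.1)
    (hσ : Permutes b σ) : σ ∈ (pairPerm x).range :=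
  ⟨⟨(a, b), ha, hb, h⟩, diagPerm_eq hσ⟩

theorem pow_comm_of_comm {a b : UnitQuaternions} {x : ℍ[ℝ]} (h : a.1 * x = x * b.1) (n : ℕ) :
    (a ^ n).1 * x = x * (b ^ n).1 := by
  induction n with
  | zero => simp
  | succ n ih =>
    rw [pow_succ, pow_succ']
    change (a ^ n).1 * a.1 * x = x * (b.1 * (b ^ n).1)
    rw [mul_assoc, h, ← mul_assoc, ih, mul_assoc]
    congr 1
    exact congrArg Subtype.val ((Commute.refl b).pow_left n)

/-- The fix group of a real point contains no permutation of order four of the diagonals: it would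
come from `b` with `b⁴ = -1`, conjugate to an element of the binary icosahedral group, which has
no element of order eight. -/
theorem sq_eq_one_of_mem_range {x : ℍ[ℝ]} (hx : x ≠ 0) {σ : Equiv.Perm (Fin 4)}
    (hσ : σ ∈ (pairPerm x).range) (h4 : σ ^ 4 = 1) : σ ^ 2 = 1 := by
  obtain ⟨⟨⟨a, b⟩, ha, hb, h⟩, hp⟩ := hσ
  replace hp : Permutes b σ := by
    rw [← hp]
    exact permutes_pairPerm ⟨(a, b), ha, hb, h⟩
  dsimp only at ha hb h
  have hpow : ∀ n : ℕ, Permutes (b ^ n) (σ ^ n) := by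
    intro n
    induction n with
    | zero => exact Permutes.one
    | succ n ih => exact (pow_succ b n) ▸ (pow_succ σ n) ▸ ih.mul hp
  have h4' := hpow 4
  rw [h4] at h4'
  rcases eq_one_or_of_permutes_one h4' with h5 | h5
  · have h6 : b ^ 2 = 1 ∨ b ^ 2 = -1 := by
      have : ((b ^ 2).1 - 1) * ((b ^ 2).1 + 1) = 0 := by
        have h7 : (b ^ 2).1 * (b ^ 2).1 = 1 := by
          rw [← sq]
          change ((b ^ 2) ^ 2).1 = 1
          rw [← pow_mul, h5]
          rfl
        rw [sub_mul, mul_add, h7, mul_one, one_mul, add_comm, sub_self]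
      rcases mul_eq_zero.mp this with h | h
      · exact Or.inl (Subtype.ext (sub_eq_zero.mp h))
      · exact Or.inr (Subtype.ext (eq_neg_of_add_eq_zero_left h))
    rcases h6 with h6 | h6
    · exact (hpow 2).unique (h6 ▸ Permutes.one)
    · exact (hpow 2).unique (h6 ▸ permutes_neg Permutes.one)
  · exfalso
    apply pow_four_ne_neg_one ha
    apply Subtype.ext
    apply mul_right_cancel₀ hx
    rw [pow_comm_of_comm h, h5]
    change x * -1 = -1 * x
    rw [neg_one_mul, mul_neg_one]

/-- A group of permutations realised by the fix group is all of its image, if every larger group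
contains a permutation of order four. -/
theorem range_pairPerm_eq {x : ℍ[ℝ]} (hx : x ≠ 0) {R : Subgroup (Equiv.Perm (Fin 4))}
    (hR : R ≤ (pairPerm x).range)
    (hmax : ∀ σ ∉ R, ∃ r ∈ R, (σ * r) ^ 4 = 1 ∧ (σ * r) ^ 2 ≠ 1) : (pairPerm x).range = R := by
  refine le_antisymm (fun σ hσ => ?_) hR
  by_contra h
  obtain ⟨r, hr, h4, h2⟩ := hmax σ h
  exact h2 (sq_eq_one_of_mem_range hx (mul_mem hσ (hR hr)) h4)

/-! ### The fix groups of the nodes -/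

set_option maxRecDepth 10000 in
open Equiv in
theorem range_pairPerm_one : (pairPerm (quat 1 0 0 0)).range = alternatingGroup (Fin 4) := by
  have hx : quat 1 0 0 0 ≠ 0 := by
    intro h
    exact one_ne_zero (congrArg (fun x : ℍ[ℝ] => x.re) h)
  have hone : quat 1 0 0 0 = 1 := rfl
  refine range_pairPerm_eq hx (alternating_le_closure.trans ((Subgroup.closure_le _).mpr ?_)) ?_
  · rintro σ (rfl | rfl)
    · exact mem_range_pairPerm (tetrahedral_le_icosahedral A1_mem)
        (tetrahedral_le_octahedral A1_mem) (by rw [hone, mul_one, one_mul]) permutes_A1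
    · exact mem_range_pairPerm (tetrahedral_le_icosahedral S_mem)
        (tetrahedral_le_octahedral S_mem) (by rw [hone, mul_one, one_mul]) permutes_S
  · have : ∀ σ : Perm (Fin 4), Perm.sign σ ≠ 1 →
        ∃ r, Perm.sign r = 1 ∧ (σ * r) ^ 4 = 1 ∧ (σ * r) ^ 2 ≠ 1 := by
      decide
    intro σ hσ
    obtain ⟨r, hr, h⟩ := this σ fun h => hσ (Perm.mem_alternatingGroup.mpr h)
    exact ⟨r, Perm.mem_alternatingGroup.mpr hr, h⟩

open Equiv in
/-- The Klein four-group as the group generated by two disjoint transpositions. -/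
def kleinHom : Multiplicative (ZMod 2) × Multiplicative (ZMod 2) →* Perm (Fin 4) where
  toFun z := swap 0 1 ^ z.1.toAdd.val * swap 2 3 ^ z.2.toAdd.val
  map_one' := by decide
  map_mul' := by decide

theorem kleinHom_injective : Function.Injective kleinHom := by
  decide

open Equiv in
/-- The dihedral group of order six as the stabilizer of a diagonal. -/
def dihedralHom : DihedralGroup 3 →* Perm (Fin 4) where
  toFun
    | .r i => (swap 0 3 * swap 3 1) ^ i.val
    | .sr i => swap 1 3 * (swap 0 3 * swap 3 1) ^ i.val
  map_one' := by decide
  map_mul' := by decide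

theorem dihedralHom_injective : Function.Injective dihedralHom := by
  decide

theorem octahedral_R4_J1_mem : R4 * J1 ∈ binaryOctahedral :=
  mul_mem R4_mem (tetrahedral_le_octahedral J1_mem)

theorem coe_R4 : R4.1 = quat (√2 / 2) (√2 / 2) 0 0 := by
  rw [R4, coe_unitQuat, Real.cos_pi_div_four, Real.sin_pi_div_four]

theorem coe_R4_J1 : (R4 * J1).1 = quat 0 0 (√2 / 2) (√2 / 2) := by
  change R4.1 * J1.1 = _
  rw [coe_R4, J1, coe_unitQuat, quat_mul]
  simp

open Equiv in
theorem permutes_R4_J1 : Permutes (R4 * J1) (swap 0 1) := by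
  intro i
  have h : ∀ i : Fin 4, (swap 0 1 : Perm (Fin 4)) i = ![1, 0, 2, 3] i := by decide
  rw [h, coe_R4_J1]
  fin_cases i <;> simp [diagonal, quat_mul, quat_neg, quat_inj] <;> ring_nf <;> simp

set_option maxRecDepth 10000 in
open Equiv in
theorem range_pairPerm_two : (pairPerm (quat (1 + √2) 1 0 0)).range = kleinHom.range := by
  have hx : quat (1 + √2) 1 0 0 ≠ 0 := by
    intro h
    exact one_ne_zero (congrArg (fun x : ℍ[ℝ] => x.imI) h)
  have h2 : √2 ^ 2 = 2 := Real.sq_sqrt (by norm_num)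
  have g1 : (swap 0 1 * swap 2 3 : Perm (Fin 4)) ∈ (pairPerm (quat (1 + √2) 1 0 0)).range := by
    refine mem_range_pairPerm (tetrahedral_le_icosahedral A1_mem)
      (tetrahedral_le_octahedral A1_mem) ?_ permutes_A1
    rw [A1, coe_unitQuat, quat_mul, quat_mul, quat_inj]
    refine ⟨?_, ?_, ?_, ?_⟩ <;> ring
  have g2 : (swap 0 1 : Perm (Fin 4)) ∈ (pairPerm (quat (1 + √2) 1 0 0)).range := by
    refine mem_range_pairPerm (tetrahedral_le_icosahedral K1_mem) octahedral_R4_J1_mem ?_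
      permutes_R4_J1
    rw [coe_R4_J1, K1, coe_unitQuat, quat_mul, quat_mul, quat_inj]
    refine ⟨?_, ?_, ?_, ?_⟩ <;> grind
  refine range_pairPerm_eq hx ?_ ?_
  · rintro σ ⟨z, rfl⟩
    have g3 : (swap 2 3 : Perm (Fin 4)) ∈ (pairPerm (quat (1 + √2) 1 0 0)).range :=
      (Subgroup.mul_mem_cancel_left _ g2).mp g1
    exact mul_mem (pow_mem g2 _) (pow_mem g3 _)
  · have : ∀ σ : Perm (Fin 4), (∀ z, kleinHom z ≠ σ) →
        ∃ z, (σ * kleinHom z) ^ 4 = 1 ∧ (σ * kleinHom z) ^ 2 ≠ 1 := by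
      decide
    intro σ hσ
    obtain ⟨z, hz⟩ := this σ fun z h => hσ ⟨z, h⟩
    exact ⟨_, ⟨z, rfl⟩, hz⟩

theorem coe_R4_J1_S_S : (R4 * (J1 * S * S)).1 = quat 0 (√2 / 2) 0 (-√2 / 2) := by
  change R4.1 * (J1.1 * S.1 * S.1) = _
  rw [coe_R4, J1, S, coe_unitQuat, coe_unitQuat, quat_mul, quat_mul, quat_mul, quat_inj]
  refine ⟨?_, ?_, ?_, ?_⟩ <;> ring

open Equiv in
theorem permutes_R4_J1_S_S : Permutes (R4 * (J1 * S * S)) (swap 1 3) := by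
  intro i
  have h : ∀ i : Fin 4, (swap 1 3 : Perm (Fin 4)) i = ![0, 3, 2, 1] i := by decide
  rw [h, coe_R4_J1_S_S]
  fin_cases i <;> simp [diagonal, quat_mul, quat_neg, quat_inj] <;> ring_nf <;> simp

theorem coe_U_A1 : (U * A1).1 = quat 0 (tau / 2) (1 / 2) (-(tau - 1) / 2) := by
  change U.1 * A1.1 = _
  rw [U, A1, coe_unitQuat, coe_unitQuat, quat_mul, quat_inj]
  refine ⟨?_, ?_, ?_, ?_⟩ <;> ring

set_option maxRecDepth 10000 in
open Equiv in
theorem range_pairPerm_pe {e : ℝ} (he : e = √2 ∨ e = -√2) :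
    (pairPerm (quat (2 * e + √5) 1 (-1) 1)).range = dihedralHom.range := by
  have hx : quat (2 * e + √5) 1 (-1) 1 ≠ 0 := by
    intro h
    exact one_ne_zero (congrArg (fun x : ℍ[ℝ] => x.imI) h)
  have h2 : √2 ^ 2 = 2 := Real.sq_sqrt (by norm_num)
  have h5 : √5 ^ 2 = 5 := Real.sq_sqrt (by norm_num)
  have g1 : (swap 0 3 * swap 3 1 : Perm (Fin 4)) ∈
      (pairPerm (quat (2 * e + √5) 1 (-1) 1)).range := by
    refine mem_range_pairPerm (tetrahedral_le_icosahedral S_mem)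
      (tetrahedral_le_octahedral S_mem) ?_ permutes_S
    rw [S, coe_unitQuat, quat_mul, quat_mul, quat_inj]
    refine ⟨?_, ?_, ?_, ?_⟩ <;> ring
  have hb : R4 * (J1 * S * S) ∈ binaryOctahedral := mul_mem R4_mem
    (tetrahedral_le_octahedral (mul_mem (mul_mem J1_mem S_mem) S_mem))
  have ha : U * A1 ∈ binaryIcosahedral := mul_mem U_mem (tetrahedral_le_icosahedral A1_mem)
  have g2 : (swap 1 3 : Perm (Fin 4)) ∈ (pairPerm (quat (2 * e + √5) 1 (-1) 1)).range := by
    rcases he with rfl | rfl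
    · refine mem_range_pairPerm ha hb ?_ permutes_R4_J1_S_S
      rw [coe_R4_J1_S_S, coe_U_A1, quat_mul, quat_mul, quat_inj, tau]
      generalize √2 = e, √5 = s at *
      refine ⟨?_, ?_, ?_, ?_⟩ <;> grind
    · refine mem_range_pairPerm (neg_mem_of_le tetrahedral_le_icosahedral ha) hb ?_
        permutes_R4_J1_S_S
      change -(U * A1).1 * _ = _
      rw [coe_R4_J1_S_S, coe_U_A1, quat_neg, quat_mul, quat_mul, quat_inj, tau]
      generalize √2 = e, √5 = s at *
      refine ⟨?_, ?_, ?_, ?_⟩ <;> grind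
  refine range_pairPerm_eq hx ?_ ?_
  · rintro σ ⟨i | i, rfl⟩
    · exact pow_mem g1 _
    · exact mul_mem g2 (pow_mem g1 _)
  · have : ∀ σ : Perm (Fin 4), (∀ z, dihedralHom z ≠ σ) →
        ∃ z, (σ * dihedralHom z) ^ 4 = 1 ∧ (σ * dihedralHom z) ^ 2 ≠ 1 := by
      decide
    intro σ hσ
    obtain ⟨z, hz⟩ := this σ fun z h => hσ ⟨z, h⟩
    exact ⟨_, ⟨z, rfl⟩, hz⟩

/-! ### Orders and orbit lengths -/

theorem card_eq_two_of_mem_iff {G : Type*} [Group G] {K : Subgroup G} {z : G} (hz : z ≠ 1)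
    (h : ∀ g, g ∈ K ↔ g = 1 ∨ g = z) : Nat.card K = 2 := by
  rw [Nat.card_eq_two_iff]
  refine ⟨1, ⟨z, (h z).mpr (Or.inr rfl)⟩, fun h1 => hz (congrArg Subtype.val h1).symm, ?_⟩
  ext ⟨g, hg⟩
  simp only [Set.mem_insert_iff, Set.mem_singleton_iff, Set.mem_univ, iff_true]
  exact ((h g).mp hg).imp (fun h => Subtype.ext h) fun h => Subtype.ext h

theorem eq_and_eq_one_or_of_rep_eq_one {a b : UnitQuaternions} (h : rep (a, b) = 1) :
    a = b ∧ (b = 1 ∨ b = -1) := by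
  refine ⟨?_, rep_mem_signs (a := a) (h ▸ one_mem _)⟩
  have h1 : a.1 * 1 = 1 * b.1 := by
    rw [← conj_eq_iff]
    apply realVec_injective
    rw [← rep_smul_realVec, h, one_smul]
  rw [mul_one, one_mul] at h1
  exact Subtype.ext h1

theorem rep_neg_one : rep (-1, -1) = 1 := by
  apply gl_ext_realVec
  intro x
  rw [rep_smul_realVec, one_smul]
  congr 1
  rw [conj_eq_iff]
  change -1 * x = x * -1
  rw [neg_one_mul, mul_neg_one]

theorem card_icosaOcta : Nat.card icosaOcta = 2880 := by
  set F := rep.domRestrict (binaryIcosahedral.prod binaryOctahedral) with hF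
  have hr : F.range = icosaOcta := MonoidHom.domRestrict_range _ _
  have hz : ((-1, -1) : UnitQuaternions × UnitQuaternions) ∈
      binaryIcosahedral.prod binaryOctahedral := Subgroup.mem_prod.mpr
    ⟨tetrahedral_le_icosahedral neg_one_mem, tetrahedral_le_octahedral neg_one_mem⟩
  have h2 : Nat.card F.ker = 2 := by
    refine card_eq_two_of_mem_iff (z := ⟨(-1, -1), hz⟩) ?_ ?_
    · intro h
      exact neg_one_ne_one (congrArg (fun y => y.1.1) h)
    · rintro ⟨⟨a, b⟩, hab⟩
      rw [MonoidHom.mem_ker]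
      constructor
      · intro h
        obtain ⟨rfl, rfl | rfl⟩ := eq_and_eq_one_or_of_rep_eq_one h
        · exact Or.inl rfl
        · exact Or.inr rfl
      · rintro (h | h) <;> rw [h]
        · exact map_one F
        · exact rep_neg_one
  have h3 := Subgroup.card_eq_card_quotient_mul_card_subgroup F.ker
  rw [h2, Nat.card_congr (QuotientGroup.quotientKerEquivRange F).toEquiv, hr,
    Nat.card_congr (Subgroup.prodEquiv _ _).toEquiv, Nat.card_prod, card_binaryIcosahedral,
    card_binaryOctahedral] at h3
  omega

instance finite_icosaOcta : Finite icosaOcta :=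
  Nat.finite_of_card_ne_zero (by rw [card_icosaOcta]; norm_num)

theorem signs_le_fixGroup (p : ℙ ℂ V) : signs ≤ fixGroup p := by
  refine (Subgroup.zpowers_le (H := fixGroup p)).mpr ⟨?_, ?_⟩
  · have : (-1 : GL4) = rep (-1, 1) := by
      rw [rep_neg_left]
      exact congrArg Neg.neg (map_one rep).symm
    rw [this]
    exact rep_mem (tetrahedral_le_icosahedral neg_one_mem) (one_mem _)
  · change (-1 : GL4) • p = p
    rw [← p.mk_rep, Projectivization.smul_mk, Projectivization.mk_eq_mk_iff']
    exact ⟨-1, by rw [neg_one_smul_vec, neg_one_smul]⟩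

theorem card_signs : Nat.card signs = 2 := by
  refine card_eq_two_of_mem_iff (z := (-1 : GL4)) ?_ fun g => mem_signs
  intro h
  have := neg_one_smul_vec (fun _ => 1)
  rw [h, one_smul] at this
  have := congrFun this 0
  norm_num at this

/-- The orbit-stabilizer theorem, with the fix group taken modulo signs. -/
theorem ncard_orbit_mul {p : ℙ ℂ V} :
    (MulAction.orbit icosaOcta p).ncard * (2 * Nat.card (FixGroupModSigns p)) = 2880 := by
  have h1 : Nat.card (fixGroup p) = Nat.card (FixGroupModSigns p) * 2 := by
    rw [Subgroup.card_eq_card_quotient_mul_card_subgroup (signs.subgroupOf (fixGroup p)),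
      Nat.card_congr (Subgroup.subgroupOfEquivOfLe (signs_le_fixGroup p)).toEquiv, card_signs]
  have h2 : Nat.card (MulAction.stabilizer icosaOcta p) = Nat.card (fixGroup p) :=
    Nat.card_congr
      { toFun := fun g => ⟨g.1.1, g.1.2, g.2⟩
        invFun := fun g => ⟨⟨g.1, g.2.1⟩, g.2.2⟩
        left_inv := fun _ => rfl
        right_inv := fun _ => rfl }
  rw [← MulAction.index_stabilizer, mul_comm 2, ← h1, ← h2, mul_comm, Subgroup.card_mul_index,
    card_icosaOcta]

/-- The fix groups of the points of one orbit are conjugate. -/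
theorem nonempty_fixGroupModSigns_smul {g : GL4} (hg : g ∈ icosaOcta) (p : ℙ ℂ V) :
    Nonempty (FixGroupModSigns p ≃* FixGroupModSigns (g • p)) := by
  have hmem : ∀ h : fixGroup p, g * h.1 * g⁻¹ ∈ fixGroup (g • p) := by
    rintro ⟨h, hh, hp⟩
    refine ⟨icosaOcta.mul_mem (icosaOcta.mul_mem hg hh) (icosaOcta.inv_mem hg), ?_⟩
    change (g * h * g⁻¹) • g • p = g • p
    rw [smul_smul, inv_mul_cancel_right, mul_smul]
    congr 1
  let χ : fixGroup p →* FixGroupModSigns (g • p) := (QuotientGroup.mk' _).comp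
    (((MulAut.conj g).toMonoidHom.comp (fixGroup p).subtype).codRestrict (fixGroup (g • p)) hmem)
  have hs : Function.Surjective χ := by
    intro y
    obtain ⟨⟨h, hh, hp⟩, rfl⟩ := QuotientGroup.mk'_surjective _ y
    refine ⟨⟨g⁻¹ * h * g,
      icosaOcta.mul_mem (icosaOcta.mul_mem (icosaOcta.inv_mem hg) hh) hg, ?_⟩, ?_⟩
    · change (g⁻¹ * h * g) • p = p
      rw [mul_smul, mul_smul, inv_smul_eq_iff]
      exact hp
    · refine congrArg (QuotientGroup.mk' _) (Subtype.ext ?_)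
      change g * (g⁻¹ * h * g) * g⁻¹ = h
      group
  have hk : χ.ker = signs.subgroupOf (fixGroup p) := by
    ext h
    rw [MonoidHom.mem_ker, Subgroup.mem_subgroupOf]
    refine (QuotientGroup.eq_one_iff (N := signs.subgroupOf (fixGroup (g • p))) _).trans ?_
    change g * h.1 * g⁻¹ ∈ signs ↔ h.1 ∈ signs
    refine ⟨fun h1 => ?_, fun h1 => signs_normal.conj_mem _ h1 g⟩
    have := signs_normal.conj_mem _ h1 g⁻¹
    rwa [show g⁻¹ * (g * h.1 * g⁻¹) * g⁻¹⁻¹ = h.1 by group] at this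
  exact ⟨(QuotientGroup.quotientMulEquivOfEq hk).symm.trans
    (QuotientGroup.quotientKerEquivOfSurjective χ hs)⟩

/-! ### Isolated singular points and nodes -/

theorem mem_orbit_iff_sameOrbit {p : ℙ ℂ V} {v : V} (hv : v ≠ 0) :
    p ∈ MulAction.orbit icosaOcta (Projectivization.mk ℂ v hv) ↔ SameOrbit p.rep v := by
  constructor
  · rintro ⟨⟨g, hg⟩, rfl⟩
    change SameOrbit (g • Projectivization.mk ℂ v hv).rep v
    rw [Projectivization.smul_mk]
    obtain ⟨c, hc, h⟩ := rep_mk_eq_smul (g • v) ((smul_ne_zero_iff_ne g).mpr hv)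
    exact ⟨g, hg, c, hc, h⟩
  · rintro ⟨g, hg, c, hc, h⟩
    refine ⟨⟨g, hg⟩, ?_⟩
    change g • Projectivization.mk ℂ v hv = p
    rw [Projectivization.smul_mk, ← p.mk_rep]
    refine ((Projectivization.mk_eq_mk_iff' ℂ _ _ p.rep_nonzero _).mpr ⟨c, h.symm⟩).symm

theorem p0_eq : p0 = realVec (quat 1 0 0 0) := by
  ext i
  fin_cases i <;> simp [p0, realVec, coords, quat]

theorem p2_eq : p2 = realVec (quat (1 + √2) 1 0 0) := by
  ext i
  fin_cases i <;> simp [p2, realVec, coords, quat, s2]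

theorem pe_eq (e : ℝ) : pe e = realVec (quat (2 * e + √5) 1 (-1) 1) := by
  ext i
  fin_cases i <;> simp [pe, realVec, coords, quat, s5]

theorem sqrt_ten : ((√10 : ℝ) : ℂ) = s5 * s2 := by
  rw [s5, s2, ← Complex.ofReal_mul, ← Real.sqrt_mul (by norm_num)]
  norm_num

theorem c1_eq : c1 = -74 / 972 - 4 / 243 * (s5 * -s2) := by
  rw [c1]
  push_cast
  rw [sqrt_ten]
  ring

theorem c2_eq : c2 = -74 / 972 - 4 / 243 * (s5 * s2) := by
  rw [c2]
  push_cast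
  rw [sqrt_ten]

theorem neg_s2_sq : (-s2) ^ 2 = 2 := by rw [neg_sq, s2_sq]

/-- Off the quadric, every singular point of a member of the pencil is a node. -/
theorem nodeAt_of_singAt {lam : ℂ} {v : V} (hq : eval v q ≠ 0) (h : SingAt (pencil lam) v) :
    NodeAt (pencil lam) v := by
  rcases isNodal_of_singAt hq h with ho | ho | ho | ho
  · exact NodeAt.of_sameOrbit (eq_zero_of_eval_p0 (h.of_sameOrbit ho).1 ▸ nodeAt_p0) ho.symm
  · exact NodeAt.of_sameOrbit (eq_of_eval_p2 (h.of_sameOrbit ho).1 ▸ nodeAt_p2) ho.symm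
  · exact NodeAt.of_sameOrbit
      (nodeAt_pe s2_sq (eq_of_eval_pe s2_sq (h.of_sameOrbit ho).1)) ho.symm
  · exact NodeAt.of_sameOrbit
      (nodeAt_pe neg_s2_sq (eq_of_eval_pe neg_s2_sq (h.of_sameOrbit ho).1)) ho.symm

theorem eval_q_ne_zero_of_nodeAt {lam : ℂ} {v : V} (hv : v ≠ 0) (h : NodeAt (pencil lam) v) :
    eval v q ≠ 0 := by
  intro hq
  obtain ⟨w, hw, hl⟩ := exists_line_of_singAt_pencil hv hq h.1
  exact not_nodeAt_of_line hw hl h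

theorem eval_q_ne_zero_of_isIsolated {lam : ℂ} {p : ℙ ℂ V}
    (h : IsIsolatedSingularPoint (pencil lam) p) : eval p.rep q ≠ 0 := by
  intro hq
  obtain ⟨w, hw, hl⟩ := exists_line_of_singAt_pencil p.rep_nonzero hq (isSingularPoint_iff.mp h.1)
  exact not_isIsolated_of_line (isHomogeneous_pencil lam) hw hl h

theorem finite_isNodal : {p : ℙ ℂ V | IsNodal p.rep}.Finite := by
  have hfin : ∀ v : V, {p : ℙ ℂ V | SameOrbit p.rep v}.Finite := by
    intro v
    by_cases hv : v = 0
    · convert Set.finite_empty using 1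
      ext p
      simp only [Set.mem_ofPred_eq, Set.mem_empty_iff_false, iff_false]
      rintro ⟨g, -, c, -, h⟩
      exact p.rep_nonzero (by rw [h, hv, smul_zero, smul_zero])
    · convert Set.finite_range fun g : icosaOcta => g • Projectivization.mk ℂ v hv using 1
      ext p
      exact (mem_orbit_iff_sameOrbit hv).symm
  exact (hfin p0).union ((hfin p2).union ((hfin (pe s2)).union (hfin (pe (-s2)))))

theorem isIsolated_iff_isNode (lam : ℂ) (p : ℙ ℂ V) :
    IsIsolatedSingularPoint (pencil lam) p ↔ IsNode (pencil lam) p := by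
  rw [isNode_iff (isHomogeneous_pencil lam)]
  constructor
  · intro h
    exact nodeAt_of_singAt (eval_q_ne_zero_of_isIsolated h) (isSingularPoint_iff.mp h.1)
  · intro h
    -- off the quadric there are only finitely many singular points
    refine isIsolated_of_finite (isHomogeneous_pencil lam) (isSingularPoint_iff.mpr h.1)
      {w | eval w q ≠ 0} ?_ (eval_q_ne_zero_of_nodeAt p.rep_nonzero h) _ finite_isNodal ?_
    · exact isOpen_ne_fun (MvPolynomial.continuous_eval q) continuous_const
    · intro w hwq hw hs
      obtain ⟨c, hc, h⟩ := rep_mk_eq_smul w hw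
      rw [Set.mem_ofPred_eq, h]
      exact IsNodal.of_sameOrbit (sameOrbit_smul_left hc w) (isNodal_of_singAt hwq hs)

theorem not_isIsolated_q_pow (p : ℙ ℂ V) : ¬IsIsolatedSingularPoint (q ^ 6) p := by
  intro h
  obtain ⟨w, hw, hl⟩ := exists_line_of_singAt_q_pow p.rep_nonzero (isSingularPoint_iff.mp h.1)
  exact not_isIsolated_of_line isHomogeneous_q_pow hw hl h

theorem exists_isIsolated_of_nodeAt {lam : ℂ} {v : V} (hv : v ≠ 0) (h : NodeAt (pencil lam) v) :
    ∃ p, IsIsolatedSingularPoint (pencil lam) p := by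
  refine ⟨Projectivization.mk ℂ v hv, (isIsolated_iff_isNode _ _).mpr
    ((isNode_iff (isHomogeneous_pencil lam)).mpr ?_)⟩
  obtain ⟨c, hc, hr⟩ := rep_mk_eq_smul v hv
  rw [hr]
  exact h.smul (isHomogeneous_pencil lam) hc

/-- If the singular points off the quadric lie in the orbit of the node given by the real
vector `x`, then the nodes are this orbit, and its length and the fix groups are determined by the
action on the diagonals of the cube. -/
theorem nodesFormOrbit_of_realVec {x : ℍ[ℝ]} (hx : x ≠ 0) {lam : ℂ}
    (hnode : NodeAt (pencil lam) (realVec x))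
    (honly : ∀ v, eval v q ≠ 0 → SingAt (pencil lam) v → SameOrbit v (realVec x))
    {H : Type} [Group H] (e : Nonempty ((pairPerm x).range ≃* H)) {n : ℕ}
    (hn : n * (2 * Nat.card H) = 2880) : NodesFormOrbit (pencil lam) n H := by
  set p := Projectivization.mk ℂ (realVec x) (realVec_ne_zero hx) with hp
  have hnodes : nodes (pencil lam) = MulAction.orbit icosaOcta p := by
    ext r
    change IsNode (pencil lam) r ↔ _
    rw [isNode_iff (isHomogeneous_pencil lam), mem_orbit_iff_sameOrbit]
    exact ⟨fun h => honly _ (eval_q_ne_zero_of_nodeAt r.rep_nonzero h) h.1,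
      fun h => hnode.of_sameOrbit h.symm⟩
  obtain ⟨e⟩ := e
  obtain ⟨e'⟩ := nonempty_fixGroupModSigns_equiv hx
  refine ⟨⟨p, hnodes⟩, ?_, ?_⟩
  · have h1 := ncard_orbit_mul (p := p)
    rw [Nat.card_congr (e'.trans e).toEquiv, ← hn] at h1
    rw [hnodes]
    refine Nat.eq_of_mul_eq_mul_right (Nat.pos_of_ne_zero fun h => ?_) h1
    rw [h, mul_zero] at hn
    norm_num at hn
  · rw [hnodes]
    rintro _ ⟨⟨g, hg⟩, rfl⟩
    obtain ⟨f⟩ := nonempty_fixGroupModSigns_smul hg p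
    exact ⟨f.symm.trans (e'.trans e)⟩

/-- The orbit of a singular point off the quadric is determined by the parameter, because the four
orbits impose different values of it. -/
theorem sameOrbit_of_singAt {lam : ℂ} {v : V} (hq : eval v q ≠ 0) (h : SingAt (pencil lam) v) :
    (lam = 0 → SameOrbit v p0) ∧ (lam = -1 / 8 → SameOrbit v p2) ∧
      (lam = c2 → SameOrbit v (pe s2)) ∧ (lam = c1 → SameOrbit v (pe (-s2))) := by
  have ht : (s5 * s2) ^ 2 = 10 := by
    rw [mul_pow, s5_sq, s2_sq]
    norm_num
  rw [c1_eq, c2_eq]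
  rcases isNodal_of_singAt hq h with ho | ho | ho | ho
  · have hl := eq_zero_of_eval_p0 (h.of_sameOrbit ho).1
    refine ⟨fun _ => ho, fun h => ?_, fun h => ?_, fun h => ?_⟩ <;> exfalso <;> rw [hl] at h
    · norm_num at h
    all_goals generalize s5 = s, s2 = t at *; clear * - ht h; grind
  · have hl := eq_of_eval_p2 (h.of_sameOrbit ho).1
    refine ⟨fun h => ?_, fun _ => ho, fun h => ?_, fun h => ?_⟩ <;> (try exfalso) <;> rw [hl] at h
    · norm_num at h
    all_goals generalize s5 = s, s2 = t at *; clear * - ht h; grind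
  · have hl := eq_of_eval_pe s2_sq (h.of_sameOrbit ho).1
    refine ⟨fun h => ?_, fun h => ?_, fun _ => ho, fun h => ?_⟩ <;> exfalso <;> rw [hl] at h <;>
    · generalize s5 = s, s2 = t at *; clear * - ht h; grind
  · have hl := eq_of_eval_pe neg_s2_sq (h.of_sameOrbit ho).1
    refine ⟨fun h => ?_, fun h => ?_, fun h => ?_, fun _ => ho⟩ <;> exfalso <;> rw [hl] at h <;>
    · generalize s5 = s, s2 = t at *; clear * - ht h; grind

theorem exists_isIsolated_iff (lam : ℂ) : (∃ p, IsIsolatedSingularPoint (pencil lam) p) ↔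
    lam = 0 ∨ lam = c1 ∨ lam = -1 / 8 ∨ lam = c2 := by
  constructor
  · rintro ⟨p, hp⟩
    have h := isSingularPoint_iff.mp hp.1
    rcases isNodal_of_singAt (eval_q_ne_zero_of_isIsolated hp) h with ho | ho | ho | ho
    · exact Or.inl (eq_zero_of_eval_p0 (h.of_sameOrbit ho).1)
    · exact Or.inr (Or.inr (Or.inl (eq_of_eval_p2 (h.of_sameOrbit ho).1)))
    · exact Or.inr (Or.inr (Or.inr
        ((eq_of_eval_pe s2_sq (h.of_sameOrbit ho).1).trans c2_eq.symm)))
    · exact Or.inr (Or.inl ((eq_of_eval_pe neg_s2_sq (h.of_sameOrbit ho).1).trans c1_eq.symm))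
  · have hpe : ∀ e, pe e ≠ 0 := fun e h => one_ne_zero (congrFun h 1)
    rintro (rfl | rfl | rfl | rfl)
    · exact exists_isIsolated_of_nodeAt (fun h => one_ne_zero (congrFun h 0)) nodeAt_p0
    · exact exists_isIsolated_of_nodeAt (hpe _) (nodeAt_pe neg_s2_sq c1_eq)
    · exact exists_isIsolated_of_nodeAt (fun h => one_ne_zero (congrFun h 1)) nodeAt_p2
    · exact exists_isIsolated_of_nodeAt (hpe _) (nodeAt_pe s2_sq c2_eq)

theorem nodesFormOrbit_zero : NodesFormOrbit (pencil 0) 120 (alternatingGroup (Fin 4)) := by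
  have hx : quat 1 0 0 0 ≠ 0 := fun h => one_ne_zero (congrArg (fun x : ℍ[ℝ] => x.re) h)
  refine nodesFormOrbit_of_realVec hx (p0_eq ▸ nodeAt_p0) (fun v hq h => ?_)
    ⟨MulEquiv.subgroupCongr range_pairPerm_one⟩ ?_
  · rw [← p0_eq]
    exact (sameOrbit_of_singAt hq h).1 rfl
  · rw [nat_card_alternatingGroup, Nat.card_fin]
    rfl

theorem nodesFormOrbit_neg_eighth : NodesFormOrbit (pencil (-1 / 8)) 360
    (Multiplicative (ZMod 2) × Multiplicative (ZMod 2)) := by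
  have hx : quat (1 + √2) 1 0 0 ≠ 0 :=
    fun h => one_ne_zero (congrArg (fun x : ℍ[ℝ] => x.imI) h)
  refine nodesFormOrbit_of_realVec hx (p2_eq ▸ nodeAt_p2) (fun v hq h => ?_)
    ⟨(MulEquiv.subgroupCongr range_pairPerm_two).trans
      (MonoidHom.ofInjective kleinHom_injective).symm⟩ ?_
  · rw [← p2_eq]
    exact (sameOrbit_of_singAt hq h).2.1 rfl
  · simp

theorem nodesFormOrbit_pe {e : ℝ} (he : e = √2 ∨ e = -√2) {lam : ℂ}
    (hnode : NodeAt (pencil lam) (pe e))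
    (honly : ∀ v, eval v q ≠ 0 → SingAt (pencil lam) v → SameOrbit v (pe e)) :
    NodesFormOrbit (pencil lam) 240 (DihedralGroup 3) := by
  have hx : quat (2 * e + √5) 1 (-1) 1 ≠ 0 :=
    fun h => one_ne_zero (congrArg (fun x : ℍ[ℝ] => x.imI) h)
  rw [pe_eq] at hnode
  simp only [pe_eq] at honly
  refine nodesFormOrbit_of_realVec hx hnode honly
    ⟨(MulEquiv.subgroupCongr (range_pairPerm_pe he)).trans
      (MonoidHom.ofInjective dihedralHom_injective).symm⟩ ?_
  rw [DihedralGroup.nat_card]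

theorem nodesFormOrbit_c1 : NodesFormOrbit (pencil c1) 240 (DihedralGroup 3) := by
  have hs : ((-√2 : ℝ) : ℂ) = -s2 := by rw [Complex.ofReal_neg, s2]
  refine nodesFormOrbit_pe (Or.inr rfl) ?_ fun v hq h => ?_ <;> rw [hs]
  · exact nodeAt_pe neg_s2_sq c1_eq
  · exact (sameOrbit_of_singAt hq h).2.2.2 rfl

theorem nodesFormOrbit_c2 : NodesFormOrbit (pencil c2) 240 (DihedralGroup 3) :=
  nodesFormOrbit_pe (Or.inl rfl) (nodeAt_pe s2_sq c2_eq) fun _ hq h =>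
    (sameOrbit_of_singAt hq h).2.2.1 rfl

end IOPencil

end

open IOPencil in
theorem mainTheorem5 :
    (∀ g ∈ icosaOcta, IsInvariant g q ∧ IsInvariant g invForm) ∧
    (∀ lam : ℂ, (∃ p, IsIsolatedSingularPoint (pencil lam) p) ↔
      lam = 0 ∨ lam = c1 ∨ lam = -1 / 8 ∨ lam = c2) ∧
    (¬ ∃ p, IsIsolatedSingularPoint (q ^ 6) p) ∧
    (∀ lam : ℂ, ∀ p, IsIsolatedSingularPoint (pencil lam) p ↔ IsNode (pencil lam) p) ∧
    NodesFormOrbit (pencil 0) 120 (alternatingGroup (Fin 4)) ∧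
    NodesFormOrbit (pencil c1) 240 (DihedralGroup 3) ∧
    NodesFormOrbit (pencil (-1 / 8)) 360 (Multiplicative (ZMod 2) × Multiplicative (ZMod 2)) ∧
    NodesFormOrbit (pencil c2) 240 (DihedralGroup 3) :=
  ⟨fun _ hg => ⟨isInvariant_q hg, isInvariant_invForm hg⟩, exists_isIsolated_iff,
    fun ⟨p, hp⟩ => not_isIsolated_q_pow p hp, isIsolated_iff_isNode, nodesFormOrbit_zero,
    nodesFormOrbit_c1, nodesFormOrbit_neg_eighth, nodesFormOrbit_c2⟩
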